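/- Let $p$ be a prime, $K/\mathbb{Q}_p$ a finite extension, $K_0\subseteq K$ its maximal unramified subextension with Frobenius lift $\phi$, $f=[K_0:\mathbb{Q}_p]$, $e=[K:K_0]$, and let $d\ge 1$. Let $A\subset \mathrm{GL}_d$ be the diagonal torus, $W=S_d$, and let $\nu=(\nu_\psi)_{\psi:K\hookrightarrow\bar{\mathbb{Q}}_p}$ be a dominant cocharacter of $(\mathrm{Res}_{K/\mathbb{Q}_p}A_K)_{\bar{\mathbb{Q}}_p}$, i.e. $\nu_\psi\in\mathbb{Z}^d$ is nonincreasing for every $\psi$. Let $E\subset\bar{\mathbb{Q}}_p$ be its reflex field and $\mathrm{Gr}_{K,\nu}$ the flag variety over $E$ parametrizing filtrations of type $\nu$, i.e. decreasing filtrations $\mathcal{F}^\bullet$ of $\mathcal{O}\otimes_{\mathbb{Q}_p}K^d$ such that $\dim\mathrm{gr}_i\mathcal{F}_\psi^\bullet$ is the multiplicity of $i$ in $\nu_\psi$ for all $\psi$ and $i$. Let $$\widetilde\alpha:\ (\mathrm{Res}_{K_0/\mathbb{Q}_p}\mathrm{GL}_d)_E\times\mathrm{Gr}_{K,\nu}\longrightarrow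 (A/W)_E=(\mathbb{A}^{d-1}\times\mathbb{G}_m)_E$$ be the map sending $(g,\mathcal{F}^\bullet)$ to the coefficients $(c_1,\dots,c_d)$ of the characteristic polynomial $T^d+c_1T^{d-1}+\dots+c_d$ of $(g(\mathrm{id}\otimes\phi))^f$, and $\widetilde\alpha^{\mathrm{an}}$ its analytification (Berkovich spaces over $E$). For $x\in (A/W)^{\mathrm{an}}$ let $(\widetilde\alpha^{\mathrm{an}})^{-1}(x)^{\mathrm{wa}}$ be the set of points $z$ of the fibre over $x$ for which the $K$-filtered isocrystal with coefficients in the residue field $\mathscr{H}(z)$ given by $(g,\mathcal{F}^\bullet)$ is weakly admissible. For each $\psi$ let $x_{\psi,1}>\dots>x_{\psi,r}$ ($r=r_\psi$) be the distinct entries of $\nu_\psi$ (the jumps of $\mathcal{F}_\psi^\bullet$), let $n_{\psi,j}$ be the number of entries of $\nu_\psi$ that are $\ge x_{\psi,j}$ (the rank of $\mathcal{F}_\psi^{x_{\psi,j}}$), and for $0\le i\le d$ put $$l_i=\sum_\psi\frac{1}{ef}\Big(\sum_{j=1}^{r-1}(x_{\psi,j}-x_{\psi,j+1})\max(0,n_{\psi,j}+i-d)+x_{\psi,r}\,i\Big).$$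 Write $\mathfrak{a}=X_*(A)\otimes\mathbb{R}=\mathbb{R}^d$, $\mathfrak{a}_{\mathrm{dom}}$ for its dominant elements, and $\langle\omega_i,y\rangle=y_1+\dots+y_i$. Let $\mu(\nu)\in\mathbb{Q}^d\subset\mathfrak{a}$ be the element with $\frac1f\langle\omega_i,\mu(\nu)\rangle=-l_i$ for $1\le i\le d$. For $c\in(A/W)^{\mathrm{an}}$ put $d_c=(-v_c(c_1),\dots,-v_c(c_d))\in(\mathbb{R}\cup\{-\infty\})^{d-1}\times\mathbb{R}$, where $v_c$ is the additive valuation of $\mathscr{H}(c)$ with $v_c(p)=1$. Let $r:\mathfrak{a}\to\mathfrak{a}_{\mathrm{dom}}$ map an element to the nearest dominant element, extended continuously to $(\mathbb{R}\cup\{-\infty\})^{d-1}\times\mathbb{R}\supset\mathfrak{a}$, where $\mathfrak{a}$ is embedded by $y\mapsto(\langle\omega_i,y\rangle)_i$. For $\mu\in\mathfrak{a}_{\mathrm{dom}}$ the closed Newton stratum is $(A/W)^{\mathrm{an}}_{\le\mu}=\{c\mid r(d_c)\le\mu\}$ for the dominance order. Theorem. The coweight $\mu(\nu)$ is dominant,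 and for every $x\in(A/W)^{\mathrm{an}}$ $$(\widetilde\alpha^{\mathrm{an}})^{-1}(x)^{\mathrm{wa}}\neq\emptyset\iff x\in(A/W)^{\mathrm{an}}_{\le\mu(\nu)}.$$ -/

import Mathlib

open scoped TensorProduct Topology

noncomputable section

namespace FilteredPhi

/-! ### The base fields -/

section BaseField

variable (p : ℕ) [Fact p.Prime] (K : Type*) [Field K] [Algebra ℚ_[p] K]

/-- A subextension `M` of `K / ℚ_p` is unramified if its value group (for the unique extension of
the `p`-adic absolute value) is that of `ℚ_p`, i.e. is `p ^ ℤ`. (Residue fields of finite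
extensions of `ℚ_p` are finite, so separability of the residue extension is automatic.) -/
def IsUnramifiedSubextension (M : IntermediateField ℚ_[p] K) : Prop :=
  ∀ x ∈ M, x ≠ 0 → ∃ n : ℤ, spectralNorm ℚ_[p] K x = (p : ℝ) ^ n

/-- `K₀`, the maximal unramified extension of `ℚ_p` inside `K`: the compositum of all
unramified subextensions. -/
def maxUnramified : IntermediateField ℚ_[p] K :=
  sSup {M | IsUnramifiedSubextension p K M}

/-- `f = [K₀ : ℚ_p]`. -/
def inertiaDeg : ℕ := Module.finrank ℚ_[p] (maxUnramified p K)

/-- `e = [K : K₀]`. -/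
def ramIdx : ℕ := Module.finrank (maxUnramified p K) K

variable {p K} in
/-- `φ` is the lift to `K₀` of the absolute Frobenius `y ↦ y ^ p` of the residue field:
`φ x ≡ x ^ p` modulo the maximal ideal, for all integral `x`. -/
def IsFrobeniusLift (φ : maxUnramified p K ≃ₐ[ℚ_[p]] maxUnramified p K) : Prop :=
  ∀ x : maxUnramified p K, spectralNorm ℚ_[p] K (x : K) ≤ 1 →
    spectralNorm ℚ_[p] K ((φ x - x ^ p : maxUnramified p K) : K) < 1

end BaseField

/-! ### Dominant cocharacters of `Res_{K/ℚ_p} A` and their reflex fields -/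

section Cocharacter

variable (p : ℕ) [Fact p.Prime] (K : Type*) [Field K] [Algebra ℚ_[p] K] (d : ℕ)

/-- A cocharacter of `(Res_{K/ℚ_p} A)` over `ℚ̄_p` (with `A ⊆ GL_d` the diagonal torus): one
cocharacter `λ ↦ diag(λ ^ ν_{ψ,1}, …, λ ^ ν_{ψ,d})` for every embedding `ψ : K → ℚ̄_p`. It is
dominant for the upper triangular Borel if every `ν_ψ` is nonincreasing. -/
structure DominantCocharacter where
  toFun : (K →ₐ[ℚ_[p]] PadicAlgCl p) → Fin d → ℤ
  dominant : ∀ ψ, Antitone (toFun ψ)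

variable {p K d}

/-- The stabilizer of `ν` in `Gal(ℚ̄_p / ℚ_p)`. -/
def DominantCocharacter.stabilizer (ν : DominantCocharacter p K d) :
    Subgroup (PadicAlgCl p ≃ₐ[ℚ_[p]] PadicAlgCl p) where
  carrier := {σ | ∀ ψ : K →ₐ[ℚ_[p]] PadicAlgCl p,
    ν.toFun ((σ : PadicAlgCl p →ₐ[ℚ_[p]] PadicAlgCl p).comp ψ) = ν.toFun ψ}
  one_mem' := fun _ => rfl
  mul_mem' := fun {σ τ} hσ hτ ψ =>
    (hσ ((τ : PadicAlgCl p →ₐ[ℚ_[p]] PadicAlgCl p).comp ψ)).trans (hτ ψ)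
  inv_mem' := fun {σ} hσ ψ => by
    have h := hσ (((σ⁻¹ : PadicAlgCl p ≃ₐ[ℚ_[p]] PadicAlgCl p) :
      PadicAlgCl p →ₐ[ℚ_[p]] PadicAlgCl p).comp ψ)
    rw [← h]
    congr 1
    ext x
    exact σ.apply_symm_apply (ψ x)

/-- The reflex field `E ⊆ ℚ̄_p` of `ν`: its field of definition. -/
def DominantCocharacter.reflexField (ν : DominantCocharacter p K d) :
    IntermediateField ℚ_[p] (PadicAlgCl p) :=
  IntermediateField.fixedField ν.stabilizer

/-- The jumps `x_{ψ,1} > x_{ψ,2} > … > x_{ψ,r}` of a filtration of type `ν` at `ψ`,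
in decreasing order. -/
def DominantCocharacter.jumps (ν : DominantCocharacter p K d)
    (ψ : K →ₐ[ℚ_[p]] PadicAlgCl p) : List ℤ :=
  (Finset.univ.image (ν.toFun ψ)).sort (fun a b => b ≤ a)

/-- The rank of the step `ℱ_ψ ^ x` of a filtration of type `ν`. -/
def DominantCocharacter.stepRank (ν : DominantCocharacter p K d)
    (ψ : K →ₐ[ℚ_[p]] PadicAlgCl p) (x : ℤ) : ℕ :=
  (Finset.univ.filter fun k : Fin d => x ≤ ν.toFun ψ k).card

/-- The summand of `l_i` at `ψ`:
`∑_{j=1}^{r-1} (x_{ψ,j} - x_{ψ,j+1}) max(0, n_{ψ,j} + i - d) + x_{ψ,r} i`,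
where `n_{ψ,j}` is the rank of `ℱ_ψ ^ {x_{ψ,j}}` (the list of jumps is indexed from `0`). -/
def DominantCocharacter.localDeg (ν : DominantCocharacter p K d)
    (ψ : K →ₐ[ℚ_[p]] PadicAlgCl p) (i : ℕ) : ℤ :=
  (∑ j ∈ Finset.range ((ν.jumps ψ).length - 1),
      ((ν.jumps ψ).getD j 0 - (ν.jumps ψ).getD (j + 1) 0) *
        max 0 ((ν.stepRank ψ ((ν.jumps ψ).getD j 0) : ℤ) + i - d)) +
    (ν.jumps ψ).getD ((ν.jumps ψ).length - 1) 0 * i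

/-- The rational numbers `l_i`, `0 ≤ i ≤ d`. -/
def DominantCocharacter.l [FiniteDimensional ℚ_[p] K] (ν : DominantCocharacter p K d) (i : ℕ) :
    ℚ :=
  ∑ ψ : K →ₐ[ℚ_[p]] PadicAlgCl p, (1 / ((ramIdx p K : ℚ) * inertiaDeg p K)) * ν.localDeg ψ i

end Cocharacter

/-! ### Coweights of `GL_d` and Newton strata in the adjoint quotient -/

section Coweights

variable {d : ℕ}

/-- `𝔞 = X_*(A) ⊗ ℝ = ℝ ^ d`, with its Weyl group invariant Euclidean metric. -/
abbrev Coweight (d : ℕ) : Type := EuclideanSpace ℝ (Fin d)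

/-- The dominant elements: `⟨α_i, μ⟩ = μ_i - μ_{i+1} ≥ 0` for all simple roots. -/
def dominantCone (d : ℕ) : Set (Coweight d) := {μ | Antitone fun i => μ i}

/-- The pairing with the weight `(1, …, 1, 0, …, 0)` with `i + 1` ones; as the index set `Fin d`
starts at `0`, this is the weight usually called `ω_{i+1}`. -/
def omegaPairing (i : Fin d) (μ : Coweight d) : ℝ := ∑ k ∈ Finset.Iic i, μ k

/-- The dominance order: `μ' - μ` is a nonnegative real combination of simple coroots. -/
def DominanceLE (μ μ' : Coweight d) : Prop :=
  (∀ i, omegaPairing i μ ≤ omegaPairing i μ') ∧ ∑ k, μ k = ∑ k, μ' k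

theorem isClosed_dominantCone (d : ℕ) : IsClosed (dominantCone d) := by
  have h : dominantCone d = ⋂ (i : Fin d) (j : Fin d) (_ : i ≤ j), {μ : Coweight d | μ j ≤ μ i} := by
    ext μ
    simp [dominantCone, Antitone]
  rw [h]
  exact isClosed_iInter fun i => isClosed_iInter fun j => isClosed_iInter fun _ =>
    isClosed_le (by fun_prop) (by fun_prop)

theorem exists_nearest_dominant (x : Coweight d) :
    ∃ y ∈ dominantCone d, ∀ z ∈ dominantCone d, dist x y ≤ dist x z := by
  obtain ⟨y, hy, h⟩ := (isClosed_dominantCone d).exists_infDist_eq_dist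
    ⟨0, fun _ _ _ => le_rfl⟩ x
  exact ⟨y, hy, fun z hz => h ▸ Metric.infDist_le_dist_of_mem hz⟩

/-- The retraction `r : 𝔞 → 𝔞_dom` sending `x` to the dominant element nearest to `x`
(unique because `𝔞_dom` is closed and convex). -/
def retraction (x : Coweight d) : Coweight d := (exists_nearest_dominant x).choose

/-- The embedding of `𝔞` into `ℝ̃ ^ {d-1} × ℝ`, `ℝ̃ = ℝ ∪ {-∞}`, by the coordinates `⟨ω_i, ·⟩`.
(The target is regarded as a subspace of `EReal ^ d`.) -/
def toExtended (x : Coweight d) : Fin d → EReal := fun i => (omegaPairing i x : EReal)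

/-- `y` is the value at `D ∈ ℝ̃ ^ {d-1} × ℝ` of the continuous extension of the retraction `r`,
i.e. the limit of `r x` as `x ∈ 𝔞` tends to `D`. -/
def IsExtendedRetraction (D : Fin d → EReal) (y : Coweight d) : Prop :=
  Filter.Tendsto retraction (Filter.comap toExtended (𝓝 D)) (𝓝 y)

/-- The points of the Berkovich space `(A/W)^an` over the normed field `E`, where `A/W` is
`𝔸 ^ {d-1} × 𝔾_m` with coordinates `c_1, …, c_d` (the variable `X i`, `i : Fin d`, is `c_{i+1}`):
multiplicative seminorms on `E[c_1, …, c_d, c_d⁻¹]` extending the norm of `E`, or equivalently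
such seminorms on `E[c_1, …, c_d]` that do not vanish at `c_d`. -/
structure AdjointQuotientAn (E : Type*) [NormedField E] (d : ℕ) where
  seminorm : MulRingSeminorm (MvPolynomial (Fin d) E)
  map_C : ∀ a : E, seminorm (MvPolynomial.C a) = ‖a‖
  last_ne_zero : ∀ i : Fin d, (i : ℕ) + 1 = d → seminorm (MvPolynomial.X i) ≠ 0

variable {E : Type*} [NormedField E]

/-- The vector `d_c = (-v_c(c_1), …, -v_c(c_d))`, where `v_c` is the additive valuation of the
residue field at `c`, normalized by `v_c(p) = 1`. -/
def AdjointQuotientAn.negVal (p : ℕ) (c : AdjointQuotientAn E d) : Fin d → EReal := fun i =>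
  if c.seminorm (MvPolynomial.X i) = 0 then ⊥
  else (Real.logb p (c.seminorm (MvPolynomial.X i)) : EReal)

/-- The closed Newton stratum `(A/W)_{≤ μ} = {c | r(d_c) ≤ μ}`. -/
def closedNewtonStratum (p : ℕ) (E : Type*) [NormedField E] (μ : Coweight d) :
    Set (AdjointQuotientAn E d) :=
  {c | ∃ y, IsExtendedRetraction (c.negVal p) y ∧ DominanceLE y μ}

end Coweights

section MuNu

variable {p : ℕ} [Fact p.Prime] {K : Type*} [Field K] [Algebra ℚ_[p] K]
  [FiniteDimensional ℚ_[p] K] {d : ℕ}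

/-- The rational coweight `μ(ν)`, determined by `(1/f) ⟨ω_i, μ(ν)⟩ = - l_i` for `1 ≤ i ≤ d`;
as `l_0 = 0`, its entries are `-f (l_i - l_{i-1})`. -/
def DominantCocharacter.mu (ν : DominantCocharacter p K d) : Fin d → ℚ := fun i =>
  -(inertiaDeg p K : ℚ) * (ν.l ((i : ℕ) + 1) - ν.l i)

/-- `μ(ν)` as an element of `𝔞`. -/
def DominantCocharacter.muReal (ν : DominantCocharacter p K d) : Coweight d :=
  WithLp.toLp 2 fun i => (ν.mu i : ℝ)

end MuNu

/-! ### Filtered isocrystals with coefficients -/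

section FilteredIsocrystals

variable {p : ℕ} [Fact p.Prime] {K : Type*} [Field K] [Algebra ℚ_[p] K] {d : ℕ}
  (L : Type*) [NormedField L] [Algebra ℚ_[p] L]

variable (p K) in
/-- The coefficient ring `L ⊗_{ℚ_p} K₀`. -/
abbrev CoeffRing : Type _ := L ⊗[ℚ_[p]] (maxUnramified p K)

variable (p K) in
/-- The natural map `L ⊗_{ℚ_p} K₀ → L ⊗_{ℚ_p} K`. -/
def coeffIncl : CoeffRing p K L →ₐ[L] L ⊗[ℚ_[p]] K :=
  Algebra.TensorProduct.map (AlgHom.id L L) (maxUnramified p K).val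

variable {L}

/-- The semilinear bijection `Φ_g = g (id ⊗ φ)` of `D = (L ⊗ K₀) ^ d`, as an `L`-linear map. -/
def frob (φ : maxUnramified p K ≃ₐ[ℚ_[p]] maxUnramified p K)
    (g : GL (Fin d) (CoeffRing p K L)) :
    (Fin d → CoeffRing p K L) →ₗ[L] (Fin d → CoeffRing p K L) :=
  ((Matrix.mulVecLin (g : Matrix (Fin d) (Fin d) (CoeffRing p K L))).restrictScalars L) ∘ₗ
    LinearMap.compLeft (Algebra.TensorProduct.map (AlgHom.id L L)
      (φ : maxUnramified p K →ₐ[ℚ_[p]] maxUnramified p K)).toLinearMap (Fin d)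

/-- The matrix, in the standard basis, of the `L ⊗ K₀`-linear map `Φ_g ^ f`. -/
def frobPowMatrix (φ : maxUnramified p K ≃ₐ[ℚ_[p]] maxUnramified p K)
    (g : GL (Fin d) (CoeffRing p K L)) : Matrix (Fin d) (Fin d) (CoeffRing p K L) :=
  Matrix.of fun i j => ((frob φ g) ^ inertiaDeg p K) (Pi.single j 1) i

/-- `P ∈ L[T]` is the characteristic polynomial of `Φ_g ^ f`. (This polynomial is a priori an
element of `(L ⊗ K₀)[T]`; it is invariant under `id ⊗ φ` and hence comes from a unique `P`.) -/
def IsFrobCharpoly (φ : maxUnramified p K ≃ₐ[ℚ_[p]] maxUnramified p K)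
    (g : GL (Fin d) (CoeffRing p K L)) (P : Polynomial L) : Prop :=
  P.map (algebraMap L (CoeffRing p K L)) = (frobPowMatrix φ g).charpoly

variable (p K d L) in
/-- A descending, exhaustive and separated `ℤ`-filtration of `D_K = (L ⊗ K) ^ d` by
`L ⊗ K`-submodules. -/
structure Filtration where
  step : ℤ → Submodule (L ⊗[ℚ_[p]] K) (Fin d → L ⊗[ℚ_[p]] K)
  antitone : Antitone step
  exhaustive : ∃ i, step i = ⊤
  separated : ∃ i, step i = ⊥

/-- For a submodule `D' ⊆ D = (L ⊗ K₀) ^ d`, the submodule `D'_K = D' ⊗_{K₀} K` of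
`D_K = (L ⊗ K) ^ d`. -/
def extendToK (D' : Submodule (CoeffRing p K L) (Fin d → CoeffRing p K L)) :
    Submodule (L ⊗[ℚ_[p]] K) (Fin d → L ⊗[ℚ_[p]] K) :=
  Submodule.span _ ((fun v k => coeffIncl p K L (v k)) '' (D' : Set (Fin d → CoeffRing p K L)))

/-- The degree `∑_i (1 / ef) · i · dim_L gr_i` of the filtration induced by `F` on `D'_K`. -/
def filtrationDegree (F : Filtration p K d L)
    (D' : Submodule (CoeffRing p K L) (Fin d → CoeffRing p K L)) : ℝ :=
  ∑ᶠ i : ℤ, (1 / ((ramIdx p K : ℝ) * inertiaDeg p K)) * i *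
    ((Module.finrank L ↥(F.step i ⊓ extendToK D') : ℝ) -
      (Module.finrank L ↥(F.step (i + 1) ⊓ extendToK D') : ℝ))

/-- `D'` is stable under `Φ_g`. -/
def IsStable (φ : maxUnramified p K ≃ₐ[ℚ_[p]] maxUnramified p K)
    (g : GL (Fin d) (CoeffRing p K L))
    (D' : Submodule (CoeffRing p K L) (Fin d → CoeffRing p K L)) : Prop :=
  ∀ v ∈ D'.restrictScalars L, frob φ g v ∈ D'.restrictScalars L

/-- `det_L (Φ_g ^ f | D')` for a `Φ_g`-stable submodule `D'`. -/
def frobPowDet (φ : maxUnramified p K ≃ₐ[ℚ_[p]] maxUnramified p K)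
    (g : GL (Fin d) (CoeffRing p K L))
    (D' : Submodule (CoeffRing p K L) (Fin d → CoeffRing p K L)) (h : IsStable φ g D') : L :=
  LinearMap.det (M := ↥(D'.restrictScalars L)) (((frob φ g).restrict h) ^ inertiaDeg p K)

/-- The (multiplicatively written) degree of the subobject `D'`, with `Φ_g` and the induced
filtration: `deg = (|det_L (Φ_g ^ f | D')| ^ (1 / f²))⁻¹ · |p| ^ (deg F)`. -/
def degree (φ : maxUnramified p K ≃ₐ[ℚ_[p]] maxUnramified p K)
    (g : GL (Fin d) (CoeffRing p K L)) (F : Filtration p K d L)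
    (D' : Submodule (CoeffRing p K L) (Fin d → CoeffRing p K L)) (h : IsStable φ g D') : ℝ :=
  (‖frobPowDet φ g D' h‖ ^ (1 / (inertiaDeg p K : ℝ) ^ 2))⁻¹ *
    ‖(p : L)‖ ^ (filtrationDegree F D')

/-- The slope `deg ^ (1 / rk D')`; the rank of `D'` over `L ⊗ K₀` is `dim_L D' / f`. -/
def slope (φ : maxUnramified p K ≃ₐ[ℚ_[p]] maxUnramified p K)
    (g : GL (Fin d) (CoeffRing p K L)) (F : Filtration p K d L)
    (D' : Submodule (CoeffRing p K L) (Fin d → CoeffRing p K L)) (h : IsStable φ g D') : ℝ :=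
  degree φ g F D' h ^ (1 / ((Module.finrank L D' : ℝ) / inertiaDeg p K))

theorem isStable_top (φ : maxUnramified p K ≃ₐ[ℚ_[p]] maxUnramified p K)
    (g : GL (Fin d) (CoeffRing p K L)) : IsStable φ g ⊤ := fun _ _ => trivial

/-- The filtered isocrystal `((L ⊗ K₀) ^ d, Φ_g, F)` is weakly admissible: it is semi-stable (every
nonzero stable subobject has slope `≥` its own slope; valuations are multiplicative) of slope `1`. -/
def IsWeaklyAdmissible (φ : maxUnramified p K ≃ₐ[ℚ_[p]] maxUnramified p K)
    (g : GL (Fin d) (CoeffRing p K L)) (F : Filtration p K d L) : Prop :=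
  (∀ (D' : Submodule (CoeffRing p K L) (Fin d → CoeffRing p K L)) (h : IsStable φ g D'),
      D' ≠ ⊥ → slope φ g F ⊤ (isStable_top φ g) ≤ slope φ g F D' h) ∧
    slope φ g F ⊤ (isStable_top φ g) = 1

/-- The map `L ⊗_{ℚ_p} K → L̄` induced by an embedding `ψ : K → ℚ̄_p` and a homomorphism
`ι : ℚ̄_p → L̄`. -/
def componentMap (ι : PadicAlgCl p →ₐ[ℚ_[p]] AlgebraicClosure L)
    (ψ : K →ₐ[ℚ_[p]] PadicAlgCl p) : L ⊗[ℚ_[p]] K →ₐ[L] AlgebraicClosure L :=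
  Algebra.TensorProduct.lift (Algebra.ofId L (AlgebraicClosure L)) (ι.comp ψ)
    fun _ _ => Commute.all _ _

/-- The component at `ψ` of a submodule `N ⊆ (L ⊗ K) ^ d`, i.e. the factor at `ψ` of
`N ⊗_L L̄ ⊆ ∏_ψ L̄ ^ d`. -/
def component (ι : PadicAlgCl p →ₐ[ℚ_[p]] AlgebraicClosure L)
    (ψ : K →ₐ[ℚ_[p]] PadicAlgCl p) (N : Submodule (L ⊗[ℚ_[p]] K) (Fin d → L ⊗[ℚ_[p]] K)) :
    Submodule (AlgebraicClosure L) (Fin d → AlgebraicClosure L) :=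
  Submodule.span _
    ((fun v k => componentMap ι ψ (v k)) '' (N : Set (Fin d → L ⊗[ℚ_[p]] K)))

/-- `F` is of type `ν`, i.e. is an `L`-valued point of the flag variety `Gr_{K,ν}` over the reflex
field `E` of `ν`: over an algebraic closure `L̄` of `L`, where `F` decomposes as `∏_ψ F_ψ`, the
dimension of `gr_i F_ψ` is the multiplicity of `i` in `ν_ψ`. Embeddings of `K` into `ℚ̄_p` and into
`L̄` are identified through an `E`-embedding `ℚ̄_p → L̄` (all choices give the same condition, since
`ν` is defined over `E`). -/
def Filtration.IsOfType (ν : DominantCocharacter p K d) [Algebra ν.reflexField L]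
    [IsScalarTower ℚ_[p] ν.reflexField L] (F : Filtration p K d L) : Prop :=
  ∀ (ι : PadicAlgCl p →ₐ[ν.reflexField] AlgebraicClosure L) (ψ : K →ₐ[ℚ_[p]] PadicAlgCl p) (i : ℤ),
    Module.finrank (AlgebraicClosure L) (component (ι.restrictScalars ℚ_[p]) ψ (F.step i)) =
      Module.finrank (AlgebraicClosure L)
          (component (ι.restrictScalars ℚ_[p]) ψ (F.step (i + 1))) +
        (Finset.univ.filter fun k : Fin d => ν.toFun ψ k = i).card

end FilteredIsocrystals

/-! ### The weakly admissible fibres over the adjoint quotient -/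

section Fibres

variable {p : ℕ} [Fact p.Prime] {K : Type*} [Field K] [Algebra ℚ_[p] K] {d : ℕ}

/-- Points of the analytic space attached to `(Res_{K₀/ℚ_p} GL_d)_E × Gr_{K,ν}` over the reflex
field `E` of `ν`, each represented by a point `(g, F)` with values in a complete nonarchimedean
field `L` whose norm extends the one of `E`. -/
structure AnPoint (ν : DominantCocharacter p K d) where
  L : Type
  [normedField : NormedField L]
  [ultrametric : IsUltrametricDist L]
  [complete : CompleteSpace L]
  [normedAlgebra : NormedAlgebra ν.reflexField L]
  [algebra : Algebra ℚ_[p] L]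
  [tower : IsScalarTower ℚ_[p] ν.reflexField L]
  g : GL (Fin d) (CoeffRing p K L)
  F : Filtration p K d L
  isOfType : F.IsOfType ν

attribute [instance] AnPoint.normedField AnPoint.ultrametric AnPoint.complete
  AnPoint.normedAlgebra AnPoint.algebra AnPoint.tower

variable {ν : DominantCocharacter p K d}

/-- `z` is mapped to `x` under the morphism to `(A/W)^an` which sends `(g, F)` to the coefficients
`(c_1, …, c_d)` of the characteristic polynomial `T ^ d + c_1 T ^ {d-1} + … + c_d` of `Φ_g ^ f`:
the seminorm `x` is `Q ↦ |Q(c_1, …, c_d)|`. -/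
def AnPoint.LiesOver (φ : maxUnramified p K ≃ₐ[ℚ_[p]] maxUnramified p K) (z : AnPoint ν)
    (x : AdjointQuotientAn ν.reflexField d) : Prop :=
  ∃ P : Polynomial z.L, IsFrobCharpoly φ z.g P ∧
    ∀ Q : MvPolynomial (Fin d) ν.reflexField,
      x.seminorm Q = ‖MvPolynomial.aeval (fun i : Fin d => P.coeff (d - ((i : ℕ) + 1))) Q‖

/-- The weakly admissible locus in the fibre over `x`. -/
def weaklyAdmissibleFibre (φ : maxUnramified p K ≃ₐ[ℚ_[p]] maxUnramified p K)
    (ν : DominantCocharacter p K d) (x : AdjointQuotientAn ν.reflexField d) :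
    Set (AnPoint ν) :=
  {z | z.LiesOver φ x ∧ IsWeaklyAdmissible φ z.g z.F}

end Fibres

end FilteredPhi

end

open scoped TensorProduct Topology

noncomputable section

namespace FilteredPhi

/-! ### Filtration degrees in terms of the entries of the cocharacter -/

section JumpSums

/-! Put `b i = -f l_i = ⟨ω_i, μ(ν)⟩` (`bound`). By Abel summation over the jumps, `l_i` is `1/(ef)`
times the sum over `ψ` of the `i` smallest entries of `ν_ψ`. Hence `b` is concave, which is the
dominance of `μ(ν)`. The prefix sums of `r(D)` form the least concave majorant of the points of `D`,
with the same end points; since `b` is concave, `r(d_c) ≤ μ(ν)` therefore means `|c_i| ≤ p ^ b i`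
for all `i`, with equality for `i = d` (`mem_closedNewtonStratum_iff`). What remains is to compare
weak admissibility with these bounds on the coefficients of the characteristic polynomial `P`.

In exponents, weak admissibility says `log_p |det(Φ_g^f | D')| ≤ -f² deg(F | D')` for every stable
`D' ≠ 0`, with equality for the whole module. Over an algebraic closure a submodule splits into
components indexed by embeddings. The Frobenius lift permutes the embeddings of `K₀` in one cycle,
so all components of a stable `D'` have one dimension `r` (`IsStable.exists_rank`). A step of rank
`n` meets such a component in dimension at least `max(0, n + r - d)`, which gives `deg(F | D') ≥
l_r` (`l_le_filtrationDegree`), with equality in general position.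

Necessity (`IsWeaklyAdmissible.norm_coeff_le`): given `j`, let `s` be the slope of a supporting line
of `b` at `j`, and split `P = Q R` into the factors whose roots have norm at least, respectively
less than, `p ^ s`. They are coprime, so `ker Q(Φ_g^f)` is a stable submodule of rank `deg Q`, and
weak admissibility yields `|Q(0)| ≤ p ^ b(deg Q)`. The Gauss norm of `P` at radius `p ^ s` is
governed by this vertex, and the supporting line carries the bound over to the coefficient with
index `j`.

Sufficiency (`exists_isWeaklyAdmissible`): a point of the stratum is defined over a complete
algebraically closed field `L`. Take `g` to be the companion matrix of `P` at one embedding of `K₀`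
and the identity at the others, so that `Φ_g^f` is the companion matrix everywhere, and let every
component of the filtration run through the standard flag. A subspace stable under a companion
matrix is in general position with respect to this flag, so `deg(F | D') ≤ l_r` for stable `D'` of
rank `r`. The determinant on `D'` is, up to sign, the constant coefficient of a monic divisor of `P
^ f`, and Gauss norms bound it by `p ^ (f b(r))`. -/

theorem _root_.List.sum_range_step_of_sortedGT (a : List ℤ) (ha : a.Pairwise (· > ·)) {v : ℤ}
    (hv : v ∈ a) :
    (∑ j ∈ Finset.range (a.length - 1), (a.getD j 0 - a.getD (j + 1) 0) *
      (if a.getD j 0 ≤ v then 1 else 0)) + a.getD (a.length - 1) 0 = v := by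
  induction a generalizing v with
  | nil => simp at hv
  | cons x t ih =>
    cases t with
    | nil => simp at hv; simp [hv]
    | cons y t =>
      have ht := (List.pairwise_cons.1 ha).2
      have hx := (List.pairwise_cons.1 ha).1
      simp only [List.length_cons, Nat.add_sub_cancel] at ih ⊢
      rw [Finset.sum_range_succ']
      simp only [List.getD_cons_succ, List.getD_cons_zero] at ih ⊢
      rcases List.mem_cons.1 hv with rfl | hv'
      -- At the head all indicators are `1`, as they are for the second entry `y`; the induction
      -- hypothesis for `y` thus evaluates the sum over the tail.
      · have hy := ih ht (v := y) (by simp)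
        have hlt := hx y (by simp)
        have : ∀ j ∈ Finset.range t.length, ((y :: t).getD j 0 - t.getD j 0) *
            (if (y :: t).getD j 0 ≤ v then (1 : ℤ) else 0) =
            ((y :: t).getD j 0 - t.getD j 0) *
            (if (y :: t).getD j 0 ≤ y then (1 : ℤ) else 0) := by
          intro j hj
          have hj' : j < (y :: t).length := by simp at hj ⊢; omega
          rw [List.getD_eq_getElem _ _ hj']
          have h1 := hx _ (List.getElem_mem hj')
          have h2 : (y :: t)[j] ≤ y := by
            rcases List.mem_cons.1 (List.getElem_mem hj') with h | h
            · exact h.le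
            · exact ((List.pairwise_cons.1 ht).1 _ h).le
          rw [if_pos (by omega), if_pos h2]
        rw [Finset.sum_congr rfl this, if_pos le_rfl]
        linarith
      · have := ih ht hv'
        have h3 := hx v hv'
        rw [if_neg (by omega)]
        omega

variable {d : ℕ}

theorem card_filter_rev_lt_eq_max (n i : ℕ) (hn : n ≤ d) (hi : i ≤ d) :
    (((Finset.univ.filter fun k : Fin d => d ≤ k + i ∧ (k : ℕ) < n).card : ℕ) : ℤ) =
      max 0 ((n : ℤ) + i - d) := by
  have : (Finset.univ.filter fun k : Fin d => d ≤ k + i ∧ (k : ℕ) < n).map Fin.valEmbedding =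
      Finset.Ico (d - i) n := by
    ext k
    simp only [Finset.mem_map, Finset.mem_filter, Finset.mem_univ, true_and, Fin.valEmbedding_apply,
      Finset.mem_Ico]
    constructor
    · rintro ⟨a, h, rfl⟩; omega
    · intro h; exact ⟨⟨k, by omega⟩, by simp; omega, rfl⟩
  rw [← Finset.card_map, this, Nat.card_Ico]
  omega

theorem le_iff_lt_card_of_antitone {v : Fin d → ℤ} (hv : Antitone v) (x : ℤ) (k : Fin d) :
    x ≤ v k ↔ (k : ℕ) < (Finset.univ.filter fun k : Fin d => x ≤ v k).card := by
  have key : ∀ m, x ≤ v m → (m : ℕ) < (Finset.univ.filter fun k : Fin d => x ≤ v k).card := by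
    intro m hm
    have : (Finset.Iic m) ⊆ (Finset.univ.filter fun k : Fin d => x ≤ v k) := by
      intro a ha
      simp at ha ⊢
      exact hm.trans (hv ha)
    have := Finset.card_le_card this
    simp at this
    omega
  refine ⟨key k, fun h => ?_⟩
  by_contra hk
  have : (Finset.univ.filter fun k : Fin d => x ≤ v k) ⊆ Finset.Iio k := by
    intro a ha
    simp at ha ⊢
    by_contra hc
    exact hk (ha.trans (hv (not_lt.1 hc)))
  have := Finset.card_le_card this
  simp at this
  omega

variable {p : ℕ} [Fact p.Prime] {K : Type*} [Field K] [Algebra ℚ_[p] K]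

/-- The last `i` indices of `Fin d`. -/
def lastIndices (d i : ℕ) : Finset (Fin d) := Finset.univ.filter fun k => d ≤ k + i

theorem card_lastIndices {i : ℕ} (hi : i ≤ d) : (lastIndices d i).card = i := by
  have := card_filter_rev_lt_eq_max (d := d) d i le_rfl hi
  simp only [Fin.is_lt, and_true] at this
  rw [lastIndices]
  omega

namespace DominantCocharacter

variable (ν : DominantCocharacter p K d) (ψ : K →ₐ[ℚ_[p]] PadicAlgCl p)

theorem stepRank_le (x : ℤ) : ν.stepRank ψ x ≤ d :=
  (Finset.card_le_univ _).trans (by simp)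

theorem max_stepRank (x : ℤ) {i : ℕ} (hi : i ≤ d) :
    max 0 ((ν.stepRank ψ x : ℤ) + i - d) =
      ∑ k ∈ lastIndices d i, if x ≤ ν.toFun ψ k then 1 else 0 := by
  rw [← card_filter_rev_lt_eq_max _ _ (ν.stepRank_le ψ x) hi, Finset.sum_boole, lastIndices,
    Finset.filter_filter]
  congr 3
  ext k
  rw [le_iff_lt_card_of_antitone (ν.dominant ψ) x k]
  rfl

/-- Each entry telescopes over the jumps from the smallest one up to it. Summing over the last `i`
indices and exchanging sums gives the formula, because `max(0, n + i - d)` counts the last `i`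
indices that lie among the first `n`. -/
theorem localDeg_eq_sum {i : ℕ} (hi : i ≤ d) :
    ν.localDeg ψ i = ∑ k ∈ lastIndices d i, ν.toFun ψ k := by
  have h1 : ∀ k : Fin d, _ := fun k => List.sum_range_step_of_sortedGT (ν.jumps ψ)
    (by
      have := Finset.sortedGT_sort (Finset.univ.image (ν.toFun ψ))
      exact this.pairwise)
    (v := ν.toFun ψ k) (by simp [jumps])
  rw [← Finset.sum_congr rfl fun k _ => h1 k, Finset.sum_add_distrib, Finset.sum_comm, localDeg]
  simp only [max_stepRank ν ψ _ hi, Finset.mul_sum, Finset.sum_const, card_lastIndices hi]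
  simp [mul_comm]

end DominantCocharacter

end JumpSums

/-- Supporting line of a discrete concave function. It serves both for the polygon of `μ(ν)` and for
the prefix sums of dominant coweights. -/
theorem le_add_mul_of_concave_steps {b : ℕ → ℝ} {c : ℝ} {j d : ℕ}
    (h₁ : ∀ n, j ≤ n → n < d → b (n + 1) - b n ≤ c) (h₂ : ∀ n < j, c ≤ b (n + 1) - b n)
    {i : ℕ} (hi : i ≤ d) : b i ≤ b j + c * ((i : ℝ) - j) := by
  rcases le_total j i with h | h
  · induction i, h using Nat.le_induction with
    | base => simp
    | succ n hn ih =>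
      have := h₁ n hn hi
      have := ih (by omega)
      push_cast
      linarith
  · clear hi
    induction h using Nat.decreasingInduction with
    | self => simp
    | of_succ n hn ih =>
      have := h₂ n hn
      push_cast at ih ⊢
      linarith

/-! ### Dominance of `μ(ν)` and its concave polygon -/

section MuProperties

variable {p : ℕ} [Fact p.Prime] {K : Type*} [Field K] [Algebra ℚ_[p] K]
  [FiniteDimensional ℚ_[p] K] {d : ℕ}

theorem inertiaDeg_pos : 0 < inertiaDeg p K := Module.finrank_pos

namespace DominantCocharacter

variable (ν : DominantCocharacter p K d)

theorem l_eq_sum {i : ℕ} (hi : i ≤ d) :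
    ν.l i = (1 / ((ramIdx p K : ℚ) * inertiaDeg p K)) *
      ((∑ ψ : K →ₐ[ℚ_[p]] PadicAlgCl p, ∑ k ∈ lastIndices d i, ν.toFun ψ k : ℤ) : ℚ) := by
  rw [l, ← Finset.mul_sum]
  push_cast
  simp only [localDeg_eq_sum ν _ hi]
  push_cast
  rfl

theorem l_zero : ν.l 0 = 0 := by
  rw [l_eq_sum ν (Nat.zero_le _)]
  have : lastIndices d 0 = ∅ := Finset.card_eq_zero.1 (card_lastIndices (Nat.zero_le _))
  simp [this]

theorem lastIndices_succ (i : Fin d) :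
    lastIndices d (i + 1) = insert (Fin.rev i) (lastIndices d i) := by
  ext k
  simp [lastIndices, Fin.ext_iff, Fin.val_rev]
  omega

/-- The set of last indices gains `Fin.rev i`. The increments of `l` thus read each `ν_ψ` backwards
and increase; the minus sign in `mu` turns this into dominance. -/
theorem l_succ_sub (i : Fin d) :
    ν.l (i + 1) - ν.l i = (1 / ((ramIdx p K : ℚ) * inertiaDeg p K)) *
      ∑ ψ : K →ₐ[ℚ_[p]] PadicAlgCl p, (ν.toFun ψ (Fin.rev i) : ℚ) := by
  rw [l_eq_sum ν i.2, l_eq_sum ν i.2.le, ← mul_sub]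
  push_cast
  rw [← Finset.sum_sub_distrib, lastIndices_succ]
  congr 2
  ext ψ
  rw [Finset.sum_insert]
  · ring
  · simp [lastIndices, Fin.val_rev]; omega

theorem antitone_mu : Antitone ν.mu := by
  intro i j hij
  simp only [mu, l_succ_sub, neg_mul]
  refine neg_le_neg (mul_le_mul_of_nonneg_left (mul_le_mul_of_nonneg_left ?_ (by positivity))
    (by positivity))
  refine Finset.sum_le_sum fun ψ _ => ?_
  exact_mod_cast ν.dominant ψ (Fin.rev_le_rev.2 hij)

theorem muReal_mem_dominantCone : ν.muReal ∈ dominantCone d := by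
  intro i j hij
  simp only [muReal]
  exact_mod_cast ν.antitone_mu hij

/-- The concave polygon `i ↦ ⟨ω_i, μ(ν)⟩ = - f l_i`. -/
def bound (i : ℕ) : ℝ := -(inertiaDeg p K : ℝ) * ν.l i

theorem bound_zero : ν.bound 0 = 0 := by simp [bound, l_zero]

theorem bound_succ_sub (i : Fin d) : ν.bound (i + 1) - ν.bound i = ν.muReal i := by
  simp [bound, muReal, mu]; ring

theorem omegaPairing_muReal (i : Fin d) : omegaPairing i ν.muReal = ν.bound (i + 1) := by
  have h : ∀ k : ℕ, (hk : k < d) →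
      ∑ j ∈ Finset.Iic (⟨k, hk⟩ : Fin d), ν.muReal j = ν.bound (k + 1) := by
    intro k
    induction k with
    | zero =>
      intro hk
      have : Finset.Iic (⟨0, hk⟩ : Fin d) = {⟨0, hk⟩} := by
        ext a; simp [Fin.ext_iff, Fin.le_def]
      rw [this, Finset.sum_singleton, ← bound_succ_sub]
      simp [bound_zero]
    | succ k ih =>
      intro hk
      have : Finset.Iic (⟨k + 1, hk⟩ : Fin d) =
          insert ⟨k + 1, hk⟩ (Finset.Iic ⟨k, by omega⟩) := by
        ext a; simp [Fin.ext_iff, Fin.le_def]; omega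
      rw [this, Finset.sum_insert (by simp [Fin.le_def]), ih, ← bound_succ_sub]
      simp
  exact h i i.2

/-- The number `p ^ s` is the radius at which Gauss norms are compared, in both directions of the
theorem. -/
theorem exists_supergradient {j : ℕ} (hj : j ≤ d) :
    ∃ s : ℝ, ∀ i ≤ d, ν.bound i ≤ ν.bound j + s * ((i : ℝ) - j) := by
  rcases Nat.eq_zero_or_pos d with rfl | hd
  · refine ⟨0, fun i hi => ?_⟩
    have : i = j := by omega
    simp [this]
  -- The slope is taken from the step to the right of `j`, or from the last step when `j = d`.
  obtain ⟨m, hm1, hm2⟩ : ∃ m : Fin d, (∀ k : Fin d, (k : ℕ) < j → k ≤ m) ∧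
      ∀ k : Fin d, j ≤ k → m ≤ k := by
    rcases hj.lt_or_eq with h | h
    · exact ⟨⟨j, h⟩, fun k hk => Fin.le_def.2 hk.le, fun k hk => Fin.le_def.2 hk⟩
    · refine ⟨⟨d - 1, by omega⟩, fun k hk => Fin.le_def.2 (by simp; omega), fun k hk => ?_⟩
      have := k.2
      omega
  refine ⟨ν.muReal m, fun i hi => ?_⟩
  have hmu := ν.muReal_mem_dominantCone
  refine le_add_mul_of_concave_steps (fun n hn hnd => ?_) (fun n hn => ?_) hi
  · exact (ν.bound_succ_sub ⟨n, hnd⟩).trans_le (hmu (hm2 ⟨n, hnd⟩ hn))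
  · exact (hmu (hm1 ⟨n, by omega⟩ hn)).trans (ν.bound_succ_sub ⟨n, by omega⟩).ge

end DominantCocharacter

end MuProperties

end FilteredPhi

namespace FilteredPhi

/-! ### The retraction as least concave majorant, and its continuous extension -/

section Retraction

variable {d : ℕ}

/-- The sum of the first `i` entries. -/
def prefixSum (x : Coweight d) (i : ℕ) : ℝ := ∑ k ∈ Finset.univ.filter fun k : Fin d => (k : ℕ) < i, x k

@[simp] theorem prefixSum_zero (x : Coweight d) : prefixSum x 0 = 0 := by simp [prefixSum]

theorem prefixSum_succ (x : Coweight d) (i : Fin d) :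
    prefixSum x (i + 1) = prefixSum x i + x i := by
  have : (Finset.univ.filter fun k : Fin d => (k : ℕ) < i + 1) =
      insert i (Finset.univ.filter fun k : Fin d => (k : ℕ) < i) := by
    ext k; simp [Fin.ext_iff]; omega
  rw [prefixSum, this, Finset.sum_insert (by simp), prefixSum, add_comm]

theorem omegaPairing_eq_prefixSum (i : Fin d) (x : Coweight d) :
    omegaPairing i x = prefixSum x (i + 1) := by
  have : Finset.Iic i = Finset.univ.filter fun k : Fin d => (k : ℕ) < i + 1 :=
    Finset.ext fun k => by
      rw [Finset.mem_Iic, Finset.mem_filter, Fin.le_def, Nat.lt_succ_iff]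
      simp
  rw [omegaPairing, prefixSum, this]

theorem prefixSum_dim (x : Coweight d) : prefixSum x d = ∑ k, x k := by simp [prefixSum]

/-- Pairing with these vectors turns the variational inequality of the projection into statements
about prefix sums. -/
theorem inner_indicator (x y : Coweight d) (c : ℝ) (i : ℕ) :
    inner ℝ (x - y) (WithLp.toLp 2 fun k : Fin d => if (k : ℕ) < i then c else 0) =
      c * (prefixSum x i - prefixSum y i) := by
  simp only [PiLp.inner_apply, prefixSum, ← Finset.sum_sub_distrib, Finset.mul_sum,
    Finset.sum_filter]
  refine Finset.sum_congr rfl fun k _ => ?_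
  split_ifs <;> simp

theorem convex_dominantCone (d : ℕ) : Convex ℝ (dominantCone d) := by
  intro x hx y hy a b ha hb _ i j hij
  have h1 := mul_le_mul_of_nonneg_left (hx hij) ha
  have h2 := mul_le_mul_of_nonneg_left (hy hij) hb
  simp only [PiLp.add_apply, PiLp.smul_apply, smul_eq_mul]
  simp only at h1 h2
  linarith

theorem retraction_mem (x : Coweight d) : retraction x ∈ dominantCone d :=
  (exists_nearest_dominant x).choose_spec.1

theorem inner_sub_retraction_nonpos (x : Coweight d) {w : Coweight d} (hw : w ∈ dominantCone d) :
    inner ℝ (x - retraction x) (w - retraction x) ≤ 0 := by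
  refine (norm_eq_iInf_iff_real_inner_le_zero (convex_dominantCone d) (retraction_mem x)).1 ?_ w hw
  have hr := (exists_nearest_dominant x).choose_spec
  refine le_antisymm ?_ ?_
  · have : Nonempty (dominantCone d) := ⟨⟨_, retraction_mem x⟩⟩
    refine le_ciInf fun w => ?_
    have := hr.2 w w.2
    rwa [dist_eq_norm, dist_eq_norm] at this
  · exact ciInf_le (f := fun w : dominantCone d => ‖x - w‖)
      ⟨0, by rintro _ ⟨w, rfl⟩; exact norm_nonneg _⟩ ⟨_, retraction_mem x⟩

/-- Adding `(1, …, 1, 0, …, 0)` preserves the dominant cone, so it is an admissible test direction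
at the projection. -/
theorem prefixSum_le_prefixSum_retraction (x : Coweight d) (i : ℕ) :
    prefixSum x i ≤ prefixSum (retraction x) i := by
  have h := inner_sub_retraction_nonpos x
    (w := retraction x + WithLp.toLp 2 fun k : Fin d => if (k : ℕ) < i then 1 else 0) ?_
  · rw [add_sub_cancel_left, inner_indicator] at h
    linarith
  · intro a b hab
    have h1 := retraction_mem x hab
    have := Fin.le_def.1 hab
    simp only [PiLp.add_apply] at h1 ⊢
    split_ifs <;> linarith

/-- Constant vectors of either sign are admissible directions; the negative one supplies the missing
inequality. -/
theorem prefixSum_retraction_dim (x : Coweight d) :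
    prefixSum (retraction x) d = prefixSum x d := by
  refine le_antisymm ?_ (prefixSum_le_prefixSum_retraction x d)
  have h := inner_sub_retraction_nonpos x
    (w := retraction x + WithLp.toLp 2 fun k : Fin d => if (k : ℕ) < d then -1 else 0) ?_
  · rw [add_sub_cancel_left, inner_indicator] at h
    linarith
  · intro a b hab
    have h1 := retraction_mem x hab
    simp only [PiLp.add_apply, Fin.is_lt, if_true] at h1 ⊢
    linarith

/-- If the projection dropped strictly after `i`, its first `i + 1` entries could be lowered by the
drop without leaving the cone. The variational inequality for that direction excludes a strict gap
between the prefix sums. -/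
theorem retraction_eq_of_prefixSum_ne (x : Coweight d) {i : ℕ} (hi : i + 1 < d)
    (h : prefixSum x (i + 1) ≠ prefixSum (retraction x) (i + 1)) :
    retraction x ⟨i, by omega⟩ = retraction x ⟨i + 1, hi⟩ := by
  set y := retraction x with hy
  have hlt := lt_of_le_of_ne (prefixSum_le_prefixSum_retraction x (i + 1)) h
  have hle := retraction_mem x (show (⟨i, by omega⟩ : Fin d) ≤ ⟨i + 1, hi⟩ from by simp [Fin.le_def])
  refine le_antisymm ?_ hle
  simp only at hle
  by_contra hc
  set c := y ⟨i + 1, hi⟩ - y ⟨i, by omega⟩ with hcdef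
  have hneg : c < 0 := by
    have := not_le.1 hc
    linarith
  have := inner_sub_retraction_nonpos x
    (w := y + WithLp.toLp 2 fun k : Fin d => if (k : ℕ) < i + 1 then c else 0) ?_
  · rw [← hy, add_sub_cancel_left, inner_indicator] at this
    nlinarith
  · intro a b hab
    have h1 := retraction_mem x hab
    have hab' := Fin.le_def.1 hab
    simp only [PiLp.add_apply, ← hy] at h1 ⊢
    split_ifs with h2 h3 h3
    · linarith
    · omega
    · have h4 := retraction_mem x (show b ≥ ⟨i + 1, hi⟩ from by rw [ge_iff_le, Fin.le_def]; simpa using h2)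
      have h5 := retraction_mem x (show a ≤ ⟨i, by omega⟩ from by
        rw [Fin.le_def]; exact Nat.lt_succ_iff.1 h3)
      simp only [← hy] at h4 h5
      linarith
    · linarith

theorem prefixSum_le_of_dominant {y : Coweight d} (hy : y ∈ dominantCone d) (i : Fin d) {k : ℕ}
    (hk : k ≤ d) : prefixSum y k ≤ prefixSum y i + y i * ((k : ℝ) - i) := by
  refine le_add_mul_of_concave_steps (fun n hn hnd => ?_) (fun n hn => ?_) hk
  · have := prefixSum_succ y ⟨n, hnd⟩
    have h2 := hy (show i ≤ ⟨n, hnd⟩ from hn)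
    simp only at this h2
    linarith
  · have := prefixSum_succ y ⟨n, by omega⟩
    have h2 := hy (show i ≥ ⟨n, by omega⟩ from Fin.le_def.2 hn.le)
    simp only at this h2
    linarith

/-- The weight of the left endpoint in the chord over `[j, k]` at `i`. -/
def chordWeight (i j k : ℕ) : ℝ := ((k : ℝ) - i) / ((k : ℝ) - j)

theorem chord_le_prefixSum {y : Coweight d} (hy : y ∈ dominantCone d) {i j k : ℕ} (hj : j ≤ i)
    (hik : i < k) (hk : k ≤ d) :
    chordWeight i j k * prefixSum y j + (1 - chordWeight i j k) * prefixSum y k ≤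
      prefixSum y i := by
  have h1 := prefixSum_le_of_dominant hy ⟨i, by omega⟩ hk
  have h2 := prefixSum_le_of_dominant hy ⟨i, by omega⟩ (hj.trans (hik.le.trans hk))
  have hij : (j : ℝ) ≤ i := by exact_mod_cast hj
  have hik' : (i : ℝ) < k := by exact_mod_cast hik
  have hpos : (0 : ℝ) < k - j := by linarith
  have e : (1 - chordWeight i j k) = ((i : ℝ) - j) / (k - j) := by
    rw [chordWeight]; field_simp; ring
  rw [e, chordWeight, div_mul_eq_mul_div, div_mul_eq_mul_div, ← add_div, div_le_iff₀ hpos]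
  simp only at h1 h2
  have := mul_le_mul_of_nonneg_left h2 (show (0 : ℝ) ≤ k - i by linarith)
  have := mul_le_mul_of_nonneg_left h1 (show (0 : ℝ) ≤ i - j by linarith)
  nlinarith

theorem chordWeight_mem {i j k : ℕ} (hj : j ≤ i) (hik : i < k) :
    0 ≤ chordWeight i j k ∧ 0 ≤ 1 - chordWeight i j k := by
  have hij : (j : ℝ) ≤ i := by exact_mod_cast hj
  have hik' : (i : ℝ) < k := by exact_mod_cast hik
  have hpos : (0 : ℝ) < k - j := by linarith
  refine ⟨div_nonneg (by linarith) hpos.le, ?_⟩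
  rw [sub_nonneg, chordWeight, div_le_one hpos]
  linarith

/-- Between consecutive contact points of the two polygons the projection is constant, so its
polygon is the chord there. Contact always occurs at `0` and at `d`. -/
theorem exists_prefixSum_retraction_eq_chord (x : Coweight d) {i : ℕ} (hi : i < d) :
    ∃ j k, j ≤ i ∧ i < k ∧ k ≤ d ∧ prefixSum (retraction x) i =
      chordWeight i j k * prefixSum x j + (1 - chordWeight i j k) * prefixSum x k := by
  classical
  set y := retraction x with hy
  let C : ℕ → Prop := fun m => prefixSum x m = prefixSum y m
  let j := Nat.findGreatest C i
  have hj : C j := Nat.findGreatest_spec (P := C) (Nat.zero_le i) (by simp [C])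
  have hji : j ≤ i := Nat.findGreatest_le i
  have hex : ∃ k, i < k ∧ C k := ⟨d, hi, (prefixSum_retraction_dim x).symm⟩
  let k := Nat.find hex
  obtain ⟨hik, hk⟩ : i < k ∧ C k := Nat.find_spec hex
  have hkd : k ≤ d := Nat.find_min' hex ⟨hi, (prefixSum_retraction_dim x).symm⟩
  have hne : ∀ m, j < m → m < k → ¬ C m := by
    intro m hm hmk hC
    rcases le_or_gt m i with h | h
    · exact absurd (Nat.le_findGreatest h hC) (not_le.2 hm)
    · exact Nat.find_min hex hmk ⟨h, hC⟩
  set c := y ⟨j, by omega⟩ with hc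
  have hlin : ∀ m, j ≤ m → (hmk : m < k) → y ⟨m, by omega⟩ = c := by
    intro m hm
    induction m, hm using Nat.le_induction with
    | base => intro _; rfl
    | succ m hm ih =>
      intro hmk
      rw [← ih (by omega)]
      exact (retraction_eq_of_prefixSum_ne x (by omega) (hne (m + 1) (by omega) hmk)).symm
  have hP : ∀ m, j ≤ m → (hmk : m ≤ k) → prefixSum y m = prefixSum y j + ((m : ℝ) - j) * c := by
    intro m hm
    induction m, hm using Nat.le_induction with
    | base => intro _; simp
    | succ m hm ih =>
      intro hmk
      have := prefixSum_succ y ⟨m, by omega⟩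
      simp only at this
      rw [this, ih (by omega), hlin m hm (by omega)]
      push_cast
      ring
  refine ⟨j, k, hji, hik, hkd, ?_⟩
  have hij : (j : ℝ) ≤ i := by exact_mod_cast hji
  have hik' : (i : ℝ) < k := by exact_mod_cast hik
  have hpos : (k : ℝ) - j ≠ 0 := by linarith
  rw [hj, hk, hP i hji hik.le, hP k (hji.trans hik.le) le_rfl, chordWeight]
  field_simp
  ring

/-- The pairs of endpoints of chords over `i`. -/
def chordEnds (d i : ℕ) : Finset (ℕ × ℕ) := Finset.range (i + 1) ×ˢ Finset.Ioc i d

theorem mem_chordEnds {i : ℕ} {q : ℕ × ℕ} : q ∈ chordEnds d i ↔ q.1 ≤ i ∧ i < q.2 ∧ q.2 ≤ d := by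
  simp [chordEnds]

theorem chordEnds_nonempty {i : ℕ} (hi : i < d) : (chordEnds d i).Nonempty :=
  ⟨(0, d), mem_chordEnds.2 ⟨Nat.zero_le _, hi, le_rfl⟩⟩

/-- The exponential of the least concave majorant at `i` of the points `(j, log u_j)`. -/
def concaveHullExp {i : ℕ} (hi : i < d) (u : ℕ → ℝ) : ℝ :=
  (chordEnds d i).sup' (chordEnds_nonempty hi) fun q =>
    u q.1 ^ chordWeight i q.1 q.2 * u q.2 ^ (1 - chordWeight i q.1 q.2)

/-- The polygon of the projection lies above all chords and attains one of them. Exponentials are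
taken so that a coordinate `-∞` becomes `0`, where powers with nonnegative exponents remain
continuous in the base. -/
theorem exp_prefixSum_retraction (x : Coweight d) {i : ℕ} (hi : i < d) :
    Real.exp (prefixSum (retraction x) i) =
      concaveHullExp hi fun j => Real.exp (prefixSum x j) := by
  have hq : ∀ q : ℕ × ℕ, Real.exp (prefixSum x q.1) ^ chordWeight i q.1 q.2 *
      Real.exp (prefixSum x q.2) ^ (1 - chordWeight i q.1 q.2) =
      Real.exp (chordWeight i q.1 q.2 * prefixSum x q.1 +
        (1 - chordWeight i q.1 q.2) * prefixSum x q.2) := by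
    intro q
    rw [← Real.exp_mul, ← Real.exp_mul, ← Real.exp_add]
    ring_nf
  simp only [concaveHullExp, hq]
  refine le_antisymm ?_ (Finset.sup'_le _ _ fun q hq => ?_)
  · obtain ⟨j, k, hj, hik, hk, e⟩ := exists_prefixSum_retraction_eq_chord x hi
    rw [e]
    exact Finset.le_sup' (fun q : ℕ × ℕ => Real.exp (chordWeight i q.1 q.2 * prefixSum x q.1 +
        (1 - chordWeight i q.1 q.2) * prefixSum x q.2)) (b := (j, k)) (mem_chordEnds.2 ⟨hj, hik, hk⟩)
  · obtain ⟨hj, hik, hk⟩ := mem_chordEnds.1 hq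
    refine Real.exp_le_exp.2 ((chord_le_prefixSum (retraction_mem x) hj hik hk).trans' ?_)
    obtain ⟨h1, h2⟩ := chordWeight_mem hj hik
    exact add_le_add (mul_le_mul_of_nonneg_left (prefixSum_le_prefixSum_retraction x _) h1)
      (mul_le_mul_of_nonneg_left (prefixSum_le_prefixSum_retraction x _) h2)

theorem tendsto_concaveHullExp {ι : Type*} {l : Filter ι} {i : ℕ} (hi : i < d) {u : ι → ℕ → ℝ}
    {U : ℕ → ℝ} (h : ∀ j ≤ d, Filter.Tendsto (fun x => u x j) l (𝓝 (U j))) :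
    Filter.Tendsto (fun x => concaveHullExp hi (u x)) l (𝓝 (concaveHullExp hi U)) := by
  refine Filter.Tendsto.finset_sup'_nhds_apply (chordEnds_nonempty hi) fun q hq => ?_
  obtain ⟨hj, hik, hk⟩ := mem_chordEnds.1 hq
  obtain ⟨h1, h2⟩ := chordWeight_mem hj hik
  exact ((h q.1 (by omega)).rpow_const (Or.inr h1)).mul ((h q.2 (by omega)).rpow_const (Or.inr h2))

theorem concaveHullExp_pos {i : ℕ} (hi : i < d) {U : ℕ → ℝ} (h0 : 0 < U 0) (hd : 0 < U d) :
    0 < concaveHullExp hi U :=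
  lt_of_lt_of_le (by positivity) (Finset.le_sup' (fun q : ℕ × ℕ =>
    U q.1 ^ chordWeight i q.1 q.2 * U q.2 ^ (1 - chordWeight i q.1 q.2)) (b := (0, d))
    (mem_chordEnds.2 ⟨Nat.zero_le _, hi, le_rfl⟩))

theorem concaveHullExp_le {i : ℕ} (hi : i < d) {U : ℕ → ℝ} (h0 : ∀ j, 0 ≤ U j) {y : Coweight d}
    (hy : y ∈ dominantCone d) (h : ∀ j ≤ d, U j ≤ Real.exp (prefixSum y j)) :
    concaveHullExp hi U ≤ Real.exp (prefixSum y i) := by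
  refine Finset.sup'_le _ _ fun q hq => ?_
  obtain ⟨hj, hik, hk⟩ := mem_chordEnds.1 hq
  obtain ⟨h1, h2⟩ := chordWeight_mem hj hik
  refine (mul_le_mul (Real.rpow_le_rpow (h0 _) (h q.1 (by omega)) h1)
    (Real.rpow_le_rpow (h0 _) (h q.2 (by omega)) h2) (Real.rpow_nonneg (h0 _) _)
    (by positivity)).trans ?_
  rw [← Real.exp_mul, ← Real.exp_mul, ← Real.exp_add, mul_comm, mul_comm (prefixSum y q.2)]
  exact Real.exp_le_exp.2 (chord_le_prefixSum hy hj hik hk)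

/-- The exponentials of the coordinates of a point of `ℝ̃ ^ d`, preceded by `exp 0`. -/
def extendedExp (D : Fin d → EReal) (j : ℕ) : ℝ :=
  if h : 0 < j ∧ j - 1 < d then (EReal.exp (D ⟨j - 1, h.2⟩)).toReal else 1

theorem extendedExp_toExtended (x : Coweight d) {j : ℕ} (hj : j ≤ d) :
    extendedExp (toExtended x) j = Real.exp (prefixSum x j) := by
  rcases Nat.eq_zero_or_pos j with rfl | h
  · simp [extendedExp]
  · rw [extendedExp, dif_pos ⟨h, by omega⟩, toExtended, omegaPairing_eq_prefixSum, EReal.exp_coe,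
      ENNReal.toReal_ofReal (Real.exp_pos _).le]
    congr 2
    simp; omega

theorem tendsto_extendedExp {D : Fin d → EReal} (hD : ∀ i, D i ≠ ⊤) {j : ℕ} (hj : j ≤ d) :
    Filter.Tendsto (fun x : Coweight d => Real.exp (prefixSum x j))
      (Filter.comap toExtended (𝓝 D)) (𝓝 (extendedExp D j)) := by
  have : (fun x : Coweight d => Real.exp (prefixSum x j)) =
      (fun D' => extendedExp D' j) ∘ toExtended := by
    ext x; exact (extendedExp_toExtended x hj).symm
  rw [this]
  refine Filter.Tendsto.comp ?_ Filter.tendsto_comap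
  unfold extendedExp
  split_ifs with h
  · refine (ENNReal.tendsto_toReal ?_).comp
      ((EReal.expHomeomorph.continuous.tendsto _).comp
        ((continuous_apply (⟨j - 1, h.2⟩ : Fin d)).tendsto D))
    simpa using hD _
  · exact tendsto_const_nhds

theorem extendedExp_nonneg (D : Fin d → EReal) (j : ℕ) : 0 ≤ extendedExp D j := by
  unfold extendedExp
  split_ifs <;> simp

theorem toReal_exp_le_exp_iff {a : EReal} (ha : a ≠ ⊤) (b : ℝ) :
    (EReal.exp a).toReal ≤ Real.exp b ↔ a ≤ b := by
  rw [← ENNReal.ofReal_le_ofReal_iff (Real.exp_pos b).le, ENNReal.ofReal_toReal (by simpa using ha),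
    ← EReal.exp_coe, EReal.exp_le_exp_iff]

/-- Replacing `-∞` by `-n` approximates `D` by finite points. Without this, limits along the filter
would carry no information. -/
theorem neBot_comap_toExtended {D : Fin d → EReal} (hD : ∀ i, D i ≠ ⊤) :
    (Filter.comap toExtended (𝓝 D)).NeBot := by
  let v : ℕ → ℕ → ℝ := fun n j => if h : 0 < j ∧ j - 1 < d then
    (if D ⟨j - 1, h.2⟩ = ⊥ then -(n : ℝ) else (D ⟨j - 1, h.2⟩).toReal) else 0
  let x : ℕ → Coweight d := fun n => WithLp.toLp 2 fun k => v n (k + 1) - v n k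
  have hx : ∀ n j, j ≤ d → prefixSum (x n) j = v n j := by
    intro n j
    induction j with
    | zero => intro _; simp [v]
    | succ j ih =>
      intro hj
      have := prefixSum_succ (x n) ⟨j, hj⟩
      simp only at this
      rw [this, ih (by omega)]
      simp [x]
  have ht : Filter.Tendsto (fun n => toExtended (x n)) Filter.atTop (𝓝 D) := by
    rw [tendsto_pi_nhds]
    intro k
    have e : ∀ n, toExtended (x n) k = ((if D k = ⊥ then -(n : ℝ) else (D k).toReal : ℝ) : EReal) := by
      intro n
      rw [toExtended, omegaPairing_eq_prefixSum, hx n _ k.2]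
      simp [v]
    simp only [e]
    by_cases hk : D k = ⊥
    · simp only [hk, if_true]
      refine EReal.tendsto_coe_nhds_bot_iff.2 ?_
      exact Filter.tendsto_neg_atTop_atBot.comp tendsto_natCast_atTop_atTop
    · simp only [hk, if_false]
      rw [EReal.coe_toReal (hD k) hk]
      exact tendsto_const_nhds
  exact (Filter.tendsto_comap_iff.2 ht).neBot

theorem exists_isExtendedRetraction {D : Fin d → EReal} (hD : ∀ i, D i ≠ ⊤)
    (hlast : 0 < extendedExp D d) :
    ∃ y, IsExtendedRetraction D y ∧ (∀ i (hi : i < d), prefixSum y i =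
        Real.log (concaveHullExp hi (extendedExp D))) ∧
      prefixSum y d = Real.log (extendedExp D d) := by
  -- The chord formula needs `i < d`; at `d` the retraction preserves the total.
  let t : ℕ → ℝ := fun i => if hi : i < d then Real.log (concaveHullExp hi (extendedExp D)) else
    Real.log (extendedExp D d)
  have h0 : 0 < extendedExp D 0 := by simp [extendedExp]
  have ht : ∀ i ≤ d, Filter.Tendsto (fun x => prefixSum (retraction x) i)
      (Filter.comap toExtended (𝓝 D)) (𝓝 (t i)) := by
    intro i hi
    rcases hi.lt_or_eq with h | rfl
    · have := (tendsto_concaveHullExp h (fun j hj => tendsto_extendedExp hD hj)).log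
        (concaveHullExp_pos h h0 hlast).ne'
      simp only [t, dif_pos h]
      refine this.congr fun x => ?_
      rw [← exp_prefixSum_retraction, Real.log_exp]
    · simp only [t, lt_irrefl, dif_neg, not_false_eq_true]
      refine ((tendsto_extendedExp hD le_rfl).log hlast.ne').congr fun x => ?_
      rw [Real.log_exp, prefixSum_retraction_dim]
  let y : Coweight d := WithLp.toLp 2 fun k => t (k + 1) - t k
  have hy : Filter.Tendsto retraction (Filter.comap toExtended (𝓝 D)) (𝓝 y) := by
    have : Filter.Tendsto (fun x => (fun k : Fin d => retraction x k))
        (Filter.comap toExtended (𝓝 D)) (𝓝 fun k : Fin d => t (k + 1) - t k) := by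
      rw [tendsto_pi_nhds]
      intro k
      refine ((ht (k + 1) k.2).sub (ht k k.2.le)).congr fun x => ?_
      rw [prefixSum_succ]; ring
    exact ((PiLp.continuous_toLp 2 _).tendsto _).comp this
  have t0 : t 0 = 0 := by
    rcases Nat.eq_zero_or_pos d with rfl | hd
    · simp [t, extendedExp]
    · simp only [t, dif_pos hd]
      have hu : Filter.Tendsto (fun x => prefixSum (retraction x) 0)
        (Filter.comap toExtended (𝓝 D)) (𝓝 (t 0)) := ht 0 hd.le
      simp only [prefixSum_zero] at hu
      have := neBot_comap_toExtended hD
      have := tendsto_nhds_unique hu tendsto_const_nhds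
      simpa [t, dif_pos hd] using this
  have hP : ∀ i ≤ d, prefixSum y i = t i := by
    intro j
    induction j with
    | zero => intro _; simp [t0]
    | succ j ih =>
      intro hj
      have := prefixSum_succ y ⟨j, hj⟩
      simp only at this
      rw [this, ih (by omega)]
      simp [y]
  exact ⟨y, hy, fun i hi => by simp [hP i hi.le, t, hi], by simp [hP d le_rfl, t]⟩

/-- The retraction only raises prefix sums and keeps the total, whence the forward direction.
Conversely the polygon of the dominant `μ` is concave, so if it bounds `D` it bounds the least
concave majorant of `D`. -/
theorem exists_extendedRetraction_dominanceLE_iff (hd : 0 < d) {D : Fin d → EReal}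
    (hD : ∀ i, D i ≠ ⊤) {μ : Coweight d}
    (hμ : μ ∈ dominantCone d) :
    (∃ y, IsExtendedRetraction D y ∧ DominanceLE y μ) ↔
      (∀ i, D i ≤ omegaPairing i μ) ∧
        D ⟨d - 1, by omega⟩ = omegaPairing (⟨d - 1, by omega⟩ : Fin d) μ := by
  have := neBot_comap_toExtended hD
  have hcont : ∀ i : ℕ, Continuous fun x : Coweight d => prefixSum x i := by
    intro i
    unfold prefixSum
    fun_prop
  have hdd : d - 1 + 1 = d := by omega
  constructor
  · rintro ⟨y, hy, hle, heq⟩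
    have hlim : ∀ i, Filter.Tendsto (fun x => toExtended x i) (Filter.comap toExtended (𝓝 D))
        (𝓝 (D i)) := fun i => ((continuous_apply i).tendsto D).comp Filter.tendsto_comap
    have hlim' : ∀ i : Fin d, Filter.Tendsto (fun x => ((omegaPairing i (retraction x) : ℝ) : EReal))
        (Filter.comap toExtended (𝓝 D)) (𝓝 (omegaPairing i y : ℝ)) := by
      intro i
      refine (continuous_coe_real_ereal.tendsto _).comp ?_
      simp only [omegaPairing_eq_prefixSum]
      exact ((hcont _).tendsto _).comp hy
    refine ⟨fun i => (le_of_tendsto_of_tendsto' (hlim i) (hlim' i) fun x => ?_).trans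
      (EReal.coe_le_coe_iff.2 (hle i)), ?_⟩
    · simp only [toExtended, omegaPairing_eq_prefixSum]
      exact EReal.coe_le_coe_iff.2 (prefixSum_le_prefixSum_retraction x _)
    · have : D ⟨d - 1, by omega⟩ = omegaPairing (⟨d - 1, by omega⟩ : Fin d) y := by
        refine tendsto_nhds_unique ((hlim _).congr fun x => ?_) (hlim' _)
        simp only [toExtended, omegaPairing_eq_prefixSum, hdd, prefixSum_retraction_dim]
      rw [this]
      simp only [omegaPairing_eq_prefixSum, hdd, prefixSum_dim, heq]
  · rintro ⟨hle, heq⟩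
    have hexp : ∀ j ≤ d, extendedExp D j ≤ Real.exp (prefixSum μ j) := by
      intro j hj
      rcases Nat.eq_zero_or_pos j with rfl | h
      · simp [extendedExp]
      · rw [extendedExp, dif_pos ⟨h, by omega⟩, toReal_exp_le_exp_iff (hD _)]
        have := hle ⟨j - 1, by omega⟩
        rw [omegaPairing_eq_prefixSum] at this
        simpa [show j - 1 + 1 = j by omega] using this
    have hexpd : extendedExp D d = Real.exp (prefixSum μ d) := by
      rw [extendedExp, dif_pos ⟨hd, by omega⟩, heq, EReal.exp_coe,
        ENNReal.toReal_ofReal (Real.exp_pos _).le, omegaPairing_eq_prefixSum]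
      simp [hdd]
    obtain ⟨y, hy, h1, h2⟩ := exists_isExtendedRetraction hD (hexpd ▸ Real.exp_pos _)
    rw [hexpd, Real.log_exp] at h2
    refine ⟨y, hy, fun i => ?_, by rw [← prefixSum_dim, ← prefixSum_dim, h2]⟩
    rw [omegaPairing_eq_prefixSum, omegaPairing_eq_prefixSum]
    rcases (show (i : ℕ) + 1 ≤ d from i.2).lt_or_eq with h | h
    · rw [h1 _ h, Real.log_le_iff_le_exp]
      · exact concaveHullExp_le h (extendedExp_nonneg D) hμ hexp
      · exact concaveHullExp_pos h (by simp [extendedExp]) (hexpd ▸ Real.exp_pos _)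
    · rw [h, h2]

end Retraction

/-! ### Closed Newton strata as bounds on coefficients -/

section Strata

variable {p : ℕ} [Fact p.Prime] {K : Type*} [Field K] [Algebra ℚ_[p] K]
  [FiniteDimensional ℚ_[p] K] {d : ℕ}

theorem mem_closedNewtonStratum_iff (hd : 0 < d) (ν : DominantCocharacter p K d) {E : Type*}
    [NormedField E] (x : AdjointQuotientAn E d) :
    x ∈ closedNewtonStratum p E ν.muReal ↔
      (∀ i : Fin d, x.seminorm (MvPolynomial.X i) ≤ (p : ℝ) ^ ν.bound (i + 1)) ∧
        x.seminorm (MvPolynomial.X ⟨d - 1, by omega⟩) = (p : ℝ) ^ ν.bound d := by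
  have hp : (1 : ℝ) < p := by exact_mod_cast (Fact.out : p.Prime).one_lt
  have hl := x.last_ne_zero ⟨d - 1, by omega⟩ (by simp; omega)
  have hb : (d - 1 + 1) = d := by omega
  rw [closedNewtonStratum, Set.mem_ofPred_eq, exists_extendedRetraction_dominanceLE_iff hd _
    ν.muReal_mem_dominantCone]
  · refine and_congr (forall_congr' fun i => ?_) ?_
    · rw [AdjointQuotientAn.negVal, ν.omegaPairing_muReal]
      split_ifs with h
      · simp only [bot_le, h, true_iff]; positivity
      · have : 0 < x.seminorm (MvPolynomial.X i) := lt_of_le_of_ne (apply_nonneg _ _) (Ne.symm h)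
        rw [EReal.coe_le_coe_iff, Real.logb_le_iff_le_rpow hp this]
    · have : 0 < x.seminorm (MvPolynomial.X ⟨d - 1, by omega⟩) :=
        lt_of_le_of_ne (apply_nonneg _ _) (Ne.symm hl)
      rw [AdjointQuotientAn.negVal, ν.omegaPairing_muReal, if_neg hl, EReal.coe_eq_coe_iff,
        Real.logb_eq_iff_rpow_eq (by linarith) (by linarith) this]
      simp only [hb, eq_comm]
  · intro i
    rw [AdjointQuotientAn.negVal]
    split_ifs <;> simp

end Strata

end FilteredPhi

namespace FilteredPhi

/-! ### The `p`-power map on residue discs and Teichmüller representatives -/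

section Contraction

theorem norm_sub_le_max {F : Type*} [NormedField F] [IsUltrametricDist F] (a b : F) : ‖a - b‖ ≤ max ‖a‖ ‖b‖ := by
  simpa [sub_eq_add_neg] using IsUltrametricDist.norm_add_le_max a (-b)

theorem norm_le_one_of_pow_eq_self {F : Type*} [NormedField F] {a : F} {q : ℕ} (hq : 2 ≤ q) (ha : a ^ q = a) : ‖a‖ ≤ 1 := by
  by_contra h
  have h1 : ‖a‖ ^ 1 < ‖a‖ ^ q := pow_lt_pow_right₀ (not_le.1 h) (by omega)
  rw [← norm_pow a q, ha] at h1
  simp at h1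


variable {F : Type*} [NormedField F] [IsUltrametricDist F] {p : ℕ} [hpr : Fact p.Prime]

theorem exists_pow_prime_eq_add {a b : F} (ha : ‖a‖ ≤ 1) (hb : ‖b‖ ≤ 1) :
    ∃ r : F, ‖r‖ ≤ ‖a - b‖ ∧ a ^ p = b ^ p + (a - b) ^ p + p * r := by
  let O := (NormedField.valuation (K := F)).integer
  have hO : ∀ x : F, x ∈ O ↔ ‖x‖ ≤ 1 := fun x => by
    rw [Valuation.mem_integer_iff, NormedField.valuation_apply, ← NNReal.coe_le_coe]; simp
  have hab : a - b ∈ O := sub_mem ((hO a).2 ha) ((hO b).2 hb)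
  obtain ⟨r, hr⟩ := exists_add_pow_prime_eq hpr.out (⟨b, (hO b).2 hb⟩ : O) ⟨a - b, hab⟩
  have hr' := congrArg (Subtype.val) hr
  simp only [Subring.coe_pow, Subring.coe_add, Subring.coe_mul, add_sub_cancel] at hr'
  refine ⟨b * (a - b) * r, ?_, by rw [hr']; simp; ring⟩
  rw [norm_mul, norm_mul]
  have hr1 : ‖(r : F)‖ ≤ 1 := (hO _).1 r.2
  calc ‖b‖ * ‖a - b‖ * ‖(r : F)‖ ≤ 1 * ‖a - b‖ * 1 := by gcongr
    _ = ‖a - b‖ := by ring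

theorem norm_pow_prime_sub_le {a b : F} (ha : ‖a‖ ≤ 1) (hb : ‖b‖ ≤ 1) :
    ‖a ^ p - b ^ p‖ ≤ max ‖(p : F)‖ ‖a - b‖ * ‖a - b‖ := by
  obtain ⟨r, hr1, hr⟩ := exists_pow_prime_eq_add (p := p) ha hb
  have hab1 : ‖a - b‖ ≤ 1 := (norm_sub_le_max a b).trans (max_le ha hb)
  rw [hr, add_assoc, add_sub_cancel_left]
  refine (IsUltrametricDist.norm_add_le_max _ _).trans (max_le ?_ ?_)
  · rw [norm_pow]
    calc ‖a - b‖ ^ p ≤ ‖a - b‖ ^ 2 := pow_le_pow_of_le_one (norm_nonneg _) hab1 hpr.out.two_le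
      _ = ‖a - b‖ * ‖a - b‖ := sq _
      _ ≤ _ := mul_le_mul_of_nonneg_right (le_max_right _ _) (norm_nonneg _)
  · rw [norm_mul]
    exact mul_le_mul (le_max_left _ _) hr1 (norm_nonneg _) (le_max_of_le_left (norm_nonneg _))

/-- Injectivity of the Frobenius of the residue field. -/
theorem norm_sub_lt_one_of_pow_prime (hp : ‖(p : F)‖ < 1) {a b : F} (ha : ‖a‖ ≤ 1)
    (hb : ‖b‖ ≤ 1) (h : ‖a ^ p - b ^ p‖ < 1) : ‖a - b‖ < 1 := by
  obtain ⟨r, hr1, hr⟩ := exists_pow_prime_eq_add (p := p) ha hb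
  have hab1 : ‖a - b‖ ≤ 1 := (norm_sub_le_max a b).trans (max_le ha hb)
  have e : (a - b) ^ p = (a ^ p - b ^ p) - p * r := by rw [hr]; ring
  refine lt_of_le_of_ne hab1 fun h1 => ?_
  have h2 : ‖(a - b) ^ p‖ < 1 := by
    rw [e]
    refine (norm_sub_le_max _ _).trans_lt (max_lt h ?_)
    rw [norm_mul]
    exact mul_lt_one_of_nonneg_of_lt_one_left (norm_nonneg _) hp (hr1.trans hab1)
  rw [norm_pow, h1, one_pow] at h2
  exact lt_irrefl _ h2

theorem norm_pow_sub_le (hp : ‖(p : F)‖ < 1) {a b : F} (ha : ‖a‖ ≤ 1) (hb : ‖b‖ ≤ 1) (n : ℕ) :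
    ‖a ^ p ^ (n + 1) - b ^ p ^ (n + 1)‖ ≤ max ‖(p : F)‖ ‖a - b‖ * ‖a - b‖ := by
  have hab : ‖a - b‖ ≤ 1 := (norm_sub_le_max _ _).trans (max_le ha hb)
  induction n with
  | zero => simpa using norm_pow_prime_sub_le ha hb
  | succ n ih =>
    rw [pow_succ p (n + 1), pow_mul, pow_mul]
    have h1 := norm_pow_prime_sub_le (p := p) (a := a ^ p ^ (n + 1)) (b := b ^ p ^ (n + 1))
      (by rw [norm_pow]; exact pow_le_one₀ (norm_nonneg _) ha)
      (by rw [norm_pow]; exact pow_le_one₀ (norm_nonneg _) hb)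
    have hc : max ‖(p : F)‖ ‖a - b‖ ≤ 1 := max_le hp.le hab
    have h2 : ‖a ^ p ^ (n + 1) - b ^ p ^ (n + 1)‖ ≤ 1 :=
      ih.trans (mul_le_one₀ hc (norm_nonneg _) hab)
    refine h1.trans (le_trans ?_ ih)
    exact mul_le_of_le_one_left (norm_nonneg _) (max_le hp.le h2)

/-- Iterates of the `p`-power map strictly shrink distances that are positive and less than `1`, so
an open residue disc contains at most one fixed point. -/
theorem eq_of_pow_eq_self_of_norm_sub_lt (hp : ‖(p : F)‖ < 1) {a b : F} (n : ℕ)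
    (ha : a ^ p ^ (n + 1) = a) (hb : b ^ p ^ (n + 1) = b) (ha1 : ‖a‖ ≤ 1) (hb1 : ‖b‖ ≤ 1)
    (h : ‖a - b‖ < 1) : a = b := by
  have h1 := norm_pow_sub_le hp ha1 hb1 n
  rw [ha, hb] at h1
  by_contra hne
  have : 0 < ‖a - b‖ := norm_pos_iff.2 (sub_ne_zero.2 hne)
  have : max ‖(p : F)‖ ‖a - b‖ * ‖a - b‖ < 1 * ‖a - b‖ :=
    mul_lt_mul_of_pos_right (max_lt hp h) this
  linarith

/-- Compactness covers the unit ball by finitely many residue discs. Two iterates of `x` meet in one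
disc by pigeonhole, and injectivity modulo the maximal ideal cancels the common initial iterates. -/
theorem exists_norm_pow_sub_self_lt [ProperSpace F] (hp : ‖(p : F)‖ < 1) :
    ∃ n : ℕ, ∀ x : F, ‖x‖ ≤ 1 → ‖x ^ p ^ (n + 1) - x‖ < 1 := by
  obtain ⟨t, -, htf, ht⟩ := (isCompact_closedBall (0 : F) 1).finite_cover_balls one_pos
  obtain ⟨N, hN⟩ : ∃ N, t.ncard < N := ⟨_, Nat.lt_succ_self _⟩
  have key : ∀ x : F, ‖x‖ ≤ 1 → ∃ m, 0 < m ∧ m ≤ N ∧ ‖x ^ p ^ m - x‖ < 1 := by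
    intro x hx
    have hpow : ∀ a : ℕ, ‖x ^ a‖ ≤ 1 := fun a => by
      rw [norm_pow]; exact pow_le_one₀ (norm_nonneg _) hx
    have hcl : ∀ a : ℕ, ∃ y ∈ t, ‖x ^ p ^ a - y‖ < 1 := by
      intro a
      have := ht (show x ^ p ^ a ∈ Metric.closedBall (0 : F) 1 by simpa using hpow (p ^ a))
      simpa [dist_eq_norm] using this
    choose c hct hc using hcl
    obtain ⟨a, ha, b, hb, hab, hcab⟩ := Finset.exists_ne_map_eq_of_card_lt_of_maps_to
      (s := Finset.range N) (t := htf.toFinset) (f := c)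
      (by rw [← Set.ncard_eq_toFinset_card t htf]; simpa using hN) (fun a _ => by simpa using hct a)
    wlog hlt : a < b generalizing a b
    · exact this b hb a ha hab.symm hcab.symm (lt_of_le_of_ne (not_lt.1 hlt) hab.symm)
    simp only [Finset.mem_range] at ha hb
    refine ⟨b - a, by omega, by omega, ?_⟩
    have h1 : ‖(x ^ p ^ (b - a)) ^ p ^ a - x ^ p ^ a‖ < 1 := by
      rw [← pow_mul, ← pow_add, Nat.sub_add_cancel hlt.le]
      have := norm_sub_le_max (x ^ p ^ b - c b) (x ^ p ^ a - c b)
      rw [sub_sub_sub_cancel_right] at this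
      exact this.trans_lt (max_lt (hc b) (hcab ▸ hc a))
    have h2 : ∀ (k : ℕ) (u v : F), ‖u‖ ≤ 1 → ‖v‖ ≤ 1 → ‖u ^ p ^ k - v ^ p ^ k‖ < 1 →
        ‖u - v‖ < 1 := by
      intro k
      induction k with
      | zero => intro u v _ _ h; simpa using h
      | succ k ih =>
        intro u v hu hv h
        rw [pow_succ' p k, pow_mul, pow_mul] at h
        have h3 := ih (u ^ p) (v ^ p) (by rw [norm_pow]; exact pow_le_one₀ (norm_nonneg _) hu)
          (by rw [norm_pow]; exact pow_le_one₀ (norm_nonneg _) hv) h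
        exact norm_sub_lt_one_of_pow_prime hp hu hv h3
    exact h2 a _ _ (hpow _) hx h1
  -- The exponent `N!` is a multiple of all periods `m ≤ N`; one is subtracted because the statement
  -- uses `n + 1`.
  refine ⟨N.factorial - 1, fun x hx => ?_⟩
  rw [Nat.sub_add_cancel (Nat.one_le_iff_ne_zero.2 (Nat.factorial_ne_zero N))]
  obtain ⟨m, hm, hmN, h⟩ := key x hx
  obtain ⟨k, hk⟩ := Nat.dvd_factorial hm hmN
  rw [hk]
  clear hk
  induction k with
  | zero => simp
  | succ k ih =>
    have h1 : ‖(x ^ p ^ (m * k)) ^ p ^ m - x ^ p ^ m‖ < 1 := by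
      obtain ⟨m', rfl⟩ := Nat.exists_eq_succ_of_ne_zero hm.ne'
      refine (norm_pow_sub_le hp (by rw [norm_pow]; exact pow_le_one₀ (norm_nonneg _) hx) hx
        m').trans_lt ?_
      exact mul_lt_one_of_nonneg_of_lt_one_left (by positivity) (max_lt hp ih) ih.le
    rw [← pow_mul, ← pow_add] at h1
    have := IsUltrametricDist.norm_add_le_max (x ^ p ^ (m * k + m) - x ^ p ^ m) (x ^ p ^ m - x)
    rw [sub_add_sub_cancel] at this
    exact this.trans_lt (max_lt h1 h)

/-- Successive differences of the iterates decay geometrically with ratio `max ‖p‖ ‖x ^ q - x‖ < 1`,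
so the iterates converge to a fixed point in the residue disc of `x`. -/
theorem exists_teichmuller [CompleteSpace F] (hp : ‖(p : F)‖ < 1) (n : ℕ) {x : F} (hx : ‖x‖ ≤ 1)
    (h : ‖x ^ p ^ (n + 1) - x‖ < 1) :
    ∃ τ, Filter.Tendsto (fun m : ℕ => x ^ (p ^ (n + 1)) ^ m) Filter.atTop (𝓝 τ) ∧
      τ ^ p ^ (n + 1) = τ ∧ ‖τ - x‖ < 1 := by
  set q := p ^ (n + 1) with hq
  set δ := ‖x ^ q - x‖ with hδ
  set c := max ‖(p : F)‖ δ
  have hc : c < 1 := max_lt hp h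
  have hc0 : 0 ≤ c := le_max_of_le_left (norm_nonneg _)
  have hpow : ∀ a : ℕ, ‖x ^ a‖ ≤ 1 := fun a => by
    rw [norm_pow]; exact pow_le_one₀ (norm_nonneg _) hx
  have hstep : ∀ m : ℕ, ‖x ^ q ^ (m + 1) - x ^ q ^ m‖ ≤ δ * c ^ m := by
    intro m
    induction m with
    | zero => simp [hδ]
    | succ m ih =>
      have h1 := norm_pow_sub_le hp (hpow (q ^ (m + 1))) (hpow (q ^ m)) n
      rw [← hq, ← pow_mul x, ← pow_mul x, ← pow_succ q, ← pow_succ q] at h1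
      have h2 : δ * c ^ m ≤ δ := mul_le_of_le_one_right (norm_nonneg _) (pow_le_one₀ hc0 hc.le)
      calc _ ≤ _ := h1
        _ ≤ c * (δ * c ^ m) := mul_le_mul (max_le_max le_rfl (ih.trans h2)) ih (norm_nonneg _) hc0
        _ = _ := by ring
  have hcau : CauchySeq fun m : ℕ => x ^ q ^ m :=
    cauchySeq_of_le_geometric c δ hc fun m => by
      rw [dist_comm, dist_eq_norm]; exact hstep m
  obtain ⟨τ, hτ⟩ := cauchySeq_tendsto_of_complete hcau
  refine ⟨τ, hτ, ?_, ?_⟩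
  · have h1 := hτ.pow q
    have h2 := hτ.comp (Filter.tendsto_add_atTop_nat 1)
    refine tendsto_nhds_unique h1 (h2.congr fun m => ?_)
    simp only [Function.comp, pow_succ, pow_mul]
  · have hle : ∀ m : ℕ, ‖x ^ q ^ m - x‖ ≤ δ := by
      intro m
      induction m with
      | zero => simp [hδ]
      | succ m ih =>
        have := IsUltrametricDist.norm_add_le_max (x ^ q ^ (m + 1) - x ^ q ^ m) (x ^ q ^ m - x)
        rw [sub_add_sub_cancel] at this
        exact this.trans (max_le ((hstep m).trans (mul_le_of_le_one_right (norm_nonneg _)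
          (pow_le_one₀ hc0 hc.le))) ih)
    exact (le_of_tendsto' ((hτ.sub_const x).norm) hle).trans_lt h

end Contraction

end FilteredPhi

namespace FilteredPhi

/-! ### The maximal unramified subextension and its Frobenius -/

section MaximalUnramified

variable {p : ℕ} [hpr : Fact p.Prime] {K : Type*} [Field K] [Algebra ℚ_[p] K]

theorem norm_natCast_prime_lt_one {F : Type*} [NormedField F] [NormedAlgebra ℚ_[p] F] :
    ‖(p : F)‖ < 1 := by
  rw [← map_natCast (algebraMap ℚ_[p] F) p, norm_algebraMap', Padic.norm_p]
  exact inv_lt_one_of_one_lt₀ (by exact_mod_cast hpr.out.one_lt)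

/-- Each `x` in `M` is a power of `p` times a unit, and replacing the unit by its Teichmüller
representative leaves a strictly smaller error. Norms on `M` are powers of `p`, so the gain is at
least a factor `p`; closedness of `M'` then leaves no room between `M` and `M'`. -/
theorem le_adjoin_teichmuller {F : Type*} [NormedField F] [NormedAlgebra ℚ_[p] F]
    [IsUltrametricDist F] [FiniteDimensional ℚ_[p] F] {n : ℕ}
    (hn : ∀ x : F, ‖x‖ ≤ 1 → ‖x ^ p ^ (n + 1) - x‖ < 1) (M : IntermediateField ℚ_[p] F)
    (hM : ∀ x ∈ M, x ≠ 0 → ∃ n : ℤ, ‖x‖ = (p : ℝ) ^ n) :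
    M ≤ IntermediateField.adjoin ℚ_[p] {τ : F | τ ∈ M ∧ τ ^ p ^ (n + 1) = τ} := by
  have : CompleteSpace F := FiniteDimensional.complete ℚ_[p] F
  have hp1 : (1 : ℝ) < p := by exact_mod_cast hpr.out.one_lt
  have hp : ‖(p : F)‖ < 1 := norm_natCast_prime_lt_one
  set M' := IntermediateField.adjoin ℚ_[p] {τ : F | τ ∈ M ∧ τ ^ p ^ (n + 1) = τ} with hM'
  have hcl : ∀ N : IntermediateField ℚ_[p] F, IsClosed (N : Set F) := fun N =>
    Submodule.closed_of_finiteDimensional (Subalgebra.toSubmodule N.toSubalgebra)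
  have hM'M : M' ≤ M := IntermediateField.adjoin_le_iff.2 fun τ hτ => hτ.1
  have key : ∀ x ∈ M, ∃ y ∈ M', ‖x - y‖ ≤ ‖x‖ * (p : ℝ)⁻¹ := by
    intro x hx
    rcases eq_or_ne x 0 with rfl | hx0
    · exact ⟨0, zero_mem _, by simp⟩
    obtain ⟨k, hk⟩ := hM x hx hx0
    have hpk : ‖(p : F) ^ k‖ = (p : ℝ) ^ (-k) := by
      rw [norm_zpow, ← map_natCast (algebraMap ℚ_[p] F) p, norm_algebraMap', Padic.norm_p,
        inv_zpow, zpow_neg]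
    have hpM' : ∀ k : ℤ, (p : F) ^ k ∈ M' := fun k => zpow_mem (natCast_mem _ _) k
    have hp0 : (p : F) ≠ 0 := by
      intro h
      have := hpk
      rw [← map_natCast (algebraMap ℚ_[p] F) p] at h
      exact hpr.out.ne_zero (by exact_mod_cast (map_eq_zero _).1 h)
    set u := x * (p : F) ^ k
    have huM : u ∈ M := mul_mem hx (hM'M (hpM' k))
    have hu : ‖u‖ = 1 := by
      rw [norm_mul, hpk, hk, ← zpow_add₀ (by positivity), add_neg_cancel, zpow_zero]
    obtain ⟨τ, hτ, hτq, hτu⟩ := exists_teichmuller hp n hu.le (hn u hu.le)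
    have hτM : τ ∈ M := (hcl M).mem_of_tendsto hτ (Filter.Eventually.of_forall fun m => pow_mem huM _)
    have hτM' : τ ∈ M' := IntermediateField.subset_adjoin _ _ ⟨hτM, hτq⟩
    refine ⟨τ * (p : F) ^ (-k), mul_mem hτM' (hpM' _), ?_⟩
    have e : x - τ * (p : F) ^ (-k) = (u - τ) * (p : F) ^ (-k) := by
      simp only [u]
      rw [sub_mul, mul_assoc, ← zpow_add₀ hp0, add_neg_cancel, zpow_zero, mul_one]
    have hpk' : ‖(p : F) ^ (-k)‖ = ‖x‖ := by rw [zpow_neg, norm_inv, hpk, hk, zpow_neg, inv_inv]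
    rw [e, norm_mul, hpk', mul_comm]
    refine mul_le_mul_of_nonneg_left ?_ (norm_nonneg _)
    rcases eq_or_ne (u - τ) 0 with h0 | h0
    · rw [h0, norm_zero]; positivity
    obtain ⟨m, hm⟩ := hM (u - τ) (sub_mem huM hτM) h0
    rw [norm_sub_rev, hm] at hτu
    rw [hm, ← zpow_neg_one]
    refine zpow_le_zpow_right₀ hp1.le ?_
    by_contra hc
    have : (p : ℝ) ^ (0 : ℤ) ≤ (p : ℝ) ^ m := zpow_le_zpow_right₀ hp1.le (by omega)
    rw [zpow_zero] at this
    linarith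
  intro x hx
  by_contra hxM'
  have hne : (M' : Set F).Nonempty := ⟨0, zero_mem M'⟩
  have hpos : 0 < Metric.infDist x (M' : Set F) :=
    ((hcl M').notMem_iff_infDist_pos hne).1 hxM'
  -- A point of `M'` within `p` times the distance of `x` is improved by the factor `1/p`, beating
  -- the infimum.
  obtain ⟨y, hy, hxy⟩ := (Metric.infDist_lt_iff hne).1
    (lt_mul_of_one_lt_left hpos hp1)
  obtain ⟨y', hy', hxy'⟩ := key (x - y) (sub_mem hx (hM'M hy))
  have := Metric.infDist_le_dist_of_mem (x := x) (show y + y' ∈ (M' : Set F) from add_mem hy hy')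
  rw [dist_eq_norm] at this hxy
  rw [sub_sub] at hxy'
  have h2 : ‖x - y‖ * (p : ℝ)⁻¹ < Metric.infDist x (M' : Set F) := by
    rw [← div_eq_mul_inv, div_lt_iff₀ (by positivity), mul_comm]
    exact hxy
  linarith

/-- Every conjugate of a Teichmüller element `ζ` is of the form `ζ ^ (p ^ j)`. -/
theorem exists_eq_pow_of_conjugate {A : Type*} [Field A] [Algebra ℚ_[p] A]
    (τ τ' : A →ₐ[ℚ_[p]] PadicAlgCl p) {ζ : A} {n : ℕ} (hζ : ζ ^ p ^ (n + 1) = ζ) :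
    ∃ j : ℕ, τ' ζ = τ (ζ ^ p ^ j) := by
  classical
  let F := PadicAlgCl p
  have hp : ‖(p : F)‖ < 1 := norm_natCast_prime_lt_one
  let O := (NormedField.valuation (K := F)).valuationSubring
  have hO : ∀ x : F, x ∈ O ↔ ‖x‖ ≤ 1 := fun x => by
    rw [Valuation.mem_valuationSubring_iff, NormedField.valuation_apply, ← NNReal.coe_le_coe]; simp
  let k := IsLocalRing.ResidueField O
  let π : O →+* k := IsLocalRing.residue O
  have hπ : ∀ x : O, π x = 0 ↔ ‖(x : F)‖ < 1 := fun x => by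
    rw [IsLocalRing.residue_eq_zero_iff, Valuation.mem_maximalIdeal_iff,
      NormedField.valuation_apply, ← NNReal.coe_lt_coe]
    simp
  have hcp : CharP k p := by
    have h0 : (p : k) = 0 := by
      have := (hπ (p : O)).2 (by simpa using hp)
      simpa using this
    rcases (Nat.dvd_prime hpr.out).1 (ringChar.dvd h0) with h | h
    · exact absurd h CharP.ringChar_ne_one
    · have := ringChar.charP k
      rw [h] at this
      exact this
  have hq : 2 ≤ p ^ (n + 1) := hpr.out.two_le.trans (Nat.le_self_pow (by omega) p)
  have hz : (τ ζ) ^ p ^ (n + 1) = τ ζ := by rw [← map_pow, hζ]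
  have hz' : (τ' ζ) ^ p ^ (n + 1) = τ' ζ := by rw [← map_pow, hζ]
  let z : O := ⟨τ ζ, (hO _).2 (norm_le_one_of_pow_eq_self hq hz)⟩
  let z' : O := ⟨τ' ζ, (hO _).2 (norm_le_one_of_pow_eq_self hq hz')⟩
  -- The product over the Frobenius orbit of the residue class of `τ ζ`. It is Frobenius invariant,
  -- so its coefficients lie in the prime field and lift to integers.
  let H : Polynomial k := ∏ j ∈ Finset.range (n + 1), (Polynomial.X - Polynomial.C (π z ^ p ^ j))
  have hzq : π z ^ p ^ (n + 1) = π z := by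
    rw [← map_pow]; congr 1; exact Subtype.ext hz
  have hH : H.map (frobenius k p) = H := by
    have e : H.map (frobenius k p) = ∏ j ∈ Finset.range (n + 1),
        (Polynomial.X - Polynomial.C (π z ^ p ^ (j + 1))) := by
      rw [Polynomial.map_prod]
      refine Finset.prod_congr rfl fun j _ => ?_
      simp only [Polynomial.map_sub, Polynomial.map_X, Polynomial.map_C, frobenius_def, ← pow_mul,
        ← pow_succ]
    rw [e, Finset.prod_range_succ, hzq]
    simp only [H]
    rw [Finset.prod_range_succ']
    simp
  obtain ⟨G, hG⟩ : ∃ G : Polynomial ℤ, G.map (Int.castRingHom k) = H := by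
    have : H ∈ Polynomial.lifts (Int.castRingHom k) := by
      rw [Polynomial.lifts_iff_coeff_lifts]
      intro i
      have h1 : (H.coeff i) ^ p = H.coeff i := by
        conv_rhs => rw [← hH, Polynomial.coeff_map, frobenius_def]
      let : Algebra (ZMod p) k := ZMod.algebra k p
      have h2 := (Subfield.mem_bot_iff_pow_eq_self (F := k) (p := p)).2 h1
      have h3 : (⊥ : Subfield k) ≤ (algebraMap (ZMod p) k).fieldRange := bot_le
      obtain ⟨a, ha⟩ := h3 h2
      obtain ⟨b, rfl⟩ := ZMod.intCast_surjective a
      exact ⟨b, by simpa using ha⟩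
    simpa [Polynomial.mem_lifts] using this
  have hev : ∀ w : O, π (Polynomial.aeval w G) = H.eval (π w) := by
    intro w
    rw [← hG, Polynomial.eval_map, Polynomial.aeval_def, Polynomial.hom_eval₂]
    congr 1
  have hcoe : ∀ w : O, ((Polynomial.aeval w G : O) : F) = Polynomial.aeval (w : F) G := by
    intro w
    exact (Polynomial.map_aeval_eq_aeval_map (φ := RingHom.id ℤ) (ψ := O.subtype)
      (RingHom.ext_int _ _) G w).trans (by simp)
  have h1 : ‖Polynomial.aeval (τ ζ) G‖ < 1 := by
    rw [← show ((Polynomial.aeval z G : O) : F) = _ from hcoe z, ← hπ, hev]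
    refine Polynomial.eval_eq_zero_of_dvd_of_eval_eq_zero (p := Polynomial.X - Polynomial.C (π z))
      ?_ (by simp)
    have := Finset.dvd_prod_of_mem (fun j => Polynomial.X - Polynomial.C (π z ^ p ^ j))
      (Finset.mem_range.2 (Nat.succ_pos n))
    rwa [pow_zero, pow_one] at this
  -- Conjugates share their minimal polynomial, hence their spectral norm; so smallness of `G (τ ζ)`
  -- passes to `G (τ' ζ)`.
  have hnorm : ∀ y : A, ‖τ y‖ = ‖τ' y‖ := by
    intro y
    rw [← PadicAlgCl.spectralNorm_eq, ← PadicAlgCl.spectralNorm_eq, spectralNorm, spectralNorm,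
      minpoly.algHom_eq τ τ.injective, minpoly.algHom_eq τ' τ'.injective]
  have hGτ : ∀ σ : A →ₐ[ℚ_[p]] PadicAlgCl p, Polynomial.aeval (σ ζ) G = σ (Polynomial.aeval ζ G) := by
    intro σ
    exact Polynomial.aeval_algHom_apply (σ.restrictScalars ℤ) ζ G
  rw [hGτ τ, hnorm, ← hGτ τ', ← show ((Polynomial.aeval z' G : O) : F) = _ from hcoe z', ← hπ,
    hev, Polynomial.eval_prod, Finset.prod_eq_zero_iff] at h1
  obtain ⟨j, -, hj⟩ := h1
  refine ⟨j, eq_of_pow_eq_self_of_norm_sub_lt hp n hz' ?_ ((hO _).1 z'.2) ?_ ?_⟩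
  · rw [← map_pow, ← pow_mul, mul_comm, pow_mul, hζ]
  · rw [map_pow, norm_pow]
    exact pow_le_one₀ (norm_nonneg _) ((hO _).1 z.2)
  · have : π (z' - z ^ p ^ j) = 0 := by simpa using hj
    rw [hπ] at this
    simpa [z, z'] using this

variable (p K) in
theorem exists_teichmuller_generators [FiniteDimensional ℚ_[p] K] :
    ∃ n : ℕ, maxUnramified p K ≤
      IntermediateField.adjoin ℚ_[p] {τ : K | τ ∈ maxUnramified p K ∧ τ ^ p ^ (n + 1) = τ} := by
  let : NormedField K := spectralNorm.normedField ℚ_[p] K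
  let : NormedAlgebra ℚ_[p] K := spectralNorm.normedAlgebra ℚ_[p] K
  have : IsUltrametricDist K :=
    IsUltrametricDist.isUltrametricDist_of_forall_norm_add_le_max_norm
      (isNonarchimedean_spectralNorm (K := ℚ_[p]) (L := K))
  have : ProperSpace K := FiniteDimensional.proper ℚ_[p] K
  obtain ⟨n, hn⟩ := exists_norm_pow_sub_self_lt (F := K) (p := p) norm_natCast_prime_lt_one
  refine ⟨n, sSup_le fun M hM => ?_⟩
  refine (le_adjoin_teichmuller hn M hM).trans (IntermediateField.adjoin.mono _ _ _ ?_)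
  rintro τ ⟨h1, h2⟩
  exact ⟨(le_sSup hM : M ≤ _) h1, h2⟩

variable [FiniteDimensional ℚ_[p] K]

variable (p K) in
-- The nonzero solutions of `z ^ q = z` form a finite group of roots of unity in a field, which is
-- cyclic. A generator determines homomorphisms on all Teichmüller elements, and these generate the
-- field.
theorem exists_teichmuller_generator :
    ∃ (n : ℕ) (ζ : maxUnramified p K), ζ ^ p ^ (n + 1) = ζ ∧
      ∀ {Ω : Type} [Field Ω] [Algebra ℚ_[p] Ω] (f g : maxUnramified p K →ₐ[ℚ_[p]] Ω),
        f ζ = g ζ → f = g := by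
  obtain ⟨n, hn⟩ := exists_teichmuller_generators p K
  set q := p ^ (n + 1) with hq
  have hq2 : 2 ≤ q := hpr.out.two_le.trans (Nat.le_self_pow (by omega) p)
  have : NeZero (q - 1) := ⟨by omega⟩
  obtain ⟨u, hu⟩ := IsCyclic.exists_generator (α := rootsOfUnity (q - 1) (maxUnramified p K))
  have hu1 := (mem_rootsOfUnity' _ _).1 u.2
  refine ⟨n, (u : (maxUnramified p K)ˣ), ?_, fun f g hfg => ?_⟩
  · calc ((u : (maxUnramified p K)ˣ) : maxUnramified p K) ^ q =
        ((u : (maxUnramified p K)ˣ) : maxUnramified p K) ^ (q - 1 + 1) := by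
          rw [Nat.sub_add_cancel (by omega)]
      _ = _ := by rw [pow_succ, hu1, one_mul]
  have hS : ∀ z : maxUnramified p K, z ^ q = z → f z = g z := by
    intro z hz
    rcases eq_or_ne z 0 with rfl | h0
    · simp
    have hz1 : z ^ (q - 1) = 1 := by
      have : z ^ (q - 1) * z = 1 * z := by rw [← pow_succ, Nat.sub_add_cancel (by omega), hz, one_mul]
      exact mul_right_cancel₀ h0 this
    obtain ⟨k, hk⟩ := hu ⟨Units.mk0 z h0, (mem_rootsOfUnity' _ _).2 hz1⟩
    have hk' : (((u : (maxUnramified p K)ˣ) : maxUnramified p K)) ^ k = z := by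
      have := congrArg (fun w : rootsOfUnity (q - 1) (maxUnramified p K) =>
        ((w : (maxUnramified p K)ˣ) : maxUnramified p K)) hk
      simpa using this
    rw [← hk', map_zpow₀, map_zpow₀, hfg]
  have hle : IntermediateField.adjoin ℚ_[p] {τ : K | τ ∈ maxUnramified p K ∧ τ ^ q = τ} ≤
      maxUnramified p K := IntermediateField.adjoin_le_iff.2 fun τ hτ => hτ.1
  have key : ∀ x (hx : x ∈ IntermediateField.adjoin ℚ_[p]
      {τ : K | τ ∈ maxUnramified p K ∧ τ ^ q = τ}), f ⟨x, hle hx⟩ = g ⟨x, hle hx⟩ := by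
    intro x hx
    induction hx using IntermediateField.adjoin_induction with
    | mem x hx => exact hS ⟨x, hx.1⟩ (Subtype.ext hx.2)
    | algebraMap x => exact (f.commutes x).trans (g.commutes x).symm
    | add x y hx hy h1 h2 =>
      exact (f.map_add ⟨x, hle hx⟩ ⟨y, hle hy⟩).trans
        ((congrArg₂ _ h1 h2).trans (g.map_add ⟨x, hle hx⟩ ⟨y, hle hy⟩).symm)
    | inv x hx h1 =>
      exact (map_inv₀ f ⟨x, hle hx⟩).trans ((congrArg _ h1).trans (map_inv₀ g ⟨x, hle hx⟩).symm)
    | mul x y hx hy h1 h2 =>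
      exact (f.map_mul ⟨x, hle hx⟩ ⟨y, hle hy⟩).trans
        ((congrArg₂ _ h1 h2).trans (g.map_mul ⟨x, hle hx⟩ ⟨y, hle hy⟩).symm)
  ext x
  exact key x (hn x.2)

/-- Both sides are Teichmüller elements and they are congruent modulo the maximal ideal. -/
theorem IsFrobeniusLift.map_teichmuller {φ : maxUnramified p K ≃ₐ[ℚ_[p]] maxUnramified p K}
    (hφ : IsFrobeniusLift φ) {n : ℕ} {ζ : maxUnramified p K} (hζ : ζ ^ p ^ (n + 1) = ζ) :
    φ ζ = ζ ^ p := by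
  let : NormedField K := spectralNorm.normedField ℚ_[p] K
  let : NormedAlgebra ℚ_[p] K := spectralNorm.normedAlgebra ℚ_[p] K
  have : IsUltrametricDist K :=
    IsUltrametricDist.isUltrametricDist_of_forall_norm_add_le_max_norm
      (isNonarchimedean_spectralNorm (K := ℚ_[p]) (L := K))
  have hq : 2 ≤ p ^ (n + 1) := hpr.out.two_le.trans (Nat.le_self_pow (by omega) p)
  have hv : ∀ z : maxUnramified p K, z ^ p ^ (n + 1) = z → (z : K) ^ p ^ (n + 1) = z := fun z hz => by
    conv_rhs => rw [← hz]
    simp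
  have h1 : (φ ζ) ^ p ^ (n + 1) = φ ζ := by rw [← map_pow, hζ]
  have h2 : (ζ ^ p) ^ p ^ (n + 1) = ζ ^ p := by rw [← pow_mul, mul_comm, pow_mul, hζ]
  refine Subtype.ext (eq_of_pow_eq_self_of_norm_sub_lt (p := p) norm_natCast_prime_lt_one n (hv _ h1)
    (hv _ h2) (norm_le_one_of_pow_eq_self hq (hv _ h1)) (norm_le_one_of_pow_eq_self hq (hv _ h2)) ?_)
  exact hφ ζ (norm_le_one_of_pow_eq_self hq (hv _ hζ))

namespace IsFrobeniusLift

variable {φ : maxUnramified p K ≃ₐ[ℚ_[p]] maxUnramified p K}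

theorem exists_eq_comp_pow (hφ : IsFrobeniusLift φ)
    (τ τ' : maxUnramified p K →ₐ[ℚ_[p]] PadicAlgCl p) :
    ∃ j : ℕ, τ' = τ.comp ((φ ^ j : maxUnramified p K ≃ₐ[ℚ_[p]] maxUnramified p K) :
      maxUnramified p K →ₐ[ℚ_[p]] maxUnramified p K) := by
  obtain ⟨n, ζ, hζ, hext⟩ := exists_teichmuller_generator p K
  obtain ⟨j, hj⟩ := exists_eq_pow_of_conjugate τ τ' hζ
  refine ⟨j, hext _ _ ?_⟩
  have : ∀ j : ℕ, (φ ^ j) ζ = ζ ^ p ^ j := by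
    intro j
    induction j with
    | zero => simp
    | succ j ih =>
      rw [pow_succ', AlgEquiv.mul_apply, ih, map_pow, hφ.map_teichmuller hζ, ← pow_mul,
        ← pow_succ']
  rw [hj, ← this j]
  rfl

/-- The order is at most the number of automorphisms, hence at most the degree. It is at least the
degree because the twists of one embedding into `PadicAlgCl p` exhaust all embeddings. -/
theorem orderOf_eq (hφ : IsFrobeniusLift φ) : orderOf φ = inertiaDeg p K := by
  classical
  refine le_antisymm ?_ ?_
  · refine orderOf_le_card_univ.trans ?_
    exact AlgEquiv.card_le (F := ℚ_[p]) (K := maxUnramified p K)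
  · obtain ⟨τ⟩ : Nonempty (maxUnramified p K →ₐ[ℚ_[p]] PadicAlgCl p) := ⟨IsAlgClosed.lift⟩
    rw [inertiaDeg, ← AlgHom.card ℚ_[p] (maxUnramified p K) (PadicAlgCl p)]
    rw [← Finset.card_univ, ← Finset.card_range (orderOf φ)]
    refine Finset.card_le_card_of_surjOn (fun j => τ.comp ((φ ^ j :
      maxUnramified p K ≃ₐ[ℚ_[p]] maxUnramified p K) :
      maxUnramified p K →ₐ[ℚ_[p]] maxUnramified p K)) ?_
    intro τ' _
    obtain ⟨j, rfl⟩ := hφ.exists_eq_comp_pow τ τ'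
    refine ⟨j % orderOf φ, by simpa using Nat.mod_lt _ (orderOf_pos φ), ?_⟩
    simp only [pow_mod_orderOf]

/-- The embeddings `τ ∘ φ ^ j`. -/
def _root_.FilteredPhi.twist (φ : maxUnramified p K ≃ₐ[ℚ_[p]] maxUnramified p K) {Ω : Type*} [Field Ω]
    [Algebra ℚ_[p] Ω] (τ : maxUnramified p K →ₐ[ℚ_[p]] Ω) (j : ℕ) :
    maxUnramified p K →ₐ[ℚ_[p]] Ω :=
  τ.comp ((φ ^ j : maxUnramified p K ≃ₐ[ℚ_[p]] maxUnramified p K) :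
      maxUnramified p K →ₐ[ℚ_[p]] maxUnramified p K)

theorem injOn_twist (hφ : IsFrobeniusLift φ) {Ω : Type*} [Field Ω] [Algebra ℚ_[p] Ω]
    (τ : maxUnramified p K →ₐ[ℚ_[p]] Ω) :
    Set.InjOn (twist φ τ) (Finset.range (inertiaDeg p K)) := by
  intro a ha b hb hab
  simp only [Finset.coe_range, Set.mem_Iio, ← hφ.orderOf_eq] at ha hb
  refine pow_injOn_Iio_orderOf (x := φ) ha hb ?_
  ext x
  have := congrArg (fun f => f x) hab
  exact congrArg _ (τ.injective this)

/-- The target need not be algebraically closed: there are `f` distinct twists and at most `f`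
embeddings. -/
theorem image_twist (hφ : IsFrobeniusLift φ) {Ω : Type*} [Field Ω] [Algebra ℚ_[p] Ω]
    [Fintype (maxUnramified p K →ₐ[ℚ_[p]] Ω)] [DecidableEq (maxUnramified p K →ₐ[ℚ_[p]] Ω)]
    (τ : maxUnramified p K →ₐ[ℚ_[p]] Ω) :
    (Finset.range (inertiaDeg p K)).image (twist φ τ) = Finset.univ := by
  refine Finset.eq_univ_of_card _ (le_antisymm (Finset.card_le_univ _) ?_)
  rw [Finset.card_image_of_injOn (hφ.injOn_twist τ), Finset.card_range, ← Nat.card_eq_fintype_card]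
  exact card_algHom_le_finrank ℚ_[p] (maxUnramified p K) Ω

end IsFrobeniusLift

end MaximalUnramified

end FilteredPhi

namespace FilteredPhi

/-! ### Decomposition of submodules over the embeddings -/

section Components

variable {k A L Ω : Type*} [Field k] [Field A] [Algebra k A] [Field L] [Algebra k L]
  [Field Ω] [Algebra k Ω] [Algebra L Ω] [IsScalarTower k L Ω] {d : ℕ}

/-- The homomorphism `L ⊗ A → Ω` induced by an embedding of `A` into an extension `Ω` of `L`. -/
def embMap (L : Type*) [Field L] [Algebra k L] [Algebra L Ω] [IsScalarTower k L Ω]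
    (τ : A →ₐ[k] Ω) : L ⊗[k] A →ₐ[L] Ω :=
  Algebra.TensorProduct.lift (Algebra.ofId L Ω) τ fun _ _ => Commute.all _ _

@[simp] theorem embMap_tmul (τ : A →ₐ[k] Ω) (c : L) (a : A) :
    embMap L τ (c ⊗ₜ a) = algebraMap L Ω c * τ a := by
  simp [embMap, Algebra.ofId_apply]

/-- The component at `τ` of a submodule of `(L ⊗ A) ^ d`. -/
def comp (τ : A →ₐ[k] Ω) (N : Submodule (L ⊗[k] A) (Fin d → L ⊗[k] A)) :
    Submodule Ω (Fin d → Ω) :=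
  Submodule.span Ω ((fun v i => embMap L τ (v i)) '' (N : Set (Fin d → L ⊗[k] A)))

theorem mem_comp_of_mem (τ : A →ₐ[k] Ω) {N : Submodule (L ⊗[k] A) (Fin d → L ⊗[k] A)}
    {v : Fin d → L ⊗[k] A} (hv : v ∈ N) : (fun i => embMap L τ (v i)) ∈ comp τ N :=
  Submodule.subset_span ⟨v, hv, rfl⟩

theorem comp_mono (τ : A →ₐ[k] Ω) {N N' : Submodule (L ⊗[k] A) (Fin d → L ⊗[k] A)}
    (h : N ≤ N') : comp τ N ≤ comp τ N' :=
  Submodule.span_mono (Set.image_mono h)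

theorem comp_bot (τ : A →ₐ[k] Ω) :
    comp τ (⊥ : Submodule (L ⊗[k] A) (Fin d → L ⊗[k] A)) = ⊥ := by
  rw [comp, eq_bot_iff, Submodule.span_le]
  rintro _ ⟨v, hv, rfl⟩
  simp only [Submodule.bot_coe, Set.mem_singleton_iff] at hv
  subst hv
  simp
  rfl

theorem comp_top (τ : A →ₐ[k] Ω) :
    comp τ (⊤ : Submodule (L ⊗[k] A) (Fin d → L ⊗[k] A)) = ⊤ := by
  rw [eq_top_iff, ← (Pi.basisFun Ω (Fin d)).span_eq, Submodule.span_le]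
  rintro _ ⟨i, rfl⟩
  have := mem_comp_of_mem τ (N := (⊤ : Submodule (L ⊗[k] A) (Fin d → L ⊗[k] A)))
    (v := Pi.single i 1) trivial
  have e : (fun j => embMap L τ ((Pi.single i 1 : Fin d → L ⊗[k] A) j)) = Pi.basisFun Ω (Fin d) i := by
    ext j
    rcases eq_or_ne j i with rfl | h <;> simp [*]
  rwa [e] at this

theorem comp_sup (τ : A →ₐ[k] Ω) (N N' : Submodule (L ⊗[k] A) (Fin d → L ⊗[k] A)) :
    comp τ (N ⊔ N') = comp τ N ⊔ comp τ N' := by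
  refine le_antisymm ?_ (sup_le (comp_mono τ le_sup_left) (comp_mono τ le_sup_right))
  rw [comp, Submodule.span_le]
  rintro _ ⟨v, hv, rfl⟩
  obtain ⟨a, ha, b, hb, rfl⟩ := Submodule.mem_sup.1 hv
  have : (fun i => embMap L τ ((a + b) i)) =
      (fun i => embMap L τ (a i)) + fun i => embMap L τ (b i) := by ext; simp
  simp only [this]
  exact add_mem (Submodule.mem_sup_left (mem_comp_of_mem τ ha))
    (Submodule.mem_sup_right (mem_comp_of_mem τ hb))

theorem _root_.LinearIndependent.exists_dual_eq_single {ι W : Type*} [AddCommGroup W] [Module Ω W]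
    [DecidableEq ι] {w : ι → W} (h : LinearIndependent Ω w) (i : ι) :
    ∃ f : W →ₗ[Ω] Ω, ∀ j, f (w j) = if j = i then 1 else 0 := by
  obtain ⟨f, hf⟩ := LinearMap.exists_extend ((Finsupp.lapply i : (ι →₀ Ω) →ₗ[Ω] Ω) ∘ₗ h.repr)
  refine ⟨f, fun j => ?_⟩
  have h1 := congrArg (fun g => g ⟨w j, Submodule.subset_span ⟨j, rfl⟩⟩) hf
  simp only [LinearMap.comp_apply, Submodule.subtype_apply] at h1
  rw [h1, h.repr_eq_single j _ rfl]
  simp [Finsupp.single_apply]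

/-- Coefficients of the idempotents of `Ω ⊗ A`. -/
theorem exists_idempotent_coeff [DecidableEq (A →ₐ[k] Ω)] {J : Type*} [Fintype J] (b : Module.Basis J k A)
    (τ₀ : A →ₐ[k] Ω) :
    ∃ c : J → Ω, ∀ τ : A →ₐ[k] Ω, ∑ j, c j * τ (b j) = if τ = τ₀ then 1 else 0 := by
  classical
  -- By Dedekind's independence of characters a linear form singles out `τ₀`. Its values on the
  -- coordinate functions of `b` are the coefficients sought.
  obtain ⟨f, hf⟩ := (linearIndependent_toLinearMap k A Ω).exists_dual_eq_single τ₀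
  refine ⟨fun j => f (b.constr Ω (Pi.single j 1)), fun τ => ?_⟩
  rw [← hf τ]
  have : (τ.toLinearMap : A →ₗ[k] Ω) = ∑ j, τ (b j) • b.constr Ω (Pi.single j (1 : Ω)) := by
    refine b.ext fun j => ?_
    simp [LinearMap.sum_apply, Pi.single_apply]
  rw [this, map_sum]
  simp [mul_comm]


/-- The embedding of `Ω ⊗ N` into the product of the components of `N`. -/
def compLift (N : Submodule (L ⊗[k] A) (Fin d → L ⊗[k] A)) :
    Ω ⊗[L] N.restrictScalars L →ₗ[Ω] ((τ : A →ₐ[k] Ω) → comp τ N) :=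
  LinearMap.liftBaseChange Ω (LinearMap.pi fun τ =>
    { toFun := fun v => ⟨fun i => embMap L τ (v.1 i), mem_comp_of_mem τ v.2⟩
      map_add' := fun v w => by ext i; simp
      map_smul' := fun c v => by
        ext i
        simp only [SetLike.val_smul, Pi.smul_apply, map_smul, RingHom.id_apply]
        rfl })

theorem compLift_tmul (N : Submodule (L ⊗[k] A) (Fin d → L ⊗[k] A)) (ω : Ω)
    (v : N.restrictScalars L) (τ : A →ₐ[k] Ω) (i : Fin d) :
    ((compLift N (ω ⊗ₜ v) τ : comp τ N) : Fin d → Ω) i = ω * embMap L τ (v.1 i) := by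
  simp [compLift]

variable [FiniteDimensional k A]

instance finite_baseChange : Module.Finite L (L ⊗[k] A) := Module.Finite.base_change k L A

/-- The idempotent attached to `τ₀` isolates its component, and a submodule is stable under
multiplication by the second factors of that idempotent. -/
theorem compLift_surjective (N : Submodule (L ⊗[k] A) (Fin d → L ⊗[k] A)) :
    Function.Surjective (compLift (Ω := Ω) N) := by
  classical
  have : Finite (A →ₐ[k] Ω) := inferInstance
  have : Fintype (A →ₐ[k] Ω) := Fintype.ofFinite _
  let b := Module.finBasis k A
  have key : ∀ (τ₀ : A →ₐ[k] Ω) (w : comp τ₀ N), Pi.single τ₀ w ∈ LinearMap.range (compLift (Ω := Ω) N) := by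
    rintro τ₀ ⟨w, hw⟩
    induction hw using Submodule.span_induction with
    | mem w h =>
      obtain ⟨v, hv, rfl⟩ := h
      obtain ⟨c, hc⟩ := exists_idempotent_coeff (Ω := Ω) b τ₀
      refine ⟨∑ j, c j ⊗ₜ ⟨((1 : L) ⊗ₜ[k] b j) • v, N.smul_mem _ hv⟩, ?_⟩
      ext τ i
      simp only [map_sum, Finset.sum_apply, AddSubmonoidClass.coe_finsetSum, compLift_tmul,
        Pi.smul_apply, smul_eq_mul, map_mul, embMap_tmul, map_one, one_mul, ← mul_assoc]
      rw [← Finset.sum_mul, hc]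
      rcases eq_or_ne τ τ₀ with rfl | h
      · simp
      · simp [h]
    | zero =>
      have := zero_mem (LinearMap.range (compLift (Ω := Ω) N))
      rwa [← Pi.single_zero τ₀] at this
    | add x y hx hy h1 h2 =>
      have := add_mem h1 h2
      rwa [← Pi.single_add] at this
    | smul a x hx h1 =>
      have := Submodule.smul_mem _ a h1
      rwa [← Pi.single_smul] at this
  rw [← LinearMap.range_eq_top, eq_top_iff]
  intro w _
  rw [← Finset.univ_sum_single w]
  exact sum_mem fun τ _ => key τ (w τ)

variable [CharZero k] [IsAlgClosed Ω]

theorem card_algHom_eq_finrank [Fintype (A →ₐ[k] Ω)] :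
    Fintype.card (A →ₐ[k] Ω) = Module.finrank k A :=
  (@Fintype.card_congr _ _ _ (minpoly.AlgHom.fintype k A Ω) (Equiv.refl _)).trans
    (AlgHom.card k A Ω)

/-- For the full module this is a dimension count. For a submodule it follows because base change
along a field extension preserves the inclusion. -/
theorem compLift_injective (N : Submodule (L ⊗[k] A) (Fin d → L ⊗[k] A)) :
    Function.Injective (compLift (Ω := Ω) N) := by
  classical
  have : Fintype (A →ₐ[k] Ω) := Fintype.ofFinite _
  have htop : Function.Injective
      (compLift (Ω := Ω) (⊤ : Submodule (L ⊗[k] A) (Fin d → L ⊗[k] A))) := by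
    refine (LinearMap.injective_iff_surjective_of_finrank_eq_finrank ?_).2 (compLift_surjective _)
    rw [Module.finrank_baseChange, Module.finrank_pi_fintype]
    have hc : ∀ τ : A →ₐ[k] Ω, Module.finrank Ω
        (comp τ (⊤ : Submodule (L ⊗[k] A) (Fin d → L ⊗[k] A))) = d := fun τ => by
      rw [comp_top, finrank_top, Module.finrank_fin_fun]
    simp only [hc, Finset.sum_const, smul_eq_mul, Finset.card_univ, card_algHom_eq_finrank]
    have : Module.finrank L ↥((⊤ : Submodule (L ⊗[k] A) (Fin d → L ⊗[k] A)).restrictScalars L) =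
        Module.finrank L (Fin d → L ⊗[k] A) := finrank_top L _
    rw [this, Module.finrank_pi_fintype]
    simp [mul_comm]
  let j := Submodule.inclusion (show N.restrictScalars L ≤
    (⊤ : Submodule (L ⊗[k] A) (Fin d → L ⊗[k] A)).restrictScalars L from fun _ _ => trivial)
  have hincl : Function.Injective (j.baseChange Ω) :=
    Module.Flat.lTensor_preserves_injective_linearMap (M := Ω) j (Submodule.inclusion_injective _)
  have hcomm : ∀ (x : Ω ⊗[L] N.restrictScalars L) (τ : A →ₐ[k] Ω),
      ((compLift N x τ : comp τ N) : Fin d → Ω) =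
        (compLift (⊤ : Submodule (L ⊗[k] A) (Fin d → L ⊗[k] A)) (j.baseChange Ω x) τ :
          comp τ (⊤ : Submodule (L ⊗[k] A) (Fin d → L ⊗[k] A))) := by
    intro x τ
    induction x with
    | zero => simp only [map_zero, Pi.zero_apply, Submodule.coe_zero]
    | add x y h1 h2 => simp only [map_add, Pi.add_apply, Submodule.coe_add, h1, h2]
    | tmul a v =>
      ext i
      rw [LinearMap.baseChange_tmul, compLift_tmul, compLift_tmul]
      rfl
  intro x y hxy
  refine hincl (htop ?_)
  ext τ : 2
  rw [← hcomm, ← hcomm, hxy]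

theorem finrank_eq_sum_comp [Fintype (A →ₐ[k] Ω)]
    (N : Submodule (L ⊗[k] A) (Fin d → L ⊗[k] A)) :
    Module.finrank L N = ∑ τ : A →ₐ[k] Ω, Module.finrank Ω (comp τ N) := by
  have := (LinearEquiv.ofBijective (compLift (Ω := Ω) N)
    ⟨compLift_injective N, compLift_surjective N⟩).finrank_eq
  rw [Module.finrank_baseChange, Module.finrank_pi_fintype] at this
  exact this

/-- Components commute with sums; the dimension formula for sums and intersections transfers this to
dimensions of intersections. -/
theorem finrank_inf_eq_sum_comp [Fintype (A →ₐ[k] Ω)]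
    (N N' : Submodule (L ⊗[k] A) (Fin d → L ⊗[k] A)) :
    Module.finrank L ↥(N ⊓ N') =
      ∑ τ : A →ₐ[k] Ω, Module.finrank Ω ↥(comp τ N ⊓ comp τ N') := by
  have h1 : Module.finrank L ↥(N ⊔ N') + Module.finrank L ↥(N ⊓ N') =
      Module.finrank L N + Module.finrank L N' := by
    have := Submodule.finrank_sup_add_finrank_inf_eq (N.restrictScalars L) (N'.restrictScalars L)
    have hs : (N ⊔ N').restrictScalars L = N.restrictScalars L ⊔ N'.restrictScalars L := by
      ext x
      simp [Submodule.mem_sup]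
    rw [← hs] at this
    exact this
  rw [finrank_eq_sum_comp (Ω := Ω) (N ⊔ N'), finrank_eq_sum_comp (Ω := Ω) N,
    finrank_eq_sum_comp (Ω := Ω) N', ← Finset.sum_add_distrib] at h1
  have h2 : ∀ τ : A →ₐ[k] Ω, Module.finrank Ω (comp τ (N ⊔ N')) +
      Module.finrank Ω ↥(comp τ N ⊓ comp τ N') =
      Module.finrank Ω (comp τ N) + Module.finrank Ω (comp τ N') := fun τ => by
    rw [comp_sup]
    exact Submodule.finrank_sup_add_finrank_inf_eq _ _
  simp only [← h2, Finset.sum_add_distrib] at h1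
  omega

end Components

end FilteredPhi

namespace FilteredPhi

/-! ### Constancy of the rank of a stable submodule -/

section StableRank

variable {p : ℕ} [Fact p.Prime] {K : Type*} [Field K] [Algebra ℚ_[p] K] {d : ℕ}
  {L : Type*} [NormedField L] [Algebra ℚ_[p] L]
  {Ω : Type*} [Field Ω] [Algebra ℚ_[p] Ω] [Algebra L Ω] [IsScalarTower ℚ_[p] L Ω]

theorem component_eq_comp (ι : PadicAlgCl p →ₐ[ℚ_[p]] AlgebraicClosure L)
    (ψ : K →ₐ[ℚ_[p]] PadicAlgCl p) (N : Submodule (L ⊗[ℚ_[p]] K) (Fin d → L ⊗[ℚ_[p]] K)) :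
    component ι ψ N = comp (ι.comp ψ) N := rfl

theorem embMap_coeffIncl (τ : K →ₐ[ℚ_[p]] Ω) (x : CoeffRing p K L) :
    embMap L τ (coeffIncl p K L x) = embMap L (τ.comp (maxUnramified p K).val) x := by
  have : (embMap L τ).comp (coeffIncl p K L) = embMap L (τ.comp (maxUnramified p K).val) := by
    ext x
    simp [coeffIncl]
  exact congrArg (fun f => f x) this

theorem comp_extendToK (τ : K →ₐ[ℚ_[p]] Ω)
    (D' : Submodule (CoeffRing p K L) (Fin d → CoeffRing p K L)) :
    comp τ (extendToK D') = comp (τ.comp (maxUnramified p K).val) D' := by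
  refine le_antisymm ?_ ?_
  · rw [comp, Submodule.span_le]
    rintro _ ⟨v, hv, rfl⟩
    change (fun i => embMap L τ (v i)) ∈ comp (τ.comp (maxUnramified p K).val) D'
    rw [SetLike.mem_coe, extendToK] at hv
    induction hv using Submodule.span_induction with
    | mem v h =>
      obtain ⟨w, hw, rfl⟩ := h
      simp only [embMap_coeffIncl]
      exact mem_comp_of_mem _ hw
    | zero =>
      rw [show (fun i => embMap L τ ((0 : Fin d → L ⊗[ℚ_[p]] K) i)) = 0 by ext; simp]
      exact zero_mem _
    | add x y hx hy h1 h2 =>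
      rw [show (fun i => embMap L τ ((x + y) i)) =
        (fun i => embMap L τ (x i)) + fun i => embMap L τ (y i) by ext; simp]
      exact add_mem h1 h2
    | smul a x hx h1 =>
      rw [show (fun i => embMap L τ ((a • x) i)) = embMap L τ a • fun i => embMap L τ (x i) by
        ext; simp]
      exact Submodule.smul_mem _ _ h1
  · rw [comp, Submodule.span_le]
    rintro _ ⟨w, hw, rfl⟩
    have := mem_comp_of_mem τ (N := extendToK D') (v := fun k => coeffIncl p K L (w k))
      (Submodule.subset_span ⟨w, hw, rfl⟩)
    simp only [embMap_coeffIncl] at this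
    exact this

theorem frob_apply (φ : maxUnramified p K ≃ₐ[ℚ_[p]] maxUnramified p K)
    (g : GL (Fin d) (CoeffRing p K L)) (v : Fin d → CoeffRing p K L) :
    frob φ g v = (g : Matrix (Fin d) (Fin d) (CoeffRing p K L)).mulVec fun i =>
      Algebra.TensorProduct.map (AlgHom.id L L)
      (φ : maxUnramified p K →ₐ[ℚ_[p]] maxUnramified p K) (v i) := rfl

theorem embMap_map (φ : maxUnramified p K ≃ₐ[ℚ_[p]] maxUnramified p K)
    (τ : maxUnramified p K →ₐ[ℚ_[p]] Ω) (x : CoeffRing p K L) :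
    embMap L τ (Algebra.TensorProduct.map (AlgHom.id L L)
      (φ : maxUnramified p K →ₐ[ℚ_[p]] maxUnramified p K) x) = embMap L (twist φ τ 1) x := by
  have : (embMap L τ).comp (Algebra.TensorProduct.map (AlgHom.id L L)
      (φ : maxUnramified p K →ₐ[ℚ_[p]] maxUnramified p K)) = embMap L (twist φ τ 1) := by
    ext x
    simp [twist]
  exact congrArg (fun f => f x) this

theorem twist_succ (φ : maxUnramified p K ≃ₐ[ℚ_[p]] maxUnramified p K)
    (τ : maxUnramified p K →ₐ[ℚ_[p]] Ω) (j : ℕ) :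
    twist φ τ (j + 1) = twist φ (twist φ τ j) 1 := by
  ext x
  simp [twist, pow_succ]

variable {φ : maxUnramified p K ≃ₐ[ℚ_[p]] maxUnramified p K} {g : GL (Fin d) (CoeffRing p K L)}
  {D' : Submodule (CoeffRing p K L) (Fin d → CoeffRing p K L)}

/-- The component of `Φ_g` at `τ` is an invertible matrix applied to the component at `τ ∘ φ`, so
stability embeds the latter component of `D'` into the one at `τ`. -/
theorem IsStable.finrank_comp_twist_one_le (h : IsStable φ g D')
    (τ : maxUnramified p K →ₐ[ℚ_[p]] Ω) :
    Module.finrank Ω (comp (twist φ τ 1) D') ≤ Module.finrank Ω (comp τ D') := by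
  let G : GL (Fin d) Ω := Matrix.GeneralLinearGroup.map (embMap L τ).toRingHom g
  have hinj : Function.Injective (Matrix.mulVecLin (G : Matrix (Fin d) (Fin d) Ω)) :=
    Matrix.mulVec_injective_of_isUnit G.isUnit
  rw [(Submodule.equivMapOfInjective _ hinj (comp (twist φ τ 1) D')).finrank_eq]
  refine Submodule.finrank_mono ?_
  rw [Submodule.map_le_iff_le_comap, comp, Submodule.span_le]
  rintro _ ⟨v, hv, rfl⟩
  rw [SetLike.mem_coe, Submodule.mem_comap]
  have := mem_comp_of_mem τ (h v hv)
  convert this using 1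
  ext i
  simp only [frob_apply, Matrix.mulVecLin_apply, Matrix.mulVec, dotProduct, map_sum, map_mul,
    embMap_map]
  rfl

/-- Dimensions do not increase along twists, and twisting reaches every embedding from every other
one, so they are all equal. -/
theorem IsStable.exists_rank [FiniteDimensional ℚ_[p] K] (hφ : IsFrobeniusLift φ)
    (h : IsStable φ g D') (Ω : Type*) [Field Ω] [Algebra ℚ_[p] Ω] [Algebra L Ω]
    [IsScalarTower ℚ_[p] L Ω] [IsAlgClosed Ω] :
    ∃ r ≤ d, (∀ τ : maxUnramified p K →ₐ[ℚ_[p]] Ω, Module.finrank Ω (comp τ D') = r) ∧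
      Module.finrank L D' = inertiaDeg p K * r := by
  classical
  have : Fintype (maxUnramified p K →ₐ[ℚ_[p]] Ω) := Fintype.ofFinite _
  have h1 : ∀ (τ : maxUnramified p K →ₐ[ℚ_[p]] Ω) (j : ℕ),
      Module.finrank Ω (comp (twist φ τ j) D') ≤ Module.finrank Ω (comp τ D') := by
    intro τ j
    induction j with
    | zero => exact le_of_eq rfl
    | succ j ih =>
      rw [twist_succ]
      exact (h.finrank_comp_twist_one_le _).trans ih
  have h2 : ∀ τ τ' : maxUnramified p K →ₐ[ℚ_[p]] Ω,
      Module.finrank Ω (comp τ' D') ≤ Module.finrank Ω (comp τ D') := by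
    intro τ τ'
    have := Finset.mem_univ τ'
    rw [← hφ.image_twist τ, Finset.mem_image] at this
    obtain ⟨j, -, rfl⟩ := this
    exact h1 τ j
  obtain ⟨τ₀⟩ : Nonempty (maxUnramified p K →ₐ[ℚ_[p]] Ω) := ⟨IsAlgClosed.lift⟩
  refine ⟨Module.finrank Ω (comp τ₀ D'), (Submodule.finrank_le _).trans (by simp),
    fun τ => le_antisymm (h2 _ _) (h2 _ _), ?_⟩
  rw [finrank_eq_sum_comp (Ω := Ω) D',
    Finset.sum_congr rfl fun τ _ => le_antisymm (h2 τ₀ τ) (h2 τ τ₀), Finset.sum_const,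
    Finset.card_univ, card_algHom_eq_finrank, smul_eq_mul, inertiaDeg]

end StableRank

/-! ### Degree of the induced filtration -/

section FiltrationDegree

variable {p : ℕ} [Fact p.Prime] {K : Type*} [Field K] [Algebra ℚ_[p] K]
  {d : ℕ} {L : Type*} [NormedField L] [Algebra ℚ_[p] L]

variable {ν : DominantCocharacter p K d}

theorem Filtration.IsOfType.finrank_component [Algebra ν.reflexField L]
    [IsScalarTower ℚ_[p] ν.reflexField L] {F : Filtration p K d L} (hF : F.IsOfType ν)
    (ι : PadicAlgCl p →ₐ[ν.reflexField] AlgebraicClosure L) (ψ : K →ₐ[ℚ_[p]] PadicAlgCl p) (x : ℤ) :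
    Module.finrank (AlgebraicClosure L) (comp ((ι.restrictScalars ℚ_[p]).comp ψ) (F.step x)) =
      ν.stepRank ψ x := by
  obtain ⟨b₀, hb₀⟩ := F.separated
  obtain ⟨b, hbb, hbν⟩ : ∃ b, b₀ ≤ b ∧ ∀ k, ν.toFun ψ k < b := by
    obtain ⟨c, hc⟩ := (Set.finite_range (ν.toFun ψ)).bddAbove
    exact ⟨max b₀ (c + 1), le_max_left _ _, fun k => lt_of_lt_of_le (Int.lt_add_one_of_le (hc ⟨k, rfl⟩))
      (le_max_right _ _)⟩
  have hbase : ∀ x ≥ b, Module.finrank (AlgebraicClosure L)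
      (comp ((ι.restrictScalars ℚ_[p]).comp ψ) (F.step x)) = ν.stepRank ψ x := by
    intro x hx
    have h1 : F.step x = ⊥ := eq_bot_iff.2 (hb₀ ▸ F.antitone (hbb.trans hx))
    rw [h1, comp_bot, finrank_bot, DominantCocharacter.stepRank, eq_comm, Finset.card_eq_zero,
      Finset.filter_eq_empty_iff]
    intro k _
    have := hbν k
    omega
  have key : ∀ n : ℕ, Module.finrank (AlgebraicClosure L)
      (comp ((ι.restrictScalars ℚ_[p]).comp ψ) (F.step (b - n))) = ν.stepRank ψ (b - n) := by
    intro n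
    induction n with
    | zero => exact hbase _ (by simp)
    | succ n ih =>
      have h1 := hF ι ψ (b - (n + 1 : ℕ))
      rw [component_eq_comp, component_eq_comp,
        show b - ((n + 1 : ℕ) : ℤ) + 1 = b - n by push_cast; ring] at h1
      rw [h1, ih, DominantCocharacter.stepRank, DominantCocharacter.stepRank,
        ← Finset.card_union_of_disjoint]
      · congr 1
        ext k
        simp only [Finset.mem_union, Finset.mem_filter, Finset.mem_univ, true_and]
        push_cast
        omega
      · rw [Finset.disjoint_filter]
        intro k _
        push_cast
        omega
  rcases le_total b x with h | h
  · exact hbase x h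
  · have := key (b - x).toNat
    rwa [show b - ((b - x).toNat : ℤ) = x by omega] at this

theorem finrank_comp_top (τ : maxUnramified p K →ₐ[ℚ_[p]] AlgebraicClosure L) :
    Module.finrank (AlgebraicClosure L)
      (comp τ (⊤ : Submodule (CoeffRing p K L) (Fin d → CoeffRing p K L))) = d := by
  rw [comp_top, finrank_top, Module.finrank_fin_fun]

theorem sum_range_mul_sub_succ (h : ℤ → ℝ) (a : ℤ) (n : ℕ) :
    ∑ m ∈ Finset.range n, ((a + m : ℤ) : ℝ) * (h (a + m) - h (a + m + 1)) =
      a * h a + ∑ m ∈ Finset.range n, h (a + m + 1) - ((a + n : ℤ) : ℝ) * h (a + n) := by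
  induction n with
  | zero => simp
  | succ n ih =>
    rw [Finset.sum_range_succ, Finset.sum_range_succ, ih]
    push_cast
    rw [show a + (n : ℤ) + 1 = a + ((n : ℤ) + 1) by ring]
    ring

/-- Abel summation replaces graded pieces by the steps themselves, whose dimensions can be bounded
term by term. -/
theorem filtrationDegree_eq (F : Filtration p K d L)
    (D' : Submodule (CoeffRing p K L) (Fin d → CoeffRing p K L)) {a : ℤ} {n : ℕ}
    (ha : F.step a = ⊤) (hb : F.step (a + n) = ⊥) :
    filtrationDegree F D' = (1 / ((ramIdx p K : ℝ) * inertiaDeg p K)) *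
      (a * Module.finrank L (extendToK D') +
        ∑ m ∈ Finset.range n, (Module.finrank L ↥(F.step (a + m + 1) ⊓ extendToK D') : ℝ)) := by
  have htop : ∀ x ≤ a, F.step x = ⊤ := fun x hx => eq_top_iff.2 (ha ▸ F.antitone hx)
  have hbot : ∀ x ≥ a + n, F.step x = ⊥ := fun x hx => eq_bot_iff.2 (hb ▸ F.antitone hx)
  set h : ℤ → ℝ := fun x => (Module.finrank L ↥(F.step x ⊓ extendToK D') : ℝ) with hh
  have h0 : h (a + n) = 0 := by
    simp only [hh]
    rw [hb, bot_inf_eq]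
    exact_mod_cast finrank_bot L (Fin d → L ⊗[ℚ_[p]] K)
  have ha' : h a = Module.finrank L (extendToK D') := by
    simp only [hh]
    rw [ha, top_inf_eq]
  rw [filtrationDegree, finsum_eq_sum_of_support_subset
    (s := (Finset.range n).map ⟨fun m : ℕ => a + (m : ℤ), fun _ _ h => by simpa using h⟩)]
  · rw [Finset.sum_map, ← ha']
    have := sum_range_mul_sub_succ h a n
    rw [h0, mul_zero, sub_zero] at this
    rw [← this, Finset.mul_sum]
    refine Finset.sum_congr rfl fun m _ => ?_
    simp only [hh]
    rw [mul_assoc]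
    rfl
  · intro x hx
    by_contra hc
    refine hx ?_
    have hx' : h x - h (x + 1) = 0 := by
      by_cases h1 : x < a
      · simp only [hh]
        rw [htop x h1.le, htop (x + 1) (by omega), sub_self]
      · have h2 : a + n ≤ x := by
          by_contra h3
          refine hc ?_
          rw [Finset.mem_coe, Finset.mem_map]
          refine ⟨(x - a).toNat, Finset.mem_range.2 (by omega), ?_⟩
          change a + ((x - a).toNat : ℤ) = x
          omega
        simp only [hh]
        rw [hbot x h2, hbot (x + 1) (by omega), sub_self]
    simp only [hh] at hx'
    simp only [hx', mul_zero]

theorem nonempty_algHom_of_isAlgebraic (k S M : Type*) [Field k] [Field S] [Algebra k S]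
    [Algebra.IsAlgebraic k S] [Field M] [IsAlgClosed M] [Algebra k M] : Nonempty (S →ₐ[k] M) :=
  ⟨IsAlgClosed.lift⟩

theorem exists_embedding_algebraicClosure (ν : DominantCocharacter p K d) (L : Type*)
    [NormedField L] [Algebra ν.reflexField L] :
    Nonempty (PadicAlgCl p →ₐ[ν.reflexField] AlgebraicClosure L) :=
  nonempty_algHom_of_isAlgebraic ν.reflexField (PadicAlgCl p) (AlgebraicClosure L)

theorem sum_lastIndices_eq (ψ : K →ₐ[ℚ_[p]] PadicAlgCl p) {r : ℕ} (hr : r ≤ d) {a : ℤ} {n : ℕ}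
    (h₁ : ∀ k, a ≤ ν.toFun ψ k) (h₂ : ∀ k, ν.toFun ψ k ≤ a + n) :
    ∑ k ∈ lastIndices d r, ν.toFun ψ k =
      a * r + ∑ m ∈ Finset.range n, max 0 ((ν.stepRank ψ (a + m + 1) : ℤ) + r - d) := by
  simp only [ν.max_stepRank ψ _ hr]
  rw [Finset.sum_comm]
  have : ∀ k, ν.toFun ψ k = a + ∑ m ∈ Finset.range n,
      if a + (m : ℤ) + 1 ≤ ν.toFun ψ k then (1 : ℤ) else 0 := by
    intro k
    rw [Finset.sum_boole]
    have : (Finset.range n).filter (fun m : ℕ => a + (m : ℤ) + 1 ≤ ν.toFun ψ k) =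
        Finset.range (ν.toFun ψ k - a).toNat := by
      ext m
      have := h₁ k
      have := h₂ k
      simp only [Finset.mem_filter, Finset.mem_range]
      omega
    rw [this, Finset.card_range]
    have := h₁ k
    omega
  rw [Finset.sum_congr rfl fun k _ => this k, Finset.sum_add_distrib, Finset.sum_const,
    card_lastIndices hr, nsmul_eq_mul, mul_comm]

variable [FiniteDimensional ℚ_[p] K]

theorem sum_embeddings {L : Type*} [NormedField L] [Algebra ℚ_[p] L]
    (ι : PadicAlgCl p →ₐ[ℚ_[p]] AlgebraicClosure L) [Fintype (K →ₐ[ℚ_[p]] AlgebraicClosure L)]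
    (f : (K →ₐ[ℚ_[p]] AlgebraicClosure L) → ℕ) :
    ∑ τ, f τ = ∑ ψ : K →ₐ[ℚ_[p]] PadicAlgCl p, f (ι.comp ψ) := by
  have hinj : Function.Injective fun ψ : K →ₐ[ℚ_[p]] PadicAlgCl p => ι.comp ψ := by
    intro ψ ψ' h
    ext x
    exact ι.injective (congrArg (fun f => f x) h)
  refine (Fintype.sum_bijective (fun ψ : K →ₐ[ℚ_[p]] PadicAlgCl p => ι.comp ψ)
    ((Fintype.bijective_iff_injective_and_card _).2 ⟨hinj, ?_⟩) _ _ fun _ => rfl).symm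
  rw [card_algHom_eq_finrank, card_algHom_eq_finrank]

/-- The degree of the induced filtration on a stable submodule of rank `r`, in terms of the
components. -/
theorem Filtration.IsOfType.exists_filtrationDegree_eq [Algebra ν.reflexField L]
    [IsScalarTower ℚ_[p] ν.reflexField L] {F : Filtration p K d L}
    (ι : PadicAlgCl p →ₐ[ν.reflexField] AlgebraicClosure L) {r : ℕ} (hr : r ≤ d)
    {D' : Submodule (CoeffRing p K L) (Fin d → CoeffRing p K L)}
    (hD' : ∀ τ : maxUnramified p K →ₐ[ℚ_[p]] AlgebraicClosure L,
      Module.finrank (AlgebraicClosure L) (comp τ D') = r) :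
    ∃ (a : ℤ) (n : ℕ),
      filtrationDegree F D' = (1 / ((ramIdx p K : ℝ) * inertiaDeg p K)) *
        ((∑ ψ : K →ₐ[ℚ_[p]] PadicAlgCl p, (a * r + ∑ m ∈ Finset.range n,
          (Module.finrank (AlgebraicClosure L) ↥(comp ((ι.restrictScalars ℚ_[p]).comp ψ)
            (F.step (a + m + 1)) ⊓ comp ((ι.restrictScalars ℚ_[p]).comp ψ) (extendToK D')) : ℤ)) : ℤ)
              : ℝ) ∧
      (ν.l r : ℝ) = (1 / ((ramIdx p K : ℝ) * inertiaDeg p K)) *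
        ((∑ ψ : K →ₐ[ℚ_[p]] PadicAlgCl p, (a * r + ∑ m ∈ Finset.range n,
          max 0 ((ν.stepRank ψ (a + m + 1) : ℤ) + r - d)) : ℤ) : ℝ) := by
  classical
  have : Fintype (K →ₐ[ℚ_[p]] AlgebraicClosure L) := Fintype.ofFinite _
  obtain ⟨a₀, ha₀⟩ := F.exhaustive
  obtain ⟨b₀, hb₀⟩ := F.separated
  obtain ⟨a₁, ha₁⟩ := (Set.finite_range fun q : (K →ₐ[ℚ_[p]] PadicAlgCl p) × Fin d =>
    ν.toFun q.1 q.2).bddBelow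
  obtain ⟨b₁, hb₁⟩ := (Set.finite_range fun q : (K →ₐ[ℚ_[p]] PadicAlgCl p) × Fin d =>
    ν.toFun q.1 q.2).bddAbove
  set a := min a₀ a₁
  obtain ⟨n, hn⟩ : ∃ n : ℕ, max b₀ b₁ ≤ a + n := ⟨(max b₀ b₁ - a).toNat, by omega⟩
  have ha : F.step a = ⊤ := eq_top_iff.2 (ha₀ ▸ F.antitone (min_le_left _ _))
  have hb : F.step (a + n) = ⊥ := eq_bot_iff.2 (hb₀ ▸ F.antitone ((le_max_left _ _).trans hn))
  refine ⟨a, n, ?_, ?_⟩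
  · rw [filtrationDegree_eq F D' ha hb]
    congr 1
    have h1 : (Module.finrank L (extendToK D') : ℝ) =
        ((∑ ψ : K →ₐ[ℚ_[p]] PadicAlgCl p, (r : ℤ) : ℤ) : ℝ) := by
      rw [finrank_eq_sum_comp (Ω := AlgebraicClosure L) (extendToK D'),
        sum_embeddings (ι.restrictScalars ℚ_[p])]
      have hr' : ∀ ψ : K →ₐ[ℚ_[p]] PadicAlgCl p, Module.finrank (AlgebraicClosure L)
          (comp ((ι.restrictScalars ℚ_[p]).comp ψ) (extendToK D')) = r := fun ψ => by
        rw [comp_extendToK, hD']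
      simp only [hr']
      push_cast
      rfl
    have h2 : ∀ m : ℕ, (Module.finrank L ↥(F.step (a + m + 1) ⊓ extendToK D') : ℝ) =
        ((∑ ψ : K →ₐ[ℚ_[p]] PadicAlgCl p, (Module.finrank (AlgebraicClosure L)
          ↥(comp ((ι.restrictScalars ℚ_[p]).comp ψ)
            (F.step (a + m + 1)) ⊓ comp ((ι.restrictScalars ℚ_[p]).comp ψ) (extendToK D')) : ℤ) : ℤ)
              : ℝ) := by
      intro m
      rw [finrank_inf_eq_sum_comp (Ω := AlgebraicClosure L),
        sum_embeddings (ι.restrictScalars ℚ_[p])]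
      push_cast
      rfl
    simp only [h1, h2]
    rw [Finset.sum_add_distrib, Finset.sum_comm, ← Finset.mul_sum]
    push_cast
    rfl
  · rw [ν.l_eq_sum hr]
    have : ∀ ψ : K →ₐ[ℚ_[p]] PadicAlgCl p, _ := fun ψ => sum_lastIndices_eq (ν := ν) ψ hr
      (a := a) (n := n)
      (fun k => (min_le_right _ _).trans (ha₁ ⟨(ψ, k), rfl⟩))
      (fun k => (hb₁ ⟨(ψ, k), rfl⟩).trans ((le_max_right _ _).trans hn))
    simp only [this]
    push_cast
    rfl

/-- Subspaces of dimensions `n` and `r` in a `d`-dimensional space meet in dimension at least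
`max(0, n + r - d)`. -/
theorem Filtration.IsOfType.l_le_filtrationDegree [Algebra ν.reflexField L]
    [IsScalarTower ℚ_[p] ν.reflexField L] {F : Filtration p K d L} (hF : F.IsOfType ν)
    (ι : PadicAlgCl p →ₐ[ν.reflexField] AlgebraicClosure L) {r : ℕ} (hr : r ≤ d)
    {D' : Submodule (CoeffRing p K L) (Fin d → CoeffRing p K L)}
    (hD' : ∀ τ : maxUnramified p K →ₐ[ℚ_[p]] AlgebraicClosure L,
      Module.finrank (AlgebraicClosure L) (comp τ D') = r) :
    (ν.l r : ℝ) ≤ filtrationDegree F D' := by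
  obtain ⟨a, n, h1, h2⟩ := Filtration.IsOfType.exists_filtrationDegree_eq (F := F) ι hr hD'
  rw [h1, h2]
  refine mul_le_mul_of_nonneg_left ?_ (by positivity)
  refine Int.cast_le.2 (Finset.sum_le_sum fun ψ _ => add_le_add le_rfl
    (Finset.sum_le_sum fun m _ => max_le (by positivity) ?_))
  have h3 := Submodule.finrank_sup_add_finrank_inf_eq
    (comp ((ι.restrictScalars ℚ_[p]).comp ψ) (F.step (a + m + 1)))
    (comp ((ι.restrictScalars ℚ_[p]).comp ψ) (extendToK D'))
  rw [hF.finrank_component, comp_extendToK, hD'] at h3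
  have h4 := Submodule.finrank_le (comp ((ι.restrictScalars ℚ_[p]).comp ψ) (F.step (a + m + 1)) ⊔
    comp (((ι.restrictScalars ℚ_[p]).comp ψ).comp (maxUnramified p K).val) D')
  rw [Module.finrank_fin_fun] at h4
  rw [comp_extendToK]
  omega

/-- The hypothesis `h` says that all steps are in general position with respect to `D'`, which makes
the intersections minimal. -/
theorem Filtration.IsOfType.filtrationDegree_le_l [Algebra ν.reflexField L]
    [IsScalarTower ℚ_[p] ν.reflexField L] {F : Filtration p K d L}
    (ι : PadicAlgCl p →ₐ[ν.reflexField] AlgebraicClosure L) {r : ℕ} (hr : r ≤ d)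
    {D' : Submodule (CoeffRing p K L) (Fin d → CoeffRing p K L)}
    (hD' : ∀ τ : maxUnramified p K →ₐ[ℚ_[p]] AlgebraicClosure L,
      Module.finrank (AlgebraicClosure L) (comp τ D') = r)
    (h : ∀ (ψ : K →ₐ[ℚ_[p]] PadicAlgCl p) (x : ℤ), (Module.finrank (AlgebraicClosure L)
      ↥(comp ((ι.restrictScalars ℚ_[p]).comp ψ) (F.step x) ⊓
        comp (((ι.restrictScalars ℚ_[p]).comp ψ).comp (maxUnramified p K).val) D') : ℤ) ≤
          max 0 ((ν.stepRank ψ x : ℤ) + r - d)) :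
    filtrationDegree F D' ≤ ν.l r := by
  obtain ⟨a, n, h1, h2⟩ := Filtration.IsOfType.exists_filtrationDegree_eq (F := F) ι hr hD'
  rw [h1, h2]
  refine mul_le_mul_of_nonneg_left ?_ (by positivity)
  refine Int.cast_le.2 (Finset.sum_le_sum fun ψ _ => add_le_add le_rfl
    (Finset.sum_le_sum fun m _ => ?_))
  rw [comp_extendToK]
  exact h ψ _

theorem Filtration.IsOfType.filtrationDegree_top [Algebra ν.reflexField L]
    [IsScalarTower ℚ_[p] ν.reflexField L] {F : Filtration p K d L} (hF : F.IsOfType ν)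
    (ι : PadicAlgCl p →ₐ[ν.reflexField] AlgebraicClosure L) :
    filtrationDegree F ⊤ = ν.l d := by
  refine le_antisymm (Filtration.IsOfType.filtrationDegree_le_l ι le_rfl finrank_comp_top fun ψ x => ?_)
    (hF.l_le_filtrationDegree ι le_rfl finrank_comp_top)
  rw [comp_top, inf_top_eq, hF.finrank_component]
  simp

end FiltrationDegree

end FilteredPhi

namespace FilteredPhi

/-! ### Characteristic polynomials on stable subspaces and quotients -/

section Charpoly

open Polynomial

/-- The remainder theorem for matrices: `X - M` divides `X ^ k - M ^ k` by the geometric sum. -/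
theorem exists_charmatrix_mul_eq {R n : Type*} [CommRing R] [Fintype n] [DecidableEq n]
    (M : Matrix n n R) (Q : R[X]) : ∃ B : Matrix n n R[X],
      M.charmatrix * B = Matrix.scalar n Q - C.mapMatrix (aeval M Q) := by
  induction Q using Polynomial.induction_on' with
  | add P Q hP hQ =>
    obtain ⟨B, hB⟩ := hP
    obtain ⟨B', hB'⟩ := hQ
    exact ⟨B + B', by rw [mul_add, hB, hB', map_add, map_add, map_add]; abel⟩
  | monomial k a =>
    refine ⟨(∑ i ∈ Finset.range k, Matrix.scalar n (X : R[X]) ^ i *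
      (C.mapMatrix M) ^ (k - 1 - i)) * Matrix.scalar n (C a), ?_⟩
    have hc : Commute (Matrix.scalar n (X : R[X])) (C.mapMatrix M) :=
      Matrix.scalar_commute _ (fun _ => Commute.all _ _) _
    have ha : C.mapMatrix (algebraMap R (Matrix n n R) a) = Matrix.scalar n (C a) := by
      ext i j
      by_cases h : i = j
      · subst h; simp [Matrix.algebraMap_matrix_apply]
      · simp [Matrix.algebraMap_matrix_apply, h]
    rw [Matrix.charmatrix, ← mul_assoc, hc.mul_geom_sum₂, aeval_monomial, map_mul, map_pow, ha,
      ← (Matrix.scalar_commute (C a) (fun _ => Commute.all _ _) _).eq, mul_sub, ← map_pow,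
      ← map_mul, C_mul_X_pow_eq_monomial]

variable {k V : Type*} [Field k] [AddCommGroup V] [Module k V]

theorem aeval_restrict_apply {W : Submodule k V} {e : Module.End k V} (he : ∀ x ∈ W, e x ∈ W)
    (Q : k[X]) (x : W) : (aeval (e.restrict he) Q x : V) = aeval e Q x := by
  induction Q using Polynomial.induction_on' generalizing x with
  | add P Q hP hQ => simp [hP, hQ]
  | monomial n a =>
    simp only [aeval_monomial, Module.End.mul_apply, Module.algebraMap_end_apply,
      Submodule.coe_smul, Module.End.pow_restrict n he, LinearMap.coe_restrict_apply]

theorem aeval_mapQ_mk {W : Submodule k V} {e : Module.End k V} (he : ∀ x ∈ W, e x ∈ W)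
    (Q : k[X]) (x : V) :
    aeval (W.mapQ W e he) Q (Submodule.Quotient.mk x) = Submodule.Quotient.mk (aeval e Q x) := by
  induction Q using Polynomial.induction_on' with
  | add P Q hP hQ => simp [hP, hQ]
  | monomial n a =>
    simp only [aeval_monomial, Module.End.mul_apply, Module.algebraMap_end_apply,
      Submodule.Quotient.mk_smul]
    congr 1
    induction n generalizing x with
    | zero => simp
    | succ n ih => rw [pow_succ, pow_succ, Module.End.mul_apply, Submodule.mapQ_apply, ih]; rfl

variable [Module.Finite k V]

/-- The characteristic polynomial divides a power of every annihilating polynomial. -/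
theorem exists_charpoly_dvd_pow {T : Module.End k V} {Q : k[X]} (h : aeval T Q = 0) :
    ∃ n : ℕ, T.charpoly ∣ Q ^ n := by
  classical
  let b := Module.Free.chooseBasis k V
  obtain ⟨B, hB⟩ := exists_charmatrix_mul_eq (LinearMap.toMatrix b b T) Q
  have h0 : aeval (LinearMap.toMatrix b b T) Q = 0 := by
    have := aeval_algHom_apply (LinearMap.toMatrixAlgEquiv b).toAlgHom T Q
    rw [h, map_zero] at this
    exact this
  refine ⟨Fintype.card (Module.Free.ChooseBasisIndex k V), B.det, ?_⟩
  rw [h0, map_zero, sub_zero] at hB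
  have := congrArg Matrix.det hB
  rw [Matrix.det_mul, Matrix.scalar_apply, Matrix.det_diagonal, Finset.prod_const,
    Finset.card_univ] at this
  exact this.symm

/-- Evaluation at each scalar reduces this to multiplicativity of determinants, which suffices over
an infinite field. -/
theorem charpoly_eq_charpoly_restrict_mul_charpoly_mapQ [Infinite k] (W : Submodule k V)
    (e : Module.End k V) (he : ∀ x ∈ W, e x ∈ W) :
    e.charpoly = (e.restrict he).charpoly * (W.mapQ W e he).charpoly := by
  refine Polynomial.funext fun t => ?_
  have ht : W ≤ W.comap (algebraMap k (Module.End k V) t - e) := fun x hx => by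
    rw [Submodule.mem_comap, LinearMap.sub_apply, Module.algebraMap_end_apply]
    exact sub_mem (W.smul_mem t hx) (he x hx)
  rw [eval_mul, LinearMap.eval_charpoly, LinearMap.eval_charpoly, LinearMap.eval_charpoly,
    LinearMap.det_eq_det_mul_det W _ ht]
  congr 2
  refine LinearMap.ext fun x => ?_
  induction x using Submodule.Quotient.induction_on with
  | H x => simp [Module.algebraMap_end_apply]

/-- If the characteristic polynomial of `T` is `(Q R) ^ n` with `Q` and `R` coprime and
`Q(T) R(T) = 0`, then it is `Q ^ n` on `ker Q(T)`. -/
theorem charpoly_restrict_ker_aeval [Infinite k] {T : Module.End k V} {Q R : k[X]} {n : ℕ}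
    (hQ : Q.Monic) (hQR : IsCoprime Q R) (hT : T.charpoly = (Q * R) ^ n)
    (h0 : aeval T (Q * R) = 0) (W : Submodule k V) (hW : ∀ x, x ∈ W ↔ aeval T Q x = 0)
    (he : ∀ x ∈ W, T x ∈ W) : (T.restrict he).charpoly = Q ^ n := by
  have h1 : aeval (T.restrict he) Q = 0 := by
    refine LinearMap.ext fun x => Subtype.ext ?_
    rw [aeval_restrict_apply, (hW x).1 x.2]
    simp
  have h2 : aeval (W.mapQ W T he) R = 0 := by
    refine LinearMap.ext fun x => ?_
    induction x using Submodule.Quotient.induction_on with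
    | H x =>
      rw [aeval_mapQ_mk, LinearMap.zero_apply, Submodule.Quotient.mk_eq_zero, hW,
        ← Module.End.mul_apply, ← map_mul, h0, LinearMap.zero_apply]
  -- The characteristic polynomial divides a power of `Q` on `W` and a power of `R` on the quotient.
  -- Since `Q` and `R` are coprime, this separates the two factors of `(Q R) ^ n`.
  obtain ⟨a, ha⟩ := exists_charpoly_dvd_pow h1
  obtain ⟨b, hb⟩ := exists_charpoly_dvd_pow h2
  have h3 := charpoly_eq_charpoly_restrict_mul_charpoly_mapQ W T he
  rw [hT, mul_pow] at h3
  refine Polynomial.eq_of_monic_of_associated (LinearMap.charpoly_monic _) (hQ.pow n)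
    (associated_of_dvd_dvd ?_ ?_)
  · exact ((hQR.pow (m := a) (n := n)).of_isCoprime_of_dvd_left ha).dvd_of_dvd_mul_right
      (h3 ▸ dvd_mul_right _ _)
  · exact ((hQR.pow (m := n) (n := b)).of_isCoprime_of_dvd_right hb).dvd_of_dvd_mul_right
      (h3 ▸ dvd_mul_right _ _)

/-- The determinant over `k` is the norm of the determinant over `S`, and the norm of a scalar is
its power. -/
theorem charpoly_restrictScalars_mulVecLin [Infinite k] {S n : Type*} [CommRing S] [Algebra k S]
    [Module.Finite k S] [Fintype n] [DecidableEq n] {N : Matrix n n S} {P : k[X]}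
    (h : N.charpoly = P.map (algebraMap k S)) :
    ((Matrix.mulVecLin N).restrictScalars k).charpoly = P ^ Module.finrank k S := by
  refine Polynomial.funext fun t => ?_
  rw [LinearMap.eval_charpoly, eval_pow, ← Algebra.norm_algebraMap]
  have : algebraMap k (Module.End k (n → S)) t - (Matrix.mulVecLin N).restrictScalars k =
      (algebraMap S (Module.End S (n → S)) (algebraMap k S t) - Matrix.mulVecLin N).restrictScalars
        k := by
    ext v i
    simp [Module.algebraMap_end_apply]
  rw [this, LinearMap.det_restrictScalars, ← LinearMap.eval_charpoly, Matrix.charpoly_mulVecLin,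
    h, eval_map_algebraMap, aeval_algebraMap_apply]
  rfl

end Charpoly

/-! ### Stable submodules and the linear power of Frobenius -/

section FrobeniusPower

open Polynomial

theorem aeval_restrictScalars_mulVecLin {k S n : Type*} [Field k] [CommRing S] [Algebra k S]
    [Fintype n] [DecidableEq n] (N : Matrix n n S) (Q : k[X]) :
    aeval ((Matrix.mulVecLin N).restrictScalars k) Q =
      (Matrix.mulVecLin (aeval N Q)).restrictScalars k := by
  refine LinearMap.ext fun v => ?_
  induction Q using Polynomial.induction_on' generalizing v with
  | add P Q hP hQ =>
    rw [map_add, map_add, LinearMap.add_apply, hP, hQ]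
    simp
  | monomial m a =>
    simp only [aeval_monomial, Module.End.mul_apply, Module.algebraMap_end_apply,
      LinearMap.coe_restrictScalars, Matrix.mulVecLin_apply]
    rw [← Matrix.mulVec_mulVec, Algebra.algebraMap_eq_smul_one, Matrix.smul_mulVec,
      Matrix.one_mulVec]
    congr 1
    induction m generalizing v with
    | zero => simp
    | succ m ih => rw [pow_succ, pow_succ, Module.End.mul_apply, ih, ← Matrix.mulVec_mulVec]; rfl

theorem charpoly_pow_of_forall_iterate {k S n : Type*} [Field k] [Infinite k] [CommRing S]
    [Algebra k S] [Module.Finite k S] [Fintype n] [DecidableEq n] {N : Matrix n n S} {P : k[X]}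
    (h : P.map (algebraMap k S) = N.charpoly) {T : Module.End k (n → S)} {m : ℕ}
    (hT : ∀ v, T^[m] v = N.mulVec v) :
    T ^ m = (Matrix.mulVecLin N).restrictScalars k ∧
      (T ^ m).charpoly = P ^ Module.finrank k S ∧ aeval (T ^ m) P = 0 := by
  have hT' : T ^ m = (Matrix.mulVecLin N).restrictScalars k :=
    LinearMap.ext fun v => (Module.End.pow_apply _ _ _).trans (hT v)
  refine ⟨hT', hT' ▸ charpoly_restrictScalars_mulVecLin h.symm, ?_⟩
  have := Matrix.aeval_self_charpoly N
  rw [← h, aeval_map_algebraMap] at this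
  rw [hT', aeval_restrictScalars_mulVecLin, this]
  ext
  simp

/-- Let `T` be an endomorphism of `S ^ n` with an `S`-linear power, whose characteristic polynomial is
a product of coprime polynomials `Q` and `R` over `k`. Then the kernel of `Q (T ^ m)` is a stable
submodule. -/
theorem exists_stable_submodule {k S n : Type*} [Field k] [Infinite k] [CommRing S] [Algebra k S]
    [Module.Finite k S] [Fintype n] [DecidableEq n] {N : Matrix n n S} {Q R : k[X]}
    (h : (Q * R).map (algebraMap k S) = N.charpoly) (hQ : Q.Monic) (hQR : IsCoprime Q R)
    {T : Module.End k (n → S)} {m : ℕ} (hT : ∀ v, T^[m] v = N.mulVec v) :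
    ∃ (W : Submodule S (n → S)) (hW : ∀ v ∈ W.restrictScalars k, T v ∈ W.restrictScalars k),
      Module.finrank k W = Module.finrank k S * Q.natDegree ∧
      LinearMap.det ((T.restrict hW) ^ m) = (-1) ^ Module.finrank k W *
        Q.coeff 0 ^ Module.finrank k S := by
  obtain ⟨hT', hT1, hT2⟩ := charpoly_pow_of_forall_iterate h hT
  -- Since `T ^ m` is the matrix `N`, this kernel is an `S`-submodule, although `T` is only
  -- `k`-linear. Stability under `T` holds because `Q (T ^ m)` is a polynomial in `T`.
  let W := LinearMap.ker (Matrix.mulVecLin (aeval N Q))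
  have hW' : ∀ x, x ∈ W.restrictScalars k ↔ aeval (T ^ m) Q x = 0 := fun x => by
    rw [hT', aeval_restrictScalars_mulVecLin]
    rfl
  have hW : ∀ x ∈ W.restrictScalars k, T x ∈ W.restrictScalars k := by
    intro x hx
    rw [hW'] at hx ⊢
    have hc : aeval (T ^ m) Q * T = T * aeval (T ^ m) Q := by
      rw [← expand_aeval]
      have := congrArg (aeval T) (mul_comm (expand k m Q) X)
      rwa [map_mul, map_mul, aeval_X] at this
    have := LinearMap.congr_fun hc x
    rwa [Module.End.mul_apply, Module.End.mul_apply, hx, map_zero] at this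
  have hc := charpoly_restrict_ker_aeval hQ hQR hT1 hT2
    (W.restrictScalars k) hW' (Module.End.pow_apply_mem_of_forall_mem m hW)
  have hd := LinearMap.charpoly_natDegree ((T ^ m).restrict (p := W.restrictScalars k)
    (Module.End.pow_apply_mem_of_forall_mem m hW))
  rw [hc, natDegree_pow] at hd
  refine ⟨W, hW, hd.symm, ?_⟩
  rw [Module.End.pow_restrict, LinearMap.det_eq_sign_charpoly_coeff, hc, coeff_zero_eq_eval_zero,
    eval_pow, coeff_zero_eq_eval_zero]
  rfl

/-- Here `A` and `B` are the characteristic polynomials of `T ^ m` on `W` and on the quotient by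
`W`. -/
theorem exists_mul_eq_of_stable_submodule {k S n : Type*} [Field k] [Infinite k] [CommRing S]
    [Algebra k S] [Module.Finite k S] [Fintype n] [DecidableEq n] {N : Matrix n n S} {P : k[X]}
    (h : P.map (algebraMap k S) = N.charpoly)
    {T : Module.End k (n → S)} {m : ℕ} (hT : ∀ v, T^[m] v = N.mulVec v) (W : Submodule S (n → S))
    (hW : ∀ v ∈ W.restrictScalars k, T v ∈ W.restrictScalars k) :
    ∃ A B : k[X], A.Monic ∧ B.Monic ∧ A * B = P ^ Module.finrank k S ∧
      A.natDegree = Module.finrank k W ∧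
      LinearMap.det ((T.restrict hW) ^ m) = (-1) ^ Module.finrank k W * A.coeff 0 := by
  have hm : ∀ v ∈ W.restrictScalars k, (T ^ m) v ∈ W.restrictScalars k :=
    Module.End.pow_apply_mem_of_forall_mem m hW
  refine ⟨((T ^ m).restrict hm).charpoly,
    ((W.restrictScalars k).mapQ (W.restrictScalars k) (T ^ m) hm).charpoly,
    LinearMap.charpoly_monic _, LinearMap.charpoly_monic _, ?_, LinearMap.charpoly_natDegree _, ?_⟩
  · rw [← charpoly_eq_charpoly_restrict_mul_charpoly_mapQ,
      (charpoly_pow_of_forall_iterate h hT).2.1]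
  · rw [Module.End.pow_restrict, LinearMap.det_eq_sign_charpoly_coeff]
    rfl

section BaseChange

variable {k A L : Type*} [Field k] [Field A] [Algebra k A] [FiniteDimensional k A]
  [NormedField L] [Algebra k L] [Infinite L] {d : ℕ} {N : Matrix (Fin d) (Fin d) (L ⊗[k] A)}
  {T : (Fin d → L ⊗[k] A) →ₗ[L] (Fin d → L ⊗[k] A)} {m : ℕ}

theorem exists_stable_submodule_baseChange {Q R : L[X]}
    (h : (Q * R).map (algebraMap L (L ⊗[k] A)) = N.charpoly) (hQ : Q.Monic) (hQR : IsCoprime Q R)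
    (hT : ∀ v, T^[m] v = N.mulVec v) :
    ∃ (W : Submodule (L ⊗[k] A) (Fin d → L ⊗[k] A))
      (hW : ∀ v ∈ W.restrictScalars L, T v ∈ W.restrictScalars L),
      Module.finrank L W = Module.finrank k A * Q.natDegree ∧
      LinearMap.det (M := ↥(W.restrictScalars L)) ((T.restrict hW) ^ m) =
        (-1) ^ Module.finrank L W * Q.coeff 0 ^ Module.finrank k A := by
  rw [← Module.finrank_baseChange (R := L)]
  exact exists_stable_submodule h hQ hQR hT

theorem exists_mul_eq_of_stable_submodule_baseChange {P : L[X]}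
    (h : P.map (algebraMap L (L ⊗[k] A)) = N.charpoly) (hT : ∀ v, T^[m] v = N.mulVec v)
    (W : Submodule (L ⊗[k] A) (Fin d → L ⊗[k] A))
    (hW : ∀ v ∈ W.restrictScalars L, T v ∈ W.restrictScalars L) :
    ∃ A' B : L[X], A'.Monic ∧ B.Monic ∧ A' * B = P ^ Module.finrank k A ∧
      A'.natDegree = Module.finrank L W ∧
      LinearMap.det (M := ↥(W.restrictScalars L)) ((T.restrict hW) ^ m) =
        (-1) ^ Module.finrank L W * A'.coeff 0 := by
  rw [← Module.finrank_baseChange (R := L)]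
  exact exists_mul_eq_of_stable_submodule h hT W hW

end BaseChange

variable {p : ℕ} [Fact p.Prime] {K : Type*} [Field K] [Algebra ℚ_[p] K] {d : ℕ}
  {L : Type*} [NormedField L] [Algebra ℚ_[p] L]
  {φ : maxUnramified p K ≃ₐ[ℚ_[p]] maxUnramified p K} {g : GL (Fin d) (CoeffRing p K L)}

theorem frob_pow_smul (n : ℕ) (s : CoeffRing p K L) (v : Fin d → CoeffRing p K L) :
    (frob φ g ^ n) (s • v) = Algebra.TensorProduct.map (AlgHom.id L L)
      ((φ ^ n : maxUnramified p K ≃ₐ[ℚ_[p]] maxUnramified p K) :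
        maxUnramified p K →ₐ[ℚ_[p]] maxUnramified p K) s • (frob φ g ^ n) v := by
  induction n generalizing s v with
  | zero =>
    have : Algebra.TensorProduct.map (AlgHom.id L L)
      ((φ ^ 0 : maxUnramified p K ≃ₐ[ℚ_[p]] maxUnramified p K) :
        maxUnramified p K →ₐ[ℚ_[p]] maxUnramified p K) = AlgHom.id L _ := by
      ext x; simp
    rw [this]
    rfl
  | succ n ih =>
    have h1 : frob φ g (s • v) = Algebra.TensorProduct.map (AlgHom.id L L)
        (φ : maxUnramified p K →ₐ[ℚ_[p]] maxUnramified p K) s • frob φ g v := by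
      rw [frob_apply, frob_apply, ← Matrix.mulVec_smul]
      congr 1
      ext i
      simp
    have h2 : ((Algebra.TensorProduct.map (AlgHom.id L L)
        ((φ ^ n : maxUnramified p K ≃ₐ[ℚ_[p]] maxUnramified p K) :
          maxUnramified p K →ₐ[ℚ_[p]] maxUnramified p K)).comp
        (Algebra.TensorProduct.map (AlgHom.id L L)
          (φ : maxUnramified p K →ₐ[ℚ_[p]] maxUnramified p K))) =
        Algebra.TensorProduct.map (AlgHom.id L L)
        ((φ ^ (n + 1) : maxUnramified p K ≃ₐ[ℚ_[p]] maxUnramified p K) :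
          maxUnramified p K →ₐ[ℚ_[p]] maxUnramified p K) := by
      ext x
      simp [pow_succ]
    rw [pow_succ, Module.End.mul_apply, Module.End.mul_apply, h1, ih, ← h2]
    rfl

variable [FiniteDimensional ℚ_[p] K]

/-- As `φ ^ f = 1`, the semilinear map becomes linear after `f` steps and is determined by the
standard basis. -/
theorem frob_iterate_inertiaDeg (hφ : IsFrobeniusLift φ) (g : GL (Fin d) (CoeffRing p K L))
    (v : Fin d → CoeffRing p K L) :
    (frob φ g)^[inertiaDeg p K] v = (frobPowMatrix φ g).mulVec v := by
  have h1 : φ ^ inertiaDeg p K = 1 := by rw [← hφ.orderOf_eq, pow_orderOf_eq_one]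
  have h2 : Algebra.TensorProduct.map (AlgHom.id L L)
      ((1 : maxUnramified p K ≃ₐ[ℚ_[p]] maxUnramified p K) :
        maxUnramified p K →ₐ[ℚ_[p]] maxUnramified p K) = AlgHom.id L (CoeffRing p K L) := by
    ext x; simp
  rw [← Module.End.pow_apply]
  conv_lhs => rw [pi_eq_sum_univ' v, map_sum]
  simp only [frob_pow_smul, h1, h2, AlgHom.id_apply]
  ext i
  simp only [Finset.sum_apply, Pi.smul_apply, smul_eq_mul, Matrix.mulVec, dotProduct, frobPowMatrix,
    Matrix.of_apply]
  exact Finset.sum_congr rfl fun j _ => mul_comm (G := CoeffRing p K L) _ _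

/-- A factorization of the Frobenius characteristic polynomial into coprime factors gives a stable
submodule. -/
theorem IsFrobCharpoly.exists_isStable (hφ : IsFrobeniusLift φ) {Q R : L[X]}
    (hP : IsFrobCharpoly φ g (Q * R)) (hQ : Q.Monic) (hQR : IsCoprime Q R) :
    ∃ (D' : Submodule (CoeffRing p K L) (Fin d → CoeffRing p K L)) (h : IsStable φ g D'),
      Module.finrank L D' = inertiaDeg p K * Q.natDegree ∧
      ‖frobPowDet φ g D' h‖ = ‖Q.coeff 0‖ ^ inertiaDeg p K := by
  have : CharZero L := charZero_of_injective_algebraMap (algebraMap ℚ_[p] L).injective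
  obtain ⟨W, hW, h1, h2⟩ :=
    exists_stable_submodule_baseChange hP hQ hQR (frob_iterate_inertiaDeg hφ g)
  refine ⟨W, hW, h1, ?_⟩
  refine (congrArg norm h2).trans ?_
  rw [norm_mul, norm_pow, norm_neg, norm_one, one_pow, one_mul, norm_pow]
  rfl

theorem IsFrobCharpoly.exists_mul_eq_of_isStable (hφ : IsFrobeniusLift φ) {P : L[X]}
    (hP : IsFrobCharpoly φ g P) {D' : Submodule (CoeffRing p K L) (Fin d → CoeffRing p K L)}
    (h : IsStable φ g D') : ∃ A B : L[X], A.Monic ∧ B.Monic ∧ A * B = P ^ inertiaDeg p K ∧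
      A.natDegree = Module.finrank L D' ∧ ‖frobPowDet φ g D' h‖ = ‖A.coeff 0‖ := by
  have : CharZero L := charZero_of_injective_algebraMap (algebraMap ℚ_[p] L).injective
  obtain ⟨A, B, hA, hB, hAB, h1, h2⟩ :=
    exists_mul_eq_of_stable_submodule_baseChange hP (frob_iterate_inertiaDeg hφ g) D' h
  refine ⟨A, B, hA, hB, hAB, h1, (congrArg norm h2).trans ?_⟩
  rw [norm_mul, norm_pow, norm_neg, norm_one, one_pow, one_mul]

end FrobeniusPower

end FilteredPhi

namespace FilteredPhi

/-! ### Factorization along Newton slopes by Gauss norms -/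

section NewtonPolygon

open Polynomial

theorem isCoprime_of_irreducible_of_ne {L : Type*} [Field L] {a b : L[X]} (ha : Irreducible a) (hb : Irreducible b)
    (ham : a.Monic) (hbm : b.Monic) (h : a ≠ b) : IsCoprime a b := by
  rw [ha.coprime_iff_not_dvd]
  exact fun hd => h (eq_of_monic_of_associated ham hbm (ha.associated_of_dvd hb hd))

variable {L : Type*} [NontriviallyNormedField L] [IsUltrametricDist L]

theorem isNonarchimedean_toAbsoluteValue :
    IsNonarchimedean (NormedField.toAbsoluteValue L) := fun x y =>
  IsUltrametricDist.norm_add_le_max x y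

/-- The Newton polygon of an irreducible polynomial over a complete field is a segment. -/
theorem exists_norm_coeff_le_pow_of_irreducible [CompleteSpace L] {q : L[X]} (hq : Irreducible q)
    (hm : q.Monic) : ∃ s : ℝ, 0 ≤ s ∧ ‖q.coeff 0‖ = s ^ q.natDegree ∧
      ∀ k ≤ q.natDegree, ‖q.coeff k‖ ≤ s ^ (q.natDegree - k) := by
  obtain ⟨x, hx⟩ := IsAlgClosed.exists_aeval_eq_zero (AlgebraicClosure L) q
    (degree_pos_of_irreducible hq).ne'
  have hmin : minpoly L x = q := (minpoly.eq_of_irreducible_of_monic hq hx hm).symm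
  have h1 := spectralNorm.spectralNorm_eq_norm_coeff_zero_rpow L (AlgebraicClosure L) x
  have hn : q.natDegree ≠ 0 := hq.natDegree_pos.ne'
  rw [hmin] at h1
  refine ⟨spectralNorm L (AlgebraicClosure L) x, spectralNorm_nonneg x, ?_, fun k hk => ?_⟩
  · rw [h1, one_div, Real.rpow_inv_natCast_pow (norm_nonneg _) hn]
  · rcases hk.eq_or_lt with rfl | hk
    · simp [hm.coeff_natDegree]
    · have h2 : spectralValueTerms q k ≤ spectralNorm L (AlgebraicClosure L) x := by
        rw [spectralNorm, hmin]
        exact le_ciSup (spectralValueTerms_bddAbove q) k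
      rw [spectralValueTerms_of_lt_natDegree _ hk, ← Nat.cast_sub hk.le, one_div] at h2
      have := pow_le_pow_left₀ (by positivity) h2 (q.natDegree - k)
      rwa [Real.rpow_inv_natCast_pow (norm_nonneg _) (by omega)] at this

/-- On a segment a linear functional is maximal at an end point. -/
theorem gaussNorm_le_of_irreducible [CompleteSpace L] {q : L[X]} (hq : Irreducible q)
    (hm : q.Monic) {r : ℝ} (hr : 0 < r) :
    q.gaussNorm (NormedField.toAbsoluteValue L) r ≤ max ‖q.coeff 0‖ (r ^ q.natDegree) := by
  obtain ⟨s, hs, h0, h⟩ := exists_norm_coeff_le_pow_of_irreducible hq hm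
  obtain ⟨i, hi⟩ := q.exists_eq_gaussNorm (NormedField.toAbsoluteValue L) r
  rw [hi, h0]
  change ‖q.coeff i‖ * r ^ i ≤ _
  rcases lt_or_ge q.natDegree i with hi | hi
  · rw [coeff_eq_zero_of_natDegree_lt hi, norm_zero, zero_mul]
    exact le_max_of_le_right (by positivity)
  · rcases le_total r s with hrs | hrs
    · refine le_max_of_le_left ?_
      calc _ ≤ s ^ (q.natDegree - i) * s ^ i := by gcongr; exact h i hi
        _ = _ := by rw [← pow_add, Nat.sub_add_cancel hi]
    · refine le_max_of_le_right ?_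
      calc _ ≤ r ^ (q.natDegree - i) * r ^ i := by
            gcongr; exact (h i hi).trans (pow_le_pow_left₀ hs hrs _)
        _ = _ := by rw [← pow_add, Nat.sub_add_cancel hi]

/-- Factorization of a monic polynomial over a complete field according to whether the norms of the
roots are at least `r` or smaller than `r`. -/
theorem exists_isCoprime_factorization [CompleteSpace L] {P : L[X]} (hP : P.Monic) {r : ℝ}
    (hr : 0 < r) : ∃ Q R : L[X], Q.Monic ∧ R.Monic ∧ P = Q * R ∧ IsCoprime Q R ∧
      Q.gaussNorm (NormedField.toAbsoluteValue L) r ≤ ‖Q.coeff 0‖ ∧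
      R.gaussNorm (NormedField.toAbsoluteValue L) r ≤ r ^ R.natDegree := by
  classical
  let v := NormedField.toAbsoluteValue L
  have hna : IsNonarchimedean v := isNonarchimedean_toAbsoluteValue
  have h1 : (1 : L[X]).gaussNorm v r = 1 := by
    rw [← C_1, gaussNorm_C, map_one]
  -- The last two clauses strengthen the induction: they keep each factor coprime to the irreducible
  -- polynomials that can still be assigned to the other one.
  suffices H : ∀ m : Multiset L[X], (∀ q ∈ m, Irreducible q ∧ q.Monic) →
      ∃ Q R : L[X], Q.Monic ∧ R.Monic ∧ m.prod = Q * R ∧ IsCoprime Q R ∧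
      Q.gaussNorm v r ≤ ‖Q.coeff 0‖ ∧ R.gaussNorm v r ≤ r ^ R.natDegree ∧
      (∀ q : L[X], Irreducible q → q.Monic → ‖q.coeff 0‖ < r ^ q.natDegree → IsCoprime Q q) ∧
      (∀ q : L[X], Irreducible q → q.Monic → r ^ q.natDegree ≤ ‖q.coeff 0‖ → IsCoprime q R) by
    obtain ⟨Q, R, hQ, hR, hPQR, h2, h3, h4, -, -⟩ :=
      H (UniqueFactorizationMonoid.normalizedFactors P) fun q hq =>
        ⟨UniqueFactorizationMonoid.irreducible_of_normalized_factor q hq, by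
          have := UniqueFactorizationMonoid.normalize_normalized_factor q hq
          rw [← this]
          exact monic_normalize
            (UniqueFactorizationMonoid.irreducible_of_normalized_factor q hq).ne_zero⟩
    refine ⟨Q, R, hQ, hR, ?_, h2, h3, h4⟩
    rw [← hPQR]
    refine eq_of_monic_of_associated hP (hPQR ▸ hQ.mul hR)
      (UniqueFactorizationMonoid.prod_normalizedFactors hP.ne_zero).symm
  intro m
  induction m using Multiset.induction_on with
  | empty =>
    refine fun _ => ⟨1, 1, monic_one, monic_one, by simp, isCoprime_one_left, ?_, ?_,
      fun _ _ _ _ => isCoprime_one_left, fun _ _ _ _ => isCoprime_one_right⟩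
    · simp [h1]
    · simp [h1]
  | cons a m ih =>
    intro hm
    obtain ⟨Q, R, hQ, hR, hPQR, h2, h3, h4, h5, h6⟩ := ih fun q hq => hm q (Multiset.mem_cons_of_mem hq)
    obtain ⟨ha, ham⟩ := hm a (Multiset.mem_cons_self a m)
    have hg := gaussNorm_le_of_irreducible ha ham hr
    rcases le_or_gt (r ^ a.natDegree) ‖a.coeff 0‖ with hc | hc
    · refine ⟨a * Q, R, ham.mul hQ, hR, ?_, (h6 a ha ham hc).mul_left h2, ?_, h4, ?_, h6⟩
      · rw [Multiset.prod_cons, hPQR, mul_assoc]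
      · rw [gaussNorm_mul hna hr, mul_coeff_zero, norm_mul]
        rw [max_eq_left hc] at hg
        exact mul_le_mul hg h3 (gaussNorm_nonneg _ _ hr.le) (norm_nonneg _)
      · intro q hq hqm hql
        refine IsCoprime.mul_left (isCoprime_of_irreducible_of_ne ha hq ham hqm ?_) (h5 q hq hqm hql)
        rintro rfl
        exact absurd hc hql.not_ge
    · refine ⟨Q, a * R, hQ, ham.mul hR, ?_, (h5 a ha ham hc).mul_right h2, h3, ?_, h5, ?_⟩
      · rw [Multiset.prod_cons, hPQR, mul_left_comm]
      · rw [gaussNorm_mul hna hr, ham.natDegree_mul hR, pow_add]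
        rw [max_eq_right hc.le] at hg
        exact mul_le_mul hg h4 (gaussNorm_nonneg _ _ hr.le) (by positivity)
      · intro q hq hqm hql
        refine IsCoprime.mul_right (isCoprime_of_irreducible_of_ne hq ha hqm ham ?_) (h6 q hq hqm hql)
        rintro rfl
        exact absurd hql hc.not_ge

/-- Multiplicativity of the Gauss norm: all points of the Newton polygon of `P` lie on one side of
the line, with slope given by `r`, through the vertex that separates `Q` from `R`. -/
theorem exists_factor_norm_coeff_le [CompleteSpace L] {P : L[X]} (hP : P.Monic) {r : ℝ}
    (hr : 0 < r) : ∃ Q R : L[X], Q.Monic ∧ R.Monic ∧ P = Q * R ∧ IsCoprime Q R ∧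
      ∀ k, ‖P.coeff k‖ * r ^ k ≤ ‖Q.coeff 0‖ * r ^ R.natDegree := by
  obtain ⟨Q, R, hQ, hR, hPQR, h1, h2, h3⟩ := exists_isCoprime_factorization hP hr
  refine ⟨Q, R, hQ, hR, hPQR, h1, fun k => ?_⟩
  refine (P.le_gaussNorm (NormedField.toAbsoluteValue L) hr.le k).trans ?_
  rw [hPQR, gaussNorm_mul isNonarchimedean_toAbsoluteValue hr]
  exact mul_le_mul h2 h3 (gaussNorm_nonneg _ _ hr.le) (norm_nonneg _)

theorem monic_and_natDegree_of_map_eq_charpoly {k S : Type*} [Field k] [CommRing S] [Nontrivial S]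
    [Algebra k S] {d : ℕ} {N : Matrix (Fin d) (Fin d) S} {P : k[X]}
    (h : P.map (algebraMap k S) = N.charpoly) : P.Monic ∧ P.natDegree = d := by
  have hinj := (algebraMap k S).injective
  refine ⟨monic_of_injective hinj (h ▸ Matrix.charpoly_monic _), ?_⟩
  rw [← natDegree_map_eq_of_injective hinj, h, Matrix.charpoly_natDegree_eq_dim, Fintype.card_fin]

theorem monic_and_natDegree_of_map_eq_charpoly_baseChange {k A L : Type*} [Field k] [Field A]
    [Algebra k A] [NormedField L] [Algebra k L] {d : ℕ}
    {N : Matrix (Fin d) (Fin d) (L ⊗[k] A)} {P : L[X]}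
    (h : P.map (algebraMap L (L ⊗[k] A)) = N.charpoly) : P.Monic ∧ P.natDegree = d :=
  monic_and_natDegree_of_map_eq_charpoly h

end NewtonPolygon

/-! ### Degrees and slopes as powers of `p` -/

section Degree

variable {p : ℕ} [hpr : Fact p.Prime] {K : Type*} [Field K] [Algebra ℚ_[p] K] {d : ℕ}
  {L : Type*} [NormedField L] [Algebra ℚ_[p] L]
  {φ : maxUnramified p K ≃ₐ[ℚ_[p]] maxUnramified p K} {g : GL (Fin d) (CoeffRing p K L)}
  {D' : Submodule (CoeffRing p K L) (Fin d → CoeffRing p K L)}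

theorem degree_eq_rpow (hp : ‖(p : L)‖ = (p : ℝ)⁻¹) (F : Filtration p K d L) (h : IsStable φ g D')
    {t : ℝ} (ht : ‖frobPowDet φ g D' h‖ = (p : ℝ) ^ t) :
    degree φ g F D' h = (p : ℝ) ^ (-(t / (inertiaDeg p K : ℝ) ^ 2) - filtrationDegree F D') := by
  have h0 : (0 : ℝ) < p := by exact_mod_cast hpr.out.pos
  rw [degree, ht, hp, ← Real.rpow_mul h0.le, ← Real.rpow_neg h0.le, Real.inv_rpow h0.le,
    ← Real.rpow_neg h0.le, ← Real.rpow_add h0, mul_one_div, sub_eq_add_neg]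

theorem slope_eq_rpow (hp : ‖(p : L)‖ = (p : ℝ)⁻¹) (F : Filtration p K d L) (h : IsStable φ g D')
    {t : ℝ} (ht : ‖frobPowDet φ g D' h‖ = (p : ℝ) ^ t) :
    slope φ g F D' h = (p : ℝ) ^ ((-(t / (inertiaDeg p K : ℝ) ^ 2) - filtrationDegree F D') *
      (1 / ((Module.finrank L D' : ℝ) / inertiaDeg p K))) := by
  have h0 : (0 : ℝ) < p := by exact_mod_cast hpr.out.pos
  rw [slope, degree_eq_rpow hp F h ht, ← Real.rpow_mul h0.le]

theorem IsFrobCharpoly.monic_and_natDegree {P : Polynomial L} (hP : IsFrobCharpoly φ g P) :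
    P.Monic ∧ P.natDegree = d :=
  monic_and_natDegree_of_map_eq_charpoly_baseChange hP

variable [FiniteDimensional ℚ_[p] K]

/-- With the convention `0⁻¹ = 0`, a vanishing determinant would give slope `0`. This excludes
vanishing under weak admissibility without an argument that `Φ_g` is injective. -/
theorem slope_eq_zero (F : Filtration p K d L) (h : IsStable φ g D')
    (h0 : frobPowDet φ g D' h = 0) (hr : Module.finrank L D' ≠ 0) : slope φ g F D' h = 0 := by
  have hf : 0 < inertiaDeg p K := inertiaDeg_pos
  rw [slope, degree, h0, norm_zero, Real.zero_rpow (by positivity), inv_zero, zero_mul,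
    Real.zero_rpow (by positivity)]

theorem one_le_slope_iff (hp : ‖(p : L)‖ = (p : ℝ)⁻¹) (F : Filtration p K d L) (h : IsStable φ g D')
    {t : ℝ} (ht : ‖frobPowDet φ g D' h‖ = (p : ℝ) ^ t) (hr : Module.finrank L D' ≠ 0) :
    1 ≤ slope φ g F D' h ↔ t ≤ -((inertiaDeg p K : ℝ) ^ 2 * filtrationDegree F D') := by
  have hf : 0 < inertiaDeg p K := inertiaDeg_pos
  have h1 : (1 : ℝ) < p := by exact_mod_cast hpr.out.one_lt
  have hr' : 0 < Module.finrank L D' := hr.bot_lt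
  rw [slope_eq_rpow hp F h ht, ← Real.rpow_zero (p : ℝ), Real.rpow_le_rpow_left_iff h1,
    mul_nonneg_iff_of_pos_right (by positivity), sub_nonneg, le_neg,
    div_le_iff₀ (by positivity)]
  constructor <;> intro h <;> linarith

theorem slope_eq_one_iff (hp : ‖(p : L)‖ = (p : ℝ)⁻¹) (F : Filtration p K d L) (h : IsStable φ g D')
    {t : ℝ} (ht : ‖frobPowDet φ g D' h‖ = (p : ℝ) ^ t) (hr : Module.finrank L D' ≠ 0) :
    slope φ g F D' h = 1 ↔ t = -((inertiaDeg p K : ℝ) ^ 2 * filtrationDegree F D') := by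
  have hf : 0 < inertiaDeg p K := inertiaDeg_pos
  have h1 : (1 : ℝ) < p := by exact_mod_cast hpr.out.one_lt
  have hr' : 0 < Module.finrank L D' := hr.bot_lt
  have hf2 : (0 : ℝ) < (inertiaDeg p K : ℝ) ^ 2 := by positivity
  rw [slope_eq_rpow hp F h ht, ← Real.rpow_zero (p : ℝ), Real.rpow_right_inj (by positivity) h1.ne', mul_eq_zero,
    or_iff_left (by positivity), sub_eq_zero, neg_eq_iff_eq_neg, div_eq_iff hf2.ne']
  constructor <;> intro h <;> linarith

theorem finrank_top_coeffRing : Module.finrank L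
    ↥(⊤ : Submodule (CoeffRing p K L) (Fin d → CoeffRing p K L)) = inertiaDeg p K * d := by
  classical
  have : Fintype (maxUnramified p K →ₐ[ℚ_[p]] AlgebraicClosure L) := Fintype.ofFinite _
  rw [finrank_eq_sum_comp (Ω := AlgebraicClosure L), Finset.sum_congr rfl fun τ _ =>
    finrank_comp_top τ, Finset.sum_const, Finset.card_univ, card_algHom_eq_finrank, smul_eq_mul,
    inertiaDeg]

/-- On the whole module the cofactor has degree zero, so `A = P ^ f`. -/
theorem IsFrobCharpoly.norm_frobPowDet_top (hφ : IsFrobeniusLift φ) {P : Polynomial L}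
    (hP : IsFrobCharpoly φ g P) :
    ‖frobPowDet φ g ⊤ (isStable_top φ g)‖ = ‖P.coeff 0‖ ^ inertiaDeg p K := by
  obtain ⟨hm, hd⟩ := hP.monic_and_natDegree
  obtain ⟨A, B, hA, hB, hAB, h1, h2⟩ := hP.exists_mul_eq_of_isStable hφ (isStable_top φ g)
  have h3 := congrArg Polynomial.natDegree hAB
  rw [hA.natDegree_mul hB, h1, finrank_top_coeffRing, Polynomial.natDegree_pow, hd] at h3
  have hB1 : B = 1 := hB.natDegree_eq_zero.1 (by omega)
  rw [hB1, mul_one] at hAB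
  rw [h2, hAB, Polynomial.coeff_zero_eq_eval_zero, Polynomial.eval_pow, norm_pow,
    Polynomial.coeff_zero_eq_eval_zero]

end Degree

/-! ### Weak admissibility implies the coefficient bounds -/

section NecessaryCondition

variable {p : ℕ} [hpr : Fact p.Prime] {K : Type*} [Field K] [Algebra ℚ_[p] K]
  [FiniteDimensional ℚ_[p] K] {d : ℕ} {ν : DominantCocharacter p K d}
  {L : Type*} [NormedField L] [Algebra ℚ_[p] L]
  [Algebra ν.reflexField L] [IsScalarTower ℚ_[p] ν.reflexField L]
  {φ : maxUnramified p K ≃ₐ[ℚ_[p]] maxUnramified p K} {g : GL (Fin d) (CoeffRing p K L)}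
  {F : Filtration p K d L} {P : Polynomial L}

/-- Weak admissibility is tested on the stable submodule of rank `deg Q` cut out by `Q`, whose
induced filtration has degree at least `l_{deg Q}`. -/
theorem IsWeaklyAdmissible.norm_coeff_zero_le (hφ : IsFrobeniusLift φ)
    (hp : ‖(p : L)‖ = (p : ℝ)⁻¹) (hF : F.IsOfType ν) (hwa : IsWeaklyAdmissible φ g F)
    {Q R : Polynomial L} (hP : IsFrobCharpoly φ g (Q * R)) (hQ : Q.Monic) (hQR : IsCoprime Q R) :
    ‖Q.coeff 0‖ ≤ (p : ℝ) ^ ν.bound Q.natDegree := by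
  have hf : 0 < inertiaDeg p K := inertiaDeg_pos
  have h1 : (1 : ℝ) < p := by exact_mod_cast hpr.out.one_lt
  obtain ⟨D', h, hr, hdet⟩ := hP.exists_isStable hφ hQ hQR
  rcases eq_or_ne Q.natDegree 0 with h0 | h0
  · rw [hQ.natDegree_eq_zero.1 h0]
    simp [ν.bound_zero]
  have hr0 : Module.finrank L D' ≠ 0 := by
    rw [hr]; positivity
  have hD' : D' ≠ ⊥ := by
    rintro rfl
    exact hr0 (by exact_mod_cast finrank_bot L (Fin d → CoeffRing p K L))
  have hs : 1 ≤ slope φ g F D' h := hwa.2 ▸ hwa.1 D' h hD'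
  have hQ0 : 0 < ‖Q.coeff 0‖ := by
    refine norm_pos_iff.2 fun hQ0 => ?_
    rw [hQ0, norm_zero, zero_pow hf.ne', norm_eq_zero] at hdet
    rw [slope_eq_zero F h hdet hr0] at hs
    linarith
  set u := Real.logb p ‖Q.coeff 0‖
  have hu : ‖Q.coeff 0‖ = (p : ℝ) ^ u := (Real.rpow_logb (by positivity) h1.ne' hQ0).symm
  have ht : ‖frobPowDet φ g D' h‖ = (p : ℝ) ^ (u * inertiaDeg p K) := by
    rw [hdet, hu, ← Real.rpow_mul_natCast (by positivity)]
  rw [one_le_slope_iff hp F h ht hr0] at hs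
  obtain ⟨ι⟩ := exists_embedding_algebraicClosure ν L
  obtain ⟨r, hrd, hr1, hr2⟩ := h.exists_rank hφ (AlgebraicClosure L)
  have hrQ : r = Q.natDegree := Nat.eq_of_mul_eq_mul_left hf (hr2.symm.trans hr)
  have hl := hF.l_le_filtrationDegree ι hrd hr1
  rw [hu, Real.rpow_le_rpow_left_iff h1, DominantCocharacter.bound, ← hrQ]
  have hf' : (0 : ℝ) < inertiaDeg p K := by exact_mod_cast hf
  have : u ≤ -((inertiaDeg p K : ℝ) * filtrationDegree F D') := by
    refine le_of_mul_le_mul_right ?_ hf'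
    calc _ ≤ _ := hs
      _ = _ := by ring
  have := mul_le_mul_of_nonneg_left hl hf'.le
  linarith

theorem IsWeaklyAdmissible.norm_coeff_zero_eq (hφ : IsFrobeniusLift φ) (hd : 0 < d)
    (hp : ‖(p : L)‖ = (p : ℝ)⁻¹) (hF : F.IsOfType ν) (hwa : IsWeaklyAdmissible φ g F)
    (hP : IsFrobCharpoly φ g P) : ‖P.coeff 0‖ = (p : ℝ) ^ ν.bound d := by
  have hf : 0 < inertiaDeg p K := inertiaDeg_pos
  have h1 : (1 : ℝ) < p := by exact_mod_cast hpr.out.one_lt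
  have hdet := hP.norm_frobPowDet_top hφ
  have hr0 : Module.finrank L ↥(⊤ : Submodule (CoeffRing p K L) (Fin d → CoeffRing p K L)) ≠ 0 := by
    rw [finrank_top_coeffRing]; positivity
  have hs := hwa.2
  have hP0 : 0 < ‖P.coeff 0‖ := by
    refine norm_pos_iff.2 fun hP0 => ?_
    rw [hP0, norm_zero, zero_pow hf.ne', norm_eq_zero] at hdet
    rw [slope_eq_zero F _ hdet hr0] at hs
    linarith
  set u := Real.logb p ‖P.coeff 0‖
  have hu : ‖P.coeff 0‖ = (p : ℝ) ^ u := (Real.rpow_logb (by positivity) h1.ne' hP0).symm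
  have ht : ‖frobPowDet φ g ⊤ (isStable_top φ g)‖ = (p : ℝ) ^ (u * inertiaDeg p K) := by
    rw [hdet, hu, ← Real.rpow_mul_natCast (by positivity)]
  obtain ⟨ι⟩ := exists_embedding_algebraicClosure ν L
  rw [slope_eq_one_iff hp F _ ht hr0, hF.filtrationDegree_top ι] at hs
  have hf' : (0 : ℝ) < inertiaDeg p K := by exact_mod_cast hf
  rw [hu, DominantCocharacter.bound]
  congr 1
  refine mul_right_cancel₀ hf'.ne' (hs.trans ?_)
  ring

/-- Only coprime factors are controlled so far. If `P` is cut at radius `p ^ s`, with `s` a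
supporting slope of `bound` at `j`, all coefficients lie below a line of slope `s` through the point
given by `|Q(0)|`. That point lies below the supporting line, which has the same slope and takes the
value `bound j` at `j`. -/
theorem IsWeaklyAdmissible.norm_coeff_le [IsUltrametricDist L] [CompleteSpace L]
    (hφ : IsFrobeniusLift φ) (hp : ‖(p : L)‖ = (p : ℝ)⁻¹) (hF : F.IsOfType ν)
    (hwa : IsWeaklyAdmissible φ g F) (hP : IsFrobCharpoly φ g P) {j : ℕ} (hj : j ≤ d) :
    ‖P.coeff (d - j)‖ ≤ (p : ℝ) ^ ν.bound j := by
  have h0 : (0 : ℝ) < p := by exact_mod_cast hpr.out.pos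
  have h1 : (1 : ℝ) < p := by exact_mod_cast hpr.out.one_lt
  obtain ⟨hm, hd⟩ := hP.monic_and_natDegree
  obtain ⟨s, hs⟩ := ν.exists_supergradient hj
  let : NontriviallyNormedField L := NontriviallyNormedField.ofNormNeOne
    ⟨p, fun h => by
      rw [h, norm_zero, eq_comm, inv_eq_zero] at hp
      exact h0.ne' hp, by rw [hp]; exact (inv_lt_one_of_one_lt₀ h1).ne⟩
  obtain ⟨Q, R, hQ, hR, rfl, hQR, h⟩ := exists_factor_norm_coeff_le hm
    (Real.rpow_pos_of_pos h0 s)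
  have hQ0 := hwa.norm_coeff_zero_le hφ hp hF hP hQ hQR
  rw [hQ.natDegree_mul hR] at hd
  have h2 := hs Q.natDegree (by omega)
  have h3 := (h (d - j)).trans (mul_le_mul_of_nonneg_right hQ0 (by positivity))
  rw [← Real.rpow_mul_natCast h0.le, ← Real.rpow_mul_natCast h0.le, ← Real.rpow_add h0,
    ← le_div_iff₀ (by positivity), ← Real.rpow_sub h0] at h3
  refine h3.trans ((Real.rpow_le_rpow_left_iff h1).2 ?_)
  rw [Nat.cast_sub hj]
  have h4 : (R.natDegree : ℝ) = d - Q.natDegree := by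
    rw [← hd]; push_cast; ring
  rw [h4]
  linarith

end NecessaryCondition

end FilteredPhi

namespace FilteredPhi

/-! ### Geometric points of the Berkovich space -/

section ResidueField

open scoped NNReal

universe u

/-- The binomial expansion gives `x(a + b) ^ m ≤ (m + 1) M ^ m`, and the linear factor is negligible
for large `m`. -/
theorem isNonarchimedean_of_natCast_le_one {R : Type*} [CommRing R] (x : MulRingSeminorm R)
    (h : ∀ n : ℕ, x n ≤ 1) : IsNonarchimedean x := by
  intro a b
  set M := max (x a) (x b)
  have hM : 0 ≤ M := le_max_of_le_left (apply_nonneg x a)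
  have key : ∀ m : ℕ, x (a + b) ^ m ≤ (m + 1) * M ^ m := by
    intro m
    rw [← map_pow, add_pow]
    refine (Finset.le_sum_of_subadditive x (map_zero x).le (map_add_le_add x) _ _).trans ?_
    calc _ ≤ ∑ i ∈ Finset.range (m + 1), M ^ m := ?_
      _ = _ := by simp
    refine Finset.sum_le_sum fun i hi => ?_
    have hi' : i ≤ m := Nat.lt_succ_iff.1 (Finset.mem_range.1 hi)
    rw [map_mul, map_mul, map_pow, map_pow]
    calc _ ≤ M ^ i * M ^ (m - i) * 1 := by
          gcongr
          · exact le_max_left _ _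
          · exact le_max_right _ _
          · exact h _
      _ = _ := by rw [mul_one, ← pow_add, Nat.add_sub_cancel' hi']
  by_contra! hlt
  rcases hM.eq_or_lt with h0 | h0
  · have h1 := map_add_le_add x a b
    have h2 : x a ≤ M := le_max_left _ _
    have h3 : x b ≤ M := le_max_right _ _
    linarith
  · obtain ⟨m, hm⟩ := Real.exists_natCast_add_one_lt_pow_of_one_lt ((one_lt_div h0).2 hlt)
    rw [div_pow, lt_div_iff₀ (by positivity)] at hm
    exact absurd (key m) (not_le.2 hm)

/-- The residue field of a multiplicative seminorm. -/
theorem exists_normedField_of_mulRingSeminorm {R : Type u} [CommRing R] (x : MulRingSeminorm R)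
    (h : ∀ n : ℕ, x n ≤ 1) : ∃ (F : Type u) (_ : NormedField F) (f : R →+* F), ∀ a, ‖f a‖ = x a := by
  have hna := isNonarchimedean_of_natCast_le_one x h
  let v : Valuation R ℝ≥0 :=
    { toFun := fun a => ⟨x a, apply_nonneg x a⟩
      map_zero' := Subtype.ext (map_zero x)
      map_one' := Subtype.ext (map_one x)
      map_mul' := fun a b => Subtype.ext (map_mul x a b)
      map_add_le_max' := fun a b => hna a b }
  let R' := R ⧸ v.supp
  let w : Valuation R' ℝ≥0 := v.onQuot le_rfl
  have hw : w.supp = ⊥ := v.supp_quot_supp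
  have hS : nonZeroDivisors R' ≤ w.supp.primeCompl := by
    intro s hs
    change s ∉ w.supp
    rw [hw, Ideal.mem_bot]
    exact nonZeroDivisors.ne_zero hs
  let F := FractionRing R'
  let u : Valuation F ℝ≥0 := w.extendToLocalization hS F
  let abv : AbsoluteValue F ℝ :=
    { toFun := fun a => u a
      map_mul' := fun a b => by simp
      nonneg' := fun a => NNReal.coe_nonneg _
      eq_zero' := fun a => by simp
      add_le' := fun a b => by
        have := u.map_add a b
        refine (NNReal.coe_le_coe.2 this).trans ?_
        rw [NNReal.coe_max]
        exact max_le_add_of_nonneg (NNReal.coe_nonneg _) (NNReal.coe_nonneg _) }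
  refine ⟨F, abv.toNormedField, (algebraMap R' F).comp (Ideal.Quotient.mk v.supp), fun a => ?_⟩
  change ((u (algebraMap R' F (Ideal.Quotient.mk v.supp a)) : ℝ≥0) : ℝ) = x a
  rw [Valuation.extendToLocalization_apply_map_apply]
  rfl

theorem exists_complete_extension (F : Type u) [NontriviallyNormedField F] [IsUltrametricDist F] :
    ∃ (L : Type u) (_ : NontriviallyNormedField L) (_ : IsUltrametricDist L) (_ : CompleteSpace L)
      (f : F →+* L), DenseRange f ∧ ∀ a, ‖f a‖ = ‖a‖ := by
  let L := UniformSpace.Completion F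
  have hnorm : ∀ a : F, ‖(a : L)‖ = ‖a‖ := UniformSpace.Completion.norm_coe
  obtain ⟨y, hy⟩ := NontriviallyNormedField.non_trivial (α := F)
  let : NontriviallyNormedField L := { non_trivial := ⟨(y : L), by rwa [hnorm]⟩ }
  refine ⟨L, inferInstance, ?_, inferInstance, UniformSpace.Completion.coeRingHom,
    UniformSpace.Completion.denseRange_coe, hnorm⟩
  refine IsUltrametricDist.isUltrametricDist_of_forall_norm_natCast_le_one fun n => ?_
  have := hnorm n
  rw [show ((n : F) : L) = n from map_natCast UniformSpace.Completion.coeRingHom n] at this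
  rw [this]
  exact IsUltrametricDist.norm_natCast_le_one F n

theorem exists_algClosed_complete_extension_of_complete (F : Type u) [NontriviallyNormedField F]
    [IsUltrametricDist F] [CompleteSpace F] [CharZero F] :
    ∃ (L : Type u) (_ : NontriviallyNormedField L) (_ : IsUltrametricDist L) (_ : CompleteSpace L)
      (_ : IsAlgClosed L) (f : F →+* L), ∀ a, ‖f a‖ = ‖a‖ := by
  let Ω := AlgebraicClosure F
  have hext : ∀ a : F, spectralNorm F Ω (algebraMap F Ω a) = ‖a‖ := spectralNorm_extends
  let : NontriviallyNormedField Ω := spectralNorm.nontriviallyNormedField F Ω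
  have : IsUltrametricDist Ω :=
    IsUltrametricDist.isUltrametricDist_of_forall_norm_add_le_max_norm
      (isNonarchimedean_spectralNorm (K := F) (L := Ω))
  obtain ⟨L, h1, h2, h3, f, hf, hn⟩ := exists_complete_extension Ω
  refine ⟨L, h1, h2, h3, ?_, f.comp (algebraMap F Ω), fun a => (hn _).trans (hext a)⟩
  let : Algebra Ω L := f.toAlgebra
  have : CharZero L := charZero_of_injective_ringHom (f.comp (algebraMap F Ω)).injective
  exact IsAlgClosed.of_denseRange hf

/-- Three stages: completion, so that the spectral norm is a field norm on the algebraic closure;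
algebraic closure; and a second completion, which remains algebraically closed. -/
theorem exists_algClosed_complete_extension (F : Type u) [NontriviallyNormedField F]
    [IsUltrametricDist F] [CharZero F] :
    ∃ (L : Type u) (_ : NontriviallyNormedField L) (_ : IsUltrametricDist L) (_ : CompleteSpace L)
      (_ : IsAlgClosed L) (f : F →+* L), ∀ a, ‖f a‖ = ‖a‖ := by
  obtain ⟨F', h1, h2, h3, f, -, hf⟩ := exists_complete_extension F
  have : CharZero F' := charZero_of_injective_ringHom f.injective
  obtain ⟨L, h1, h2, h3, h4, g, hg⟩ := exists_algClosed_complete_extension_of_complete F'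
  exact ⟨L, h1, h2, h3, h4, g.comp f, fun a => (hg _).trans (hf a)⟩

/-- Every point of an analytic space is defined over a complete algebraically closed field. -/
theorem exists_algClosed_complete_of_mulRingSeminorm {R : Type u} [CommRing R] [Algebra ℚ R]
    (x : MulRingSeminorm R) (h : ∀ n : ℕ, x n ≤ 1) (ht : ∃ n : ℕ, x n ≠ 0 ∧ x n ≠ 1) :
    ∃ (L : Type u) (_ : NontriviallyNormedField L) (_ : IsUltrametricDist L) (_ : CompleteSpace L)
      (_ : IsAlgClosed L) (f : R →+* L), ∀ a, ‖f a‖ = x a := by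
  obtain ⟨F, hF, f, hf⟩ := exists_normedField_of_mulRingSeminorm x h
  obtain ⟨n, hn0, hn1⟩ := ht
  let : NontriviallyNormedField F := NontriviallyNormedField.ofNormNeOne ⟨f n, by
    rw [← norm_ne_zero_iff, hf]; exact hn0, by rw [hf]; exact hn1⟩
  have : IsUltrametricDist F :=
    IsUltrametricDist.isUltrametricDist_of_forall_norm_natCast_le_one fun n => by
      rw [← map_natCast f, hf]; exact h n
  have : CharZero F := charZero_of_injective_ringHom (f.comp (algebraMap ℚ R)).injective
  obtain ⟨L, h1, h2, h3, h4, g, hg⟩ := exists_algClosed_complete_extension F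
  exact ⟨L, h1, h2, h3, h4, g.comp f, fun a => (hg _).trans (hf a)⟩

theorem AdjointQuotientAn.exists_geometric_point {E : Type u} [NormedField E] [CharZero E] {d : ℕ}
    (h : ∀ n : ℕ, ‖(n : E)‖ ≤ 1) (ht : ∃ n : ℕ, ‖(n : E)‖ ≠ 0 ∧ ‖(n : E)‖ ≠ 1)
    (x : AdjointQuotientAn E d) :
    ∃ (L : Type u) (_ : NontriviallyNormedField L) (_ : IsUltrametricDist L) (_ : CompleteSpace L)
      (_ : IsAlgClosed L) (_ : NormedAlgebra E L) (c : Fin d → L),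
      ∀ Q : MvPolynomial (Fin d) E, x.seminorm Q = ‖MvPolynomial.aeval c Q‖ := by
  have hn : ∀ n : ℕ, x.seminorm n = ‖(n : E)‖ := fun n => by
    rw [← x.map_C, map_natCast MvPolynomial.C n]
  obtain ⟨L, h1, h2, h3, h4, f, hf⟩ := exists_algClosed_complete_of_mulRingSeminorm x.seminorm
    (fun n => hn n ▸ h n) (by simpa only [hn] using ht)
  let : Algebra E L := (f.comp MvPolynomial.C).toAlgebra
  let : NormedAlgebra E L :=
    { norm_smul_le := fun a y => by
        rw [Algebra.smul_def, norm_mul, show algebraMap E L a = f (MvPolynomial.C a) from rfl, hf,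
          x.map_C] }
  refine ⟨L, h1, h2, h3, h4, inferInstance, fun i => f (MvPolynomial.X i), fun Q => ?_⟩
  let F : MvPolynomial (Fin d) E →ₐ[E] L := { f with commutes' := fun a => rfl }
  have : MvPolynomial.aeval (fun i => f (MvPolynomial.X i)) = F :=
    MvPolynomial.algHom_ext fun i => by rw [MvPolynomial.aeval_X]; rfl
  rw [this]
  exact (hf Q).symm

end ResidueField

end FilteredPhi

namespace FilteredPhi

/-! ### Companion matrices and the standard flag -/

section Companion

open Polynomial

theorem exists_companion {k : Type*} [Field k] {P : k[X]} (hP : P.Monic) {d : ℕ}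
    (hd : P.natDegree = d) : ∃ C : Matrix (Fin d) (Fin d) k, C.charpoly = P ∧
      ∀ i j : Fin d, (j : ℕ) + 1 ≠ d → C i j = if (i : ℕ) = j + 1 then 1 else 0 := by
  have hdim : (AdjoinRoot.powerBasis hP.ne_zero).dim = d := hd
  subst hdim
  refine ⟨Algebra.leftMulMatrix (AdjoinRoot.powerBasis hP.ne_zero).basis
    (AdjoinRoot.powerBasis hP.ne_zero).gen, ?_, fun i j hj => ?_⟩
  · rw [charpoly_leftMulMatrix, AdjoinRoot.powerBasis_gen, AdjoinRoot.minpoly_root hP.ne_zero,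
      hP.leadingCoeff, inv_one, C_1, mul_one]
  · rw [PowerBasis.leftMulMatrix, Matrix.of_apply, if_neg hj]

/-- The vectors of `k ^ d` supported on the first `n` coordinates. -/
def initialSubmodule (k : Type*) [Field k] (d n : ℕ) : Submodule k (Fin d → k) where
  carrier := {v | ∀ i : Fin d, n ≤ i → v i = 0}
  add_mem' := fun {v w} hv hw i hi => by rw [Pi.add_apply, hv i hi, hw i hi, add_zero]
  zero_mem' := fun _ _ => rfl
  smul_mem' := fun c v hv i hi => by rw [Pi.smul_apply, hv i hi, smul_zero]

variable {k : Type*} [Field k] {d : ℕ}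

theorem mem_initialSubmodule {n : ℕ} {v : Fin d → k} :
    v ∈ initialSubmodule k d n ↔ ∀ i : Fin d, n ≤ i → v i = 0 := Iff.rfl

theorem initialSubmodule_eq_top {n : ℕ} (h : d ≤ n) : initialSubmodule k d n = ⊤ :=
  eq_top_iff.2 fun _ _ i hi => absurd i.2 (not_lt.2 (h.trans hi))

theorem initialSubmodule_mono {m n : ℕ} (h : m ≤ n) :
    initialSubmodule k d m ≤ initialSubmodule k d n := fun _ hv i hi => hv i (h.trans hi)

theorem finrank_initialSubmodule {n : ℕ} (hn : n ≤ d) :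
    Module.finrank k (initialSubmodule k d n) = n := by
  classical
  let I : Set (Fin d) := {i | (i : ℕ) < n}
  let J : Set (Fin d) := {i | n ≤ (i : ℕ)}
  have h : initialSubmodule k d n =
      ⨅ i ∈ J, LinearMap.ker (LinearMap.proj (R := k) (φ := fun _ : Fin d => k) i) := by
    ext v
    simp [mem_initialSubmodule, J]
  rw [h, (LinearMap.iInfKerProjEquiv k (fun _ : Fin d => k) (I := I) (J := J) ?_ ?_).finrank_eq,
    Module.finrank_fintype_fun_eq_card]
  · rw [Fintype.card_subtype]
    have := Fin.card_filter_val_lt (n := d) (m := n)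
    simp only [I, Set.mem_ofPred_eq]
    omega
  · rw [Set.disjoint_left]
    intro i hi hj
    simp only [I, J, Set.mem_ofPred_eq] at hi hj
    omega
  · intro i _
    simp only [I, J, Set.mem_union, Set.mem_ofPred_eq]
    omega

variable {C : Matrix (Fin d) (Fin d) k} {W : Submodule k (Fin d → k)}

theorem companion_mulVec_succ
    (hC : ∀ i j : Fin d, (j : ℕ) + 1 ≠ d → C i j = if (i : ℕ) = j + 1 then 1 else 0)
    {n : ℕ} (hn : n < d) {v : Fin d → k} (hv : v ∈ initialSubmodule k d n) {j : ℕ}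
    (hj : j + 1 < d) : C.mulVec v ⟨j + 1, hj⟩ = v ⟨j, by omega⟩ := by
  rw [Matrix.mulVec, dotProduct, Finset.sum_eq_single ⟨j, by omega⟩]
  · rw [hC _ _ hj.ne, if_pos rfl, one_mul]
  · intro i _ hi
    by_cases h : (i : ℕ) + 1 = d
    · rw [hv i (by omega), mul_zero]
    · rw [hC _ _ h, if_neg, zero_mul]
      intro h'
      exact hi (Fin.ext (by simpa using h'.symm))
  · simp

/-- The matrix raises the standard flag by one step. If the intersection did not grow, it would be
stable; but the matrix moves each coordinate to the next place, so the vanishing of the late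
coordinates would propagate down to all of them. -/
theorem initialSubmodule_inf_lt
    (hC : ∀ i j : Fin d, (j : ℕ) + 1 ≠ d → C i j = if (i : ℕ) = j + 1 then 1 else 0)
    (hW : ∀ w ∈ W, C.mulVec w ∈ W) {n : ℕ} (hn : n < d) (h0 : initialSubmodule k d n ⊓ W ≠ ⊥) :
    initialSubmodule k d n ⊓ W < initialSubmodule k d (n + 1) ⊓ W := by
  refine lt_of_le_of_ne (inf_le_inf_right W (initialSubmodule_mono n.le_succ)) fun heq => h0 ?_
  have hst : ∀ v ∈ initialSubmodule k d n ⊓ W, C.mulVec v ∈ initialSubmodule k d n ⊓ W := by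
    intro v hv
    rw [heq]
    refine ⟨fun i hi => ?_, hW v hv.2⟩
    have := companion_mulVec_succ hC hn hv.1 (j := i - 1) (by omega)
    rw [show (⟨(i : ℕ) - 1 + 1, by omega⟩ : Fin d) = i from Fin.ext (by simp; omega)] at this
    rw [this]
    exact hv.1 _ (by simp; omega)
  have key : ∀ m ≤ n, initialSubmodule k d n ⊓ W ≤ initialSubmodule k d (n - m) := by
    intro m
    induction m with
    | zero => exact fun _ => inf_le_left
    | succ m ih =>
      intro hm v hv i hi
      rcases (show n - m ≤ (i : ℕ) ∨ (i : ℕ) + 1 = n - m by omega) with h | h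
      · exact ih (by omega) hv i h
      · have h1 := ih (by omega) (hst v hv) ⟨i + 1, by omega⟩ (by simp; omega)
        rwa [companion_mulVec_succ hC hn hv.1] at h1
  have := key n le_rfl
  rw [Nat.sub_self] at this
  exact eq_bot_iff.2 fun v hv => (Submodule.mem_bot k).2 (funext fun i => this hv i (Nat.zero_le _))

/-- A subspace which is stable under a companion matrix is in general position with respect to the
standard flag. -/
theorem finrank_initialSubmodule_inf_le
    (hC : ∀ i j : Fin d, (j : ℕ) + 1 ≠ d → C i j = if (i : ℕ) = j + 1 then 1 else 0)
    (hW : ∀ w ∈ W, C.mulVec w ∈ W) {n : ℕ} (hn : n ≤ d) :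
    (Module.finrank k ↥(initialSubmodule k d n ⊓ W) : ℤ) ≤
      max 0 ((n : ℤ) + Module.finrank k W - d) := by
  rcases eq_or_ne (initialSubmodule k d n ⊓ W) ⊥ with h0 | h0
  · rw [h0, finrank_bot]
    exact le_max_left _ _
  refine le_max_of_le_right ?_
  -- Once nonzero, the intersection gains at least one dimension per step until it becomes `W`.
  have key : ∀ m, n + m ≤ d → initialSubmodule k d (n + m) ⊓ W ≠ ⊥ ∧
      Module.finrank k ↥(initialSubmodule k d n ⊓ W) + m ≤
        Module.finrank k ↥(initialSubmodule k d (n + m) ⊓ W) := by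
    intro m
    induction m with
    | zero => exact fun _ => ⟨h0, le_rfl⟩
    | succ m ih =>
      intro hm
      obtain ⟨h1, h2⟩ := ih (by omega)
      have h3 := initialSubmodule_inf_lt hC hW (show n + m < d by omega) h1
      have h4 := Submodule.finrank_lt_finrank_of_lt h3
      exact ⟨(bot_lt_iff_ne_bot.2 h1 |>.trans h3).ne', by rw [← add_assoc n m 1]; omega⟩
  have h1 := (key (d - n) (by omega)).2
  rw [Nat.add_sub_cancel' hn, initialSubmodule_eq_top le_rfl, top_inf_eq] at h1
  omega

end Companion

/-! ### Matrices over the coefficient ring with prescribed components -/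

section Idempotents

variable {k A L Ω : Type*} [Field k] [Field A] [Algebra k A] [Field L] [Algebra k L]
  [Field Ω] [Algebra k Ω] [Algebra L Ω] [IsScalarTower k L Ω] [FiniteDimensional k A]

theorem exists_embMap_eq_ite [DecidableEq (A →ₐ[k] Ω)]
    (hs : Function.Surjective (algebraMap L Ω)) (τ₀ : A →ₐ[k] Ω) :
    ∃ ε : L ⊗[k] A, ∀ τ, embMap L τ ε = if τ = τ₀ then 1 else 0 := by
  let b := Module.finBasis k A
  obtain ⟨c, hc⟩ := exists_idempotent_coeff b τ₀
  choose c' hc' using fun j => hs (c j)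
  refine ⟨∑ j, c' j ⊗ₜ b j, fun τ => ?_⟩
  rw [map_sum, ← hc τ]
  exact Finset.sum_congr rfl fun j _ => by rw [embMap_tmul, hc']

variable (Ω) in
-- The submodule spanned by `s - t` has zero components, hence dimension zero.
theorem ext_embMap [CharZero k] [IsAlgClosed Ω] {s t : L ⊗[k] A}
    (h : ∀ τ : A →ₐ[k] Ω, embMap L τ s = embMap L τ t) : s = t := by
  classical
  have : Fintype (A →ₐ[k] Ω) := Fintype.ofFinite _
  let N : Submodule (L ⊗[k] A) (Fin 1 → L ⊗[k] A) := Submodule.span _ {fun _ => s - t}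
  have h1 : ∀ τ : A →ₐ[k] Ω, comp τ N = ⊥ := by
    intro τ
    rw [eq_bot_iff, comp, Submodule.span_le]
    rintro _ ⟨v, hv, rfl⟩
    obtain ⟨a, rfl⟩ := Submodule.mem_span_singleton.1 hv
    refine (Submodule.mem_bot Ω).2 (funext fun i => ?_)
    simp [h τ]
  have h2 := finrank_eq_sum_comp (Ω := Ω) N
  rw [Finset.sum_eq_zero fun τ _ => by rw [h1 τ, finrank_bot]] at h2
  have h3 : (N.restrictScalars L) = ⊥ := Submodule.finrank_eq_zero.1 h2
  have h4 : (fun _ => s - t) ∈ N.restrictScalars L := Submodule.mem_span_singleton_self _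
  rw [h3, Submodule.mem_bot] at h4
  exact sub_eq_zero.1 (congrFun h4 0)

theorem exists_generalLinearGroup_map_embMap_eq_ite [CharZero k] [IsAlgClosed Ω]
    [DecidableEq (A →ₐ[k] Ω)] (hs : Function.Surjective (algebraMap L Ω)) (τ₀ : A →ₐ[k] Ω) {d : ℕ}
    (C : GL (Fin d) L) : ∃ g : GL (Fin d) (L ⊗[k] A), ∀ τ : A →ₐ[k] Ω,
      (g : Matrix (Fin d) (Fin d) (L ⊗[k] A)).map (embMap L τ) =
        if τ = τ₀ then (C : Matrix (Fin d) (Fin d) L).map (algebraMap L Ω) else 1 := by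
  obtain ⟨ε, hε⟩ := exists_embMap_eq_ite hs τ₀
  -- The matrix `1 + ε (B - 1)` has component `B` at `τ₀` and `1` elsewhere, so `M B⁻¹` is its
  -- inverse for invertible `B`.
  let M : Matrix (Fin d) (Fin d) L → Matrix (Fin d) (Fin d) (L ⊗[k] A) := fun B =>
    ε • (B.map (algebraMap L (L ⊗[k] A)) - 1) + 1
  have hM : ∀ B τ, (M B).map (embMap L τ) =
      if τ = τ₀ then B.map (algebraMap L Ω) else 1 := by
    intro B τ
    ext i j
    have h1 : embMap L τ ((1 : Matrix (Fin d) (Fin d) (L ⊗[k] A)) i j) =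
        (1 : Matrix (Fin d) (Fin d) Ω) i j := by
      rw [Matrix.one_apply, Matrix.one_apply]
      split_ifs <;> simp
    change embMap L τ (ε * (algebraMap L (L ⊗[k] A) (B i j) -
      (1 : Matrix (Fin d) (Fin d) (L ⊗[k] A)) i j) + (1 : Matrix _ _ (L ⊗[k] A)) i j) = _
    rw [map_add, map_mul, map_sub, h1, hε, AlgHom.commutes]
    split_ifs <;> simp
  have hmul : ∀ B B', B * B' = 1 → M B * M B' = 1 := by
    intro B B' h
    ext i j
    refine ext_embMap Ω fun τ => ?_
    have h1 : (M B * M B').map (embMap L τ) = (1 : Matrix _ _ (L ⊗[k] A)).map (embMap L τ) := by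
      rw [Matrix.map_mul, hM, hM, Matrix.map_one _ (map_zero _) (map_one _)]
      split_ifs
      · rw [← Matrix.map_mul, h, Matrix.map_one _ (map_zero _) (map_one _)]
      · rw [one_mul]
    exact congrFun (congrFun h1 i) j
  exact ⟨⟨M C, M C⁻¹, hmul _ _ (by simp), hmul _ _ (by simp)⟩, hM _⟩

end Idempotents

/-! ### A Frobenius whose `f`-th power is a companion matrix -/

section FrobeniusCompanion

variable {p : ℕ} [Fact p.Prime] {K : Type*} [Field K] [Algebra ℚ_[p] K]
  {d : ℕ} {L : Type*} [NormedField L] [Algebra ℚ_[p] L]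
  {Ω : Type*} [Field Ω] [Algebra ℚ_[p] Ω] [Algebra L Ω] [IsScalarTower ℚ_[p] L Ω]
  {φ : maxUnramified p K ≃ₐ[ℚ_[p]] maxUnramified p K} {g : GL (Fin d) (CoeffRing p K L)}
  {C : Matrix (Fin d) (Fin d) L}
  {D' : Submodule (CoeffRing p K L) (Fin d → CoeffRing p K L)}

theorem embMap_frob (τ : maxUnramified p K →ₐ[ℚ_[p]] Ω) (v : Fin d → CoeffRing p K L) :
    (fun i => embMap L τ (frob φ g v i)) =
      ((g : Matrix (Fin d) (Fin d) (CoeffRing p K L)).map (embMap L τ)).mulVec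
        fun i => embMap L (twist φ τ 1) (v i) := by
  ext i
  simp only [frob_apply, Matrix.mulVec, dotProduct, map_sum, map_mul, embMap_map]
  rfl

/-- The `n`-th iterate at `τ` multiplies the components of `g` along the first `n` twists of `τ`;
only the twists equal to `τ₀` contribute a factor `B`. -/
theorem embMap_frob_pow [DecidableEq (maxUnramified p K →ₐ[ℚ_[p]] Ω)]
    {τ₀ : maxUnramified p K →ₐ[ℚ_[p]] Ω} {B : Matrix (Fin d) (Fin d) Ω}
    (hg : ∀ τ : maxUnramified p K →ₐ[ℚ_[p]] Ω,
      (g : Matrix (Fin d) (Fin d) (CoeffRing p K L)).map (embMap L τ) = if τ = τ₀ then B else 1)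
    (τ : maxUnramified p K →ₐ[ℚ_[p]] Ω) (n : ℕ) (v : Fin d → CoeffRing p K L) :
    (fun i => embMap L τ (((frob φ g) ^ n) v i)) =
      (B ^ ((Finset.range n).filter fun j => twist φ τ j = τ₀).card).mulVec
        fun i => embMap L (twist φ τ n) (v i) := by
  induction n generalizing v with
  | zero =>
    simp only [pow_zero, Finset.range_zero, Finset.filter_empty, Finset.card_empty,
      Matrix.one_mulVec]
    rfl
  | succ n ih =>
    rw [pow_succ, Module.End.mul_apply, ih, embMap_frob, ← twist_succ, hg, Matrix.mulVec_mulVec,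
      Finset.range_add_one, Finset.filter_insert]
    split_ifs
    · rw [Finset.card_insert_of_notMem (by simp), pow_succ]
    · rw [mul_one]

/-- In `f` steps the cycle meets `τ₀` exactly once and returns to `τ`, so a matrix placed at one
embedding appears at all of them. -/
theorem IsFrobeniusLift.embMap_frob_pow_inertiaDeg [FiniteDimensional ℚ_[p] K]
    (hφ : IsFrobeniusLift φ) [DecidableEq (maxUnramified p K →ₐ[ℚ_[p]] Ω)]
    {τ₀ : maxUnramified p K →ₐ[ℚ_[p]] Ω} {B : Matrix (Fin d) (Fin d) Ω}
    (hg : ∀ τ : maxUnramified p K →ₐ[ℚ_[p]] Ω,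
      (g : Matrix (Fin d) (Fin d) (CoeffRing p K L)).map (embMap L τ) = if τ = τ₀ then B else 1)
    (τ : maxUnramified p K →ₐ[ℚ_[p]] Ω) (v : Fin d → CoeffRing p K L) :
    (fun i => embMap L τ (((frob φ g) ^ inertiaDeg p K) v i)) =
      B.mulVec fun i => embMap L τ (v i) := by
  have : Fintype (maxUnramified p K →ₐ[ℚ_[p]] Ω) := Fintype.ofFinite _
  have h1 : ((Finset.range (inertiaDeg p K)).filter fun j => twist φ τ j = τ₀).card = 1 := by
    have := Finset.mem_univ τ₀
    rw [← hφ.image_twist τ, Finset.mem_image] at this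
    obtain ⟨j, hj, hjτ⟩ := this
    refine Finset.card_eq_one.2 ⟨j, Finset.eq_singleton_iff_unique_mem.2
      ⟨Finset.mem_filter.2 ⟨hj, hjτ⟩, fun i hi => ?_⟩⟩
    rw [Finset.mem_filter] at hi
    exact hφ.injOn_twist τ (Finset.mem_coe.2 hi.1) (Finset.mem_coe.2 hj) (hi.2.trans hjτ.symm)
  have h2 : twist φ τ (inertiaDeg p K) = τ := by
    rw [twist, ← hφ.orderOf_eq, pow_orderOf_eq_one]
    rfl
  rw [embMap_frob_pow hg, h1, h2, pow_one]

theorem map_charpoly_eq_of_apply_eq_tmul {k A : Type*} [Field k] [Field A] [Algebra k A]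
    [Algebra k L] {N : Matrix (Fin d) (Fin d) (L ⊗[k] A)} (h : ∀ i j, N i j = C i j ⊗ₜ 1) :
    C.charpoly.map (algebraMap L (L ⊗[k] A)) = N.charpoly := by
  have : N = C.map (algebraMap L (L ⊗[k] A)) := by
    ext i j
    exact h i j
  rw [this, Matrix.charpoly_map]

theorem frobPowMatrix_apply_eq_tmul [FiniteDimensional ℚ_[p] K] [IsAlgClosed Ω]
    (h : ∀ (τ : maxUnramified p K →ₐ[ℚ_[p]] Ω) (v : Fin d → CoeffRing p K L),
      (fun i => embMap L τ (((frob φ g) ^ inertiaDeg p K) v i)) =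
        (C.map (algebraMap L Ω)).mulVec fun i => embMap L τ (v i)) (i j : Fin d) :
    frobPowMatrix φ g i j = C i j ⊗ₜ 1 := by
  refine ext_embMap Ω fun τ => ?_
  rw [embMap_tmul, map_one, mul_one]
  refine (congrFun (h τ (Pi.single j 1)) i).trans ?_
  have : (fun i => embMap L τ ((Pi.single j 1 : Fin d → CoeffRing p K L) i)) = Pi.single j 1 := by
    ext i
    rcases eq_or_ne i j with rfl | h <;> simp [*]
  rw [this, Matrix.mulVec_single_one]
  rfl

theorem isFrobCharpoly_charpoly [FiniteDimensional ℚ_[p] K] [IsAlgClosed Ω]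
    (h : ∀ (τ : maxUnramified p K →ₐ[ℚ_[p]] Ω) (v : Fin d → CoeffRing p K L),
      (fun i => embMap L τ (((frob φ g) ^ inertiaDeg p K) v i)) =
        (C.map (algebraMap L Ω)).mulVec fun i => embMap L τ (v i)) :
    IsFrobCharpoly φ g C.charpoly :=
  map_charpoly_eq_of_apply_eq_tmul (frobPowMatrix_apply_eq_tmul h)

theorem IsStable.mulVec_mem_comp (hD : IsStable φ g D') {B : Matrix (Fin d) (Fin d) Ω}
    {τ : maxUnramified p K →ₐ[ℚ_[p]] Ω}
    (h : ∀ v : Fin d → CoeffRing p K L,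
      (fun i => embMap L τ (((frob φ g) ^ inertiaDeg p K) v i)) =
        B.mulVec fun i => embMap L τ (v i)) {w : Fin d → Ω} (hw : w ∈ comp τ D') :
    B.mulVec w ∈ comp τ D' := by
  have hpow : ∀ (n : ℕ), ∀ v ∈ D', ((frob φ g) ^ n) v ∈ D' := by
    intro n
    induction n with
    | zero => exact fun v hv => hv
    | succ n ih =>
      intro v hv
      rw [pow_succ, Module.End.mul_apply]
      exact ih _ (hD v hv)
  have : comp τ D' ≤ (comp τ D').comap B.mulVecLin := by
    rw [comp, Submodule.span_le]
    rintro _ ⟨v, hv, rfl⟩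
    rw [SetLike.mem_coe, Submodule.mem_comap, Matrix.mulVecLin_apply, ← h]
    exact mem_comp_of_mem τ (hpow _ v hv)
  exact this hw

end FrobeniusCompanion

end FilteredPhi

namespace FilteredPhi

/-! ### Submodules with components in the standard flag -/

section SplitFiltration

variable {k A L Ω : Type*} [Field k] [Field A] [Algebra k A] [Field L] [Algebra k L]
  [Field Ω] [Algebra k Ω] [Algebra L Ω] [IsScalarTower k L Ω] {d : ℕ}

/-- The submodule of `(L ⊗ A) ^ d` whose component at `τ` consists of the vectors supported on the
first `n τ` coordinates. -/
def initialSubmoduleTensor (L : Type*) [Field L] [Algebra k L] [Algebra L Ω] [IsScalarTower k L Ω]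
    (d : ℕ) (n : (A →ₐ[k] Ω) → ℕ) : Submodule (L ⊗[k] A) (Fin d → L ⊗[k] A) where
  carrier := {v | ∀ τ, (fun i => embMap L τ (v i)) ∈ initialSubmodule Ω d (n τ)}
  add_mem' := fun {v w} hv hw τ i hi => by
    change embMap L τ (v i + w i) = 0
    rw [map_add]
    exact (congrArg₂ _ (hv τ i hi) (hw τ i hi)).trans (add_zero 0)
  zero_mem' := fun _ _ _ => map_zero _
  smul_mem' := fun c v hv τ i hi => by
    change embMap L τ (c * v i) = 0
    rw [map_mul]
    exact (congrArg _ (hv τ i hi)).trans (mul_zero _)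

theorem initialSubmoduleTensor_mono {m n : (A →ₐ[k] Ω) → ℕ} (h : m ≤ n) :
    initialSubmoduleTensor L d m ≤ initialSubmoduleTensor L d n :=
  fun _ hv τ => initialSubmodule_mono (h τ) (hv τ)

theorem initialSubmoduleTensor_eq_top {n : (A →ₐ[k] Ω) → ℕ} (h : ∀ τ, d ≤ n τ) :
    initialSubmoduleTensor L d n = ⊤ :=
  eq_top_iff.2 fun _ _ τ => by rw [initialSubmodule_eq_top (h τ)]; trivial

variable [FiniteDimensional k A]

theorem initialSubmoduleTensor_zero [CharZero k] [IsAlgClosed Ω] :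
    initialSubmoduleTensor L d (0 : (A →ₐ[k] Ω) → ℕ) = ⊥ := by
  refine eq_bot_iff.2 fun v hv => (Submodule.mem_bot _).2 (funext fun i => ?_)
  refine ext_embMap Ω fun τ => ?_
  rw [Pi.zero_apply, map_zero]
  exact hv τ i (Nat.zero_le _)

theorem comp_initialSubmoduleTensor (hs : Function.Surjective (algebraMap L Ω))
    (n : (A →ₐ[k] Ω) → ℕ) (τ : A →ₐ[k] Ω) :
    comp τ (initialSubmoduleTensor L d n) = initialSubmodule Ω d (n τ) := by
  classical
  refine le_antisymm (Submodule.span_le.2 ?_) fun w hw => ?_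
  · rintro _ ⟨v, hv, rfl⟩
    exact hv τ
  · obtain ⟨ε, hε⟩ := exists_embMap_eq_ite hs τ
    choose w' hw' using fun i => hs (w i)
    have hv : ∀ τ' i, embMap L τ' (ε * algebraMap L (L ⊗[k] A) (w' i)) =
        if τ' = τ then w i else 0 := by
      intro τ' i
      rw [map_mul, hε, AlgHom.commutes, hw', ite_mul, one_mul, zero_mul]
    have h1 : (fun i => ε * algebraMap L (L ⊗[k] A) (w' i)) ∈ initialSubmoduleTensor L d n := by
      intro τ' i hi
      refine (hv τ' i).trans ?_
      split_ifs with h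
      · subst h
        exact hw i hi
      · rfl
    have h2 := mem_comp_of_mem τ h1
    simp only [hv, if_pos] at h2
    exact h2

end SplitFiltration

/-! ### Galois invariance over the reflex field -/

section ReflexField

theorem exists_algEquiv_comp_eq {E N Ω : Type*} [Field E] [Field N] [Field Ω] [Algebra E N]
    [Algebra E Ω] [Normal E N] (ι₁ ι : N →ₐ[E] Ω) :
    ∃ σ : N ≃ₐ[E] N, ι = ι₁.comp (σ : N →ₐ[E] N) := by
  let _ := ι₁.toRingHom.toAlgebra
  have : IsScalarTower E N Ω := IsScalarTower.of_algebraMap_eq' ι₁.comp_algebraMap.symm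
  refine ⟨Normal.algHomEquivAut E Ω N ι, ?_⟩
  exact ((Normal.algHomEquivAut E Ω N).symm_apply_apply ι).symm

variable {p : ℕ} [Fact p.Prime] {K : Type*} [Field K] [Algebra ℚ_[p] K] {d : ℕ}
  (ν : DominantCocharacter p K d)

/-- The stabilizer contains the group fixing the compositum of the finitely many fields `ψ(K)`. It
is thus open, hence closed, and the Galois correspondence applies. -/
theorem DominantCocharacter.fixingSubgroup_reflexField [FiniteDimensional ℚ_[p] K] :
    ν.reflexField.fixingSubgroup = ν.stabilizer := by
  have hle : (⨆ ψ : K →ₐ[ℚ_[p]] PadicAlgCl p, ψ.fieldRange).fixingSubgroup ≤ ν.stabilizer := by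
    intro σ hσ ψ
    congr 1
    ext x
    exact (IntermediateField.mem_fixingSubgroup_iff _ _).1 hσ (ψ x)
      (le_iSup (fun ψ : K →ₐ[ℚ_[p]] PadicAlgCl p => ψ.fieldRange) ψ ⟨x, rfl⟩)
  have : ∀ ψ : K →ₐ[ℚ_[p]] PadicAlgCl p, FiniteDimensional ℚ_[p] ψ.fieldRange := fun ψ =>
    inferInstanceAs (FiniteDimensional ℚ_[p] (LinearMap.range ψ.toLinearMap))
  have hopen : IsOpen (ν.stabilizer : Set (PadicAlgCl p ≃ₐ[ℚ_[p]] PadicAlgCl p)) :=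
    Subgroup.isOpen_mono hle (IntermediateField.fixingSubgroup_isOpen _)
  exact InfiniteGalois.fixingSubgroup_fixedField ⟨ν.stabilizer, Subgroup.isClosed_of_isOpen _ hopen⟩

theorem DominantCocharacter.toFun_algEquiv_comp [FiniteDimensional ℚ_[p] K]
    (σ : PadicAlgCl p ≃ₐ[ν.reflexField] PadicAlgCl p) (ψ : K →ₐ[ℚ_[p]] PadicAlgCl p) :
    ν.toFun (((σ : PadicAlgCl p →ₐ[ν.reflexField] PadicAlgCl p).restrictScalars ℚ_[p]).comp ψ) =
      ν.toFun ψ := by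
  have h : σ.restrictScalars ℚ_[p] ∈ ν.stabilizer := by
    rw [← ν.fixingSubgroup_reflexField, IntermediateField.mem_fixingSubgroup_iff]
    exact fun x hx => σ.commutes ⟨x, hx⟩
  exact h ψ

theorem DominantCocharacter.stepRank_congr {ψ ψ' : K →ₐ[ℚ_[p]] PadicAlgCl p}
    (h : ν.toFun ψ = ν.toFun ψ') (x : ℤ) : ν.stepRank ψ x = ν.stepRank ψ' x := by
  rw [stepRank, stepRank, h]

theorem DominantCocharacter.stepRank_antitone (ψ : K →ₐ[ℚ_[p]] PadicAlgCl p) :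
    Antitone (ν.stepRank ψ) := fun _ _ h =>
  Finset.card_le_card fun _ hk => by
    rw [Finset.mem_filter] at hk ⊢
    exact ⟨hk.1, h.trans hk.2⟩

theorem DominantCocharacter.stepRank_eq_add_card (ψ : K →ₐ[ℚ_[p]] PadicAlgCl p) (x : ℤ) :
    ν.stepRank ψ x = ν.stepRank ψ (x + 1) +
      (Finset.univ.filter fun k : Fin d => ν.toFun ψ k = x).card := by
  rw [stepRank, stepRank, ← Finset.card_union_of_disjoint]
  · congr 1
    ext k
    simp only [Finset.mem_filter, Finset.mem_univ, true_and, Finset.mem_union]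
    omega
  · rw [Finset.disjoint_filter]
    intro k _ h1 h2
    omega

theorem DominantCocharacter.exists_forall_stepRank_eq [FiniteDimensional ℚ_[p] K] :
    (∃ x, ∀ ψ, ν.stepRank ψ x = d) ∧ ∃ x, ∀ ψ, ν.stepRank ψ x = 0 := by
  obtain ⟨a, ha⟩ := (Set.finite_range fun q : (K →ₐ[ℚ_[p]] PadicAlgCl p) × Fin d =>
    ν.toFun q.1 q.2).bddBelow
  obtain ⟨b, hb⟩ := (Set.finite_range fun q : (K →ₐ[ℚ_[p]] PadicAlgCl p) × Fin d =>
    ν.toFun q.1 q.2).bddAbove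
  refine ⟨⟨a, fun ψ => ?_⟩, b + 1, fun ψ => ?_⟩
  · rw [stepRank, Finset.filter_true_of_mem fun k _ => ha ⟨(ψ, k), rfl⟩, Finset.card_univ,
      Fintype.card_fin]
  · rw [stepRank, Finset.card_eq_zero, Finset.filter_eq_empty_iff]
    intro k _ h
    have := hb ⟨(ψ, k), rfl⟩
    simp only at this
    omega

end ReflexField

/-! ### A filtration of minimal degree on stable submodules -/

section Existence

variable {p : ℕ} [hpr : Fact p.Prime] {K : Type*} [Field K] [Algebra ℚ_[p] K]
  [FiniteDimensional ℚ_[p] K] {d : ℕ} {L : Type*} [NormedField L] [Algebra ℚ_[p] L]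
  {φ : maxUnramified p K ≃ₐ[ℚ_[p]] maxUnramified p K} {g : GL (Fin d) (CoeffRing p K L)}
  {ν : DominantCocharacter p K d}

/-- A filtration whose components are all contained in the standard flag. -/
theorem exists_filtration_comp_eq (ν : DominantCocharacter p K d)
    (hs : Function.Surjective (algebraMap L (AlgebraicClosure L)))
    (ι : PadicAlgCl p →ₐ[ℚ_[p]] AlgebraicClosure L) :
    ∃ F : Filtration p K d L, ∀ ψ x, comp (ι.comp ψ) (F.step x) =
      initialSubmodule (AlgebraicClosure L) d (ν.stepRank ψ x) := by
  have hinj : Function.Injective fun ψ : K →ₐ[ℚ_[p]] PadicAlgCl p => ι.comp ψ := fun ψ ψ' h =>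
    AlgHom.ext fun x => ι.injective (congrArg (fun f => f x) h)
  have hbij : Function.Bijective fun ψ : K →ₐ[ℚ_[p]] PadicAlgCl p => ι.comp ψ := by
    have : Fintype (K →ₐ[ℚ_[p]] AlgebraicClosure L) := Fintype.ofFinite _
    refine (Fintype.bijective_iff_injective_and_card _).2 ⟨hinj, ?_⟩
    rw [card_algHom_eq_finrank, card_algHom_eq_finrank]
  let e := Equiv.ofBijective _ hbij
  obtain ⟨⟨a, ha⟩, b, hb⟩ := ν.exists_forall_stepRank_eq
  refine ⟨⟨fun x => initialSubmoduleTensor L d fun τ => ν.stepRank (e.symm τ) x, fun x y h =>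
    initialSubmoduleTensor_mono fun τ => ν.stepRank_antitone _ h,
    ⟨a, initialSubmoduleTensor_eq_top fun τ => (ha _).ge⟩, ⟨b, ?_⟩⟩, fun ψ x => ?_⟩
  · simp only [hb]
    exact initialSubmoduleTensor_zero
  · rw [comp_initialSubmoduleTensor hs, show ι.comp ψ = e ψ from rfl, e.symm_apply_apply]

/-- Any other embedding of `PadicAlgCl p` differs from `ι` by an automorphism over the reflex field,
which leaves `ν` unchanged. -/
theorem isOfType_of_comp_eq [Algebra ν.reflexField L] [IsScalarTower ℚ_[p] ν.reflexField L]
    {F : Filtration p K d L} (ι : PadicAlgCl p →ₐ[ν.reflexField] AlgebraicClosure L)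
    (hF : ∀ ψ x, comp ((ι.restrictScalars ℚ_[p]).comp ψ) (F.step x) =
      initialSubmodule (AlgebraicClosure L) d (ν.stepRank ψ x)) : F.IsOfType ν := by
  intro ι' ψ x
  obtain ⟨σ, rfl⟩ := exists_algEquiv_comp_eq ι ι'
  have h : ∀ y, Module.finrank (AlgebraicClosure L) (component
      ((ι.comp (σ : PadicAlgCl p →ₐ[ν.reflexField] PadicAlgCl p)).restrictScalars ℚ_[p]) ψ
      (F.step y)) = ν.stepRank ψ y := by
    intro y
    rw [component_eq_comp, ← ν.stepRank_congr (ν.toFun_algEquiv_comp σ ψ),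
      ← finrank_initialSubmodule (k := AlgebraicClosure L) (ν.stepRank_le _ y), ← hF]
    rfl
  rw [h, h, ν.stepRank_eq_add_card]

/-- Every component of a stable submodule is stable under the companion matrix, hence in general
position with respect to the flag. -/
theorem IsStable.filtrationDegree_le_l_of_companion [Algebra ν.reflexField L]
    [IsScalarTower ℚ_[p] ν.reflexField L] {F : Filtration p K d L} {C : Matrix (Fin d) (Fin d) L}
    (hC : ∀ i j : Fin d, (j : ℕ) + 1 ≠ d → C i j = if (i : ℕ) = j + 1 then 1 else 0)
    (hg : ∀ (τ : maxUnramified p K →ₐ[ℚ_[p]] AlgebraicClosure L) (v : Fin d → CoeffRing p K L),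
      (fun i => embMap L τ (((frob φ g) ^ inertiaDeg p K) v i)) =
        (C.map (algebraMap L (AlgebraicClosure L))).mulVec fun i => embMap L τ (v i))
    (ι : PadicAlgCl p →ₐ[ν.reflexField] AlgebraicClosure L)
    (hF : ∀ ψ x, comp ((ι.restrictScalars ℚ_[p]).comp ψ) (F.step x) =
      initialSubmodule (AlgebraicClosure L) d (ν.stepRank ψ x))
    {D' : Submodule (CoeffRing p K L) (Fin d → CoeffRing p K L)} (h : IsStable φ g D') {r : ℕ}
    (hr : r ≤ d) (hD' : ∀ τ : maxUnramified p K →ₐ[ℚ_[p]] AlgebraicClosure L,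
      Module.finrank (AlgebraicClosure L) (comp τ D') = r) :
    filtrationDegree F D' ≤ ν.l r := by
  refine Filtration.IsOfType.filtrationDegree_le_l ι hr hD' fun ψ x => ?_
  rw [hF, ← hD' (((ι.restrictScalars ℚ_[p]).comp ψ).comp (maxUnramified p K).val)]
  refine finrank_initialSubmodule_inf_le (C := C.map (algebraMap L (AlgebraicClosure L)))
    (fun i j hj => ?_) (fun w hw => h.mulVec_mem_comp (hg _) hw) (ν.stepRank_le ψ x)
  rw [Matrix.map_apply, hC i j hj]
  split_ifs <;> simp

end Existence

/-! ### The coefficient bounds imply weak admissibility -/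

section SufficientCondition

/-- The constant term of `A` and the leading term of `B` bound their Gauss norms from below, and the
product of these norms is a power of that of `P`. -/
theorem norm_coeff_zero_mul_le_of_mul_eq_pow {L : Type*} [NontriviallyNormedField L]
    [IsUltrametricDist L] {A B P : Polynomial L} {n : ℕ} (hB : B.Monic) (hAB : A * B = P ^ n)
    {r M : ℝ} (hr : 0 < r) (hM : ∀ k, ‖P.coeff k‖ * r ^ k ≤ M) :
    ‖A.coeff 0‖ * r ^ B.natDegree ≤ M ^ n := by
  have hna := isNonarchimedean_toAbsoluteValue (L := L)
  have hpow : ∀ m, (P ^ m).gaussNorm (NormedField.toAbsoluteValue L) r =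
      P.gaussNorm (NormedField.toAbsoluteValue L) r ^ m := by
    intro m
    induction m with
    | zero => rw [pow_zero, pow_zero, ← Polynomial.C_1, Polynomial.gaussNorm_C, map_one]
    | succ m ih => rw [pow_succ, pow_succ, Polynomial.gaussNorm_mul hna hr, ih]
  have h1 := A.le_gaussNorm (NormedField.toAbsoluteValue L) hr.le 0
  have h2 := B.le_gaussNorm (NormedField.toAbsoluteValue L) hr.le B.natDegree
  rw [pow_zero, mul_one] at h1
  rw [hB.coeff_natDegree, map_one, one_mul] at h2
  obtain ⟨k, hk⟩ := P.exists_eq_gaussNorm (NormedField.toAbsoluteValue L) r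
  calc ‖A.coeff 0‖ * r ^ B.natDegree
      ≤ A.gaussNorm (NormedField.toAbsoluteValue L) r *
        B.gaussNorm (NormedField.toAbsoluteValue L) r :=
        mul_le_mul h1 h2 (by positivity) (Polynomial.gaussNorm_nonneg _ _ hr.le)
    _ = P.gaussNorm (NormedField.toAbsoluteValue L) r ^ n := by
        rw [← Polynomial.gaussNorm_mul hna hr, hAB, hpow]
    _ ≤ M ^ n := pow_le_pow_left₀ (Polynomial.gaussNorm_nonneg _ _ hr.le) (hk ▸ hM k) n

variable {p : ℕ} [hpr : Fact p.Prime] {K : Type*} [Field K] [Algebra ℚ_[p] K]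
  [FiniteDimensional ℚ_[p] K] {d : ℕ} {ν : DominantCocharacter p K d}
  {L : Type*} [NormedField L] [IsUltrametricDist L]

/-- For a supporting slope `s` at `r`, the hypothesis bounds the Gauss norm of `P` at radius `p ^ s`
by `p ^ (bound r + s (d - r))`. As `deg B = f (d - r)`, the terms in `s` cancel. -/
theorem norm_coeff_zero_le_of_mul_eq_pow_inertiaDeg (hp : ‖(p : L)‖ = (p : ℝ)⁻¹)
    {A B P : Polynomial L}
    (hA : A.Monic) (hB : B.Monic) (hd : P.natDegree = d)
    (hAB : A * B = P ^ inertiaDeg p K) {r : ℕ} (hr : r ≤ d)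
    (hdeg : A.natDegree = inertiaDeg p K * r)
    (h : ∀ j ≤ d, ‖P.coeff (d - j)‖ ≤ (p : ℝ) ^ ν.bound j) :
    ‖A.coeff 0‖ ≤ (p : ℝ) ^ (inertiaDeg p K * ν.bound r) := by
  have h0 : (0 : ℝ) < p := by exact_mod_cast hpr.out.pos
  have h1 : (1 : ℝ) < p := by exact_mod_cast hpr.out.one_lt
  let : NontriviallyNormedField L := NontriviallyNormedField.ofNormNeOne
    ⟨p, fun h => by
      rw [h, norm_zero, eq_comm, inv_eq_zero] at hp
      exact h0.ne' hp, by rw [hp]; exact (inv_lt_one_of_one_lt₀ h1).ne⟩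
  obtain ⟨s, hs⟩ := ν.exists_supergradient hr
  have hBd : (B.natDegree : ℝ) = inertiaDeg p K * ((d : ℝ) - r) := by
    have h2 := congrArg Polynomial.natDegree hAB
    rw [hA.natDegree_mul hB, hdeg, Polynomial.natDegree_pow, hd] at h2
    have h3 : (inertiaDeg p K : ℝ) * r + B.natDegree = inertiaDeg p K * d := by exact_mod_cast h2
    linarith
  have h2 := norm_coeff_zero_mul_le_of_mul_eq_pow hB hAB (Real.rpow_pos_of_pos h0 s)
    (M := (p : ℝ) ^ (ν.bound r + s * ((d : ℝ) - r))) fun k => by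
      rcases lt_or_ge d k with hk | hk
      · rw [Polynomial.coeff_eq_zero_of_natDegree_lt (hd ▸ hk), norm_zero, zero_mul]
        positivity
      · have h3 := h (d - k) (Nat.sub_le d k)
        rw [Nat.sub_sub_self hk] at h3
        refine (mul_le_mul_of_nonneg_right h3 (by positivity)).trans ?_
        rw [← Real.rpow_mul_natCast h0.le, ← Real.rpow_add h0, Real.rpow_le_rpow_left_iff h1]
        have h4 := hs (d - k) (Nat.sub_le d k)
        rw [Nat.cast_sub hk] at h4
        linarith
  rw [← Real.rpow_mul_natCast h0.le, ← Real.rpow_mul_natCast h0.le, ← le_div_iff₀ (by positivity),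
    ← Real.rpow_sub h0] at h2
  refine h2.trans_eq (congrArg _ ?_)
  rw [hBd]
  ring

variable [Algebra ℚ_[p] L] [Algebra ν.reflexField L] [IsScalarTower ℚ_[p] ν.reflexField L]
  {φ : maxUnramified p K ≃ₐ[ℚ_[p]] maxUnramified p K} {g : GL (Fin d) (CoeffRing p K L)}
  {F : Filtration p K d L} {P : Polynomial L}

theorem isWeaklyAdmissible_of_norm_coeff_le (hφ : IsFrobeniusLift φ) (hd : 0 < d)
    (hp : ‖(p : L)‖ = (p : ℝ)⁻¹) (hF : F.IsOfType ν) (hP : IsFrobCharpoly φ g P)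
    (h : ∀ j ≤ d, ‖P.coeff (d - j)‖ ≤ (p : ℝ) ^ ν.bound j)
    (h0 : ‖P.coeff 0‖ = (p : ℝ) ^ ν.bound d)
    (hdeg : ∀ D', IsStable φ g D' → ∀ r ≤ d,
      (∀ τ : maxUnramified p K →ₐ[ℚ_[p]] AlgebraicClosure L,
        Module.finrank (AlgebraicClosure L) (comp τ D') = r) → filtrationDegree F D' ≤ ν.l r) :
    IsWeaklyAdmissible φ g F := by
  have hf : 0 < inertiaDeg p K := inertiaDeg_pos
  have hp0 : (0 : ℝ) < p := by exact_mod_cast hpr.out.pos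
  have hp1 : (1 : ℝ) < p := by exact_mod_cast hpr.out.one_lt
  obtain ⟨hm, hdP⟩ := hP.monic_and_natDegree
  obtain ⟨ι⟩ := exists_embedding_algebraicClosure ν L
  have htop : slope φ g F ⊤ (isStable_top φ g) = 1 := by
    refine (slope_eq_one_iff hp F _ (t := ν.bound d * inertiaDeg p K) ?_ ?_).2 ?_
    · rw [hP.norm_frobPowDet_top hφ, h0, ← Real.rpow_mul_natCast hp0.le]
    · rw [finrank_top_coeffRing]
      positivity
    · rw [hF.filtrationDegree_top ι, DominantCocharacter.bound]
      ring
  refine ⟨fun D' hD' hne => ?_, htop⟩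
  rw [htop]
  obtain ⟨r, hr, hrank, hfin⟩ := hD'.exists_rank hφ (AlgebraicClosure L)
  obtain ⟨A, B, hA, hB, hAB, hAd, hdet⟩ := hP.exists_mul_eq_of_isStable hφ hD'
  have hA0 : 0 < ‖A.coeff 0‖ := by
    refine norm_pos_iff.2 fun hA0 => ?_
    have h1 := congrArg (fun Q => Polynomial.coeff Q 0) hAB
    rw [Polynomial.mul_coeff_zero, hA0, zero_mul, Polynomial.coeff_zero_eq_eval_zero,
      Polynomial.eval_pow, ← Polynomial.coeff_zero_eq_eval_zero] at h1
    rw [eq_zero_of_pow_eq_zero h1.symm, norm_zero] at h0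
    exact (Real.rpow_pos_of_pos hp0 _).ne h0
  have hle := norm_coeff_zero_le_of_mul_eq_pow_inertiaDeg hp hA hB hdP hAB hr (hAd.trans hfin) h
  refine (one_le_slope_iff hp F hD' (t := Real.logb p ‖A.coeff 0‖) ?_ ?_).2 ?_
  · rw [hdet, Real.rpow_logb hp0 hp1.ne' hA0]
  · exact fun h1 => hne ((Submodule.restrictScalars_eq_bot_iff L _ _).1
      (Submodule.finrank_eq_zero.1 h1))
  · rw [← Real.logb_le_iff_le_rpow hp1 hA0] at hle
    refine hle.trans ?_
    have h1 := mul_le_mul_of_nonneg_left (hdeg D' hD' r hr hrank) (sq_nonneg (inertiaDeg p K : ℝ))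
    rw [DominantCocharacter.bound]
    linarith

/-- Over an algebraically closed field, a polynomial in the closed Newton stratum of `ν` is the
characteristic polynomial of the Frobenius of a weakly admissible filtered isocrystal. -/
theorem exists_isWeaklyAdmissible [IsAlgClosed L] (ν : DominantCocharacter p K d)
    [Algebra ν.reflexField L] [IsScalarTower ℚ_[p] ν.reflexField L] (hφ : IsFrobeniusLift φ)
    (hd : 0 < d) (hp : ‖(p : L)‖ = (p : ℝ)⁻¹) (hm : P.Monic) (hdP : P.natDegree = d)
    (h : ∀ j ≤ d, ‖P.coeff (d - j)‖ ≤ (p : ℝ) ^ ν.bound j)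
    (h0 : ‖P.coeff 0‖ = (p : ℝ) ^ ν.bound d) :
    ∃ (g : GL (Fin d) (CoeffRing p K L)) (F : Filtration p K d L), F.IsOfType ν ∧
      IsFrobCharpoly φ g P ∧ IsWeaklyAdmissible φ g F := by
  classical
  have hp0 : (0 : ℝ) < p := by exact_mod_cast hpr.out.pos
  have hs : Function.Surjective (algebraMap L (AlgebraicClosure L)) :=
    (IsAlgClosed.algebraMap_bijective_of_isIntegral (k := L)).2
  obtain ⟨ι⟩ := exists_embedding_algebraicClosure ν L
  obtain ⟨F, hF⟩ := exists_filtration_comp_eq ν hs (ι.restrictScalars ℚ_[p])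
  have hFν := isOfType_of_comp_eq ι hF
  obtain ⟨C, rfl, hC⟩ := exists_companion hm hdP
  have hdet : C.det ≠ 0 := by
    intro hdet
    rw [Matrix.det_eq_sign_charpoly_coeff, mul_eq_zero,
      or_iff_right (pow_ne_zero _ (neg_ne_zero.2 one_ne_zero))] at hdet
    rw [hdet, norm_zero] at h0
    exact (Real.rpow_pos_of_pos hp0 _).ne h0
  obtain ⟨τ₀⟩ := nonempty_algHom_of_isAlgebraic ℚ_[p] (maxUnramified p K) (AlgebraicClosure L)
  obtain ⟨g, hg⟩ := exists_generalLinearGroup_map_embMap_eq_ite hs τ₀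
    (Matrix.GeneralLinearGroup.mkOfDetNeZero C hdet)
  have hgf := hφ.embMap_frob_pow_inertiaDeg (g := g) hg
  have hP : IsFrobCharpoly φ g C.charpoly := isFrobCharpoly_charpoly hgf
  exact ⟨g, F, hFν, hP, isWeaklyAdmissible_of_norm_coeff_le hφ hd hp hFν hP h h0
    fun D' hD' r hr hrank => hD'.filtrationDegree_le_l_of_companion hC hgf ι hF hr hrank⟩

end SufficientCondition

/-! ### Fibres over points of the adjoint quotient -/

section Fibres

open Polynomial in
theorem exists_monic_coeff_eq {R : Type*} [CommRing R] [Nontrivial R] {d : ℕ} (c : Fin d → R) :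
    ∃ P : R[X], P.Monic ∧ P.natDegree = d ∧ ∀ i : Fin d, P.coeff (d - ((i : ℕ) + 1)) = c i := by
  let Q : degreeLT R d := (degreeLTEquiv R d).symm (c ∘ Fin.rev)
  have hQ : (Q : R[X]).degree < d := mem_degreeLT.1 Q.2
  refine ⟨X ^ d + (Q : R[X]), monic_X_pow_add hQ, ?_, fun i => ?_⟩
  · rw [add_comm]
    exact natDegree_eq_of_degree_eq_some (degree_add_eq_right_of_degree_lt (by rwa [degree_X_pow])
      |>.trans (degree_X_pow d))
  · rw [coeff_add, coeff_X_pow, if_neg (by omega), zero_add]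
    have h := congrFun ((degreeLTEquiv R d).apply_symm_apply (c ∘ Fin.rev)) (Fin.rev i)
    rw [Function.comp_apply, Fin.rev_rev] at h
    rw [← h, ← Fin.val_rev]
    rfl

variable {p : ℕ} [hpr : Fact p.Prime] {K : Type*} [Field K] [Algebra ℚ_[p] K] {d : ℕ}
  (ν : DominantCocharacter p K d)

theorem norm_natCast_reflexField (n : ℕ) : ‖(n : ν.reflexField)‖ = ‖(n : ℚ_[p])‖ := by
  have h := norm_algebraMap' (PadicAlgCl p) (n : ℚ_[p])
  rw [map_natCast] at h
  exact h

theorem norm_natCast_prime_of_normedAlgebra_reflexField (L : Type*) [NormedField L]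
    [NormedAlgebra ν.reflexField L] : ‖(p : L)‖ = (p : ℝ)⁻¹ := by
  have h := norm_algebraMap' L (p : ν.reflexField)
  rw [map_natCast, norm_natCast_reflexField, Padic.norm_p] at h
  exact h

variable {ν} [FiniteDimensional ℚ_[p] K] {φ : maxUnramified p K ≃ₐ[ℚ_[p]] maxUnramified p K}

theorem mem_closedNewtonStratum_of_mem_weaklyAdmissibleFibre (hφ : IsFrobeniusLift φ) (hd : 0 < d)
    {x : AdjointQuotientAn ν.reflexField d} {z : AnPoint ν}
    (hz : z ∈ weaklyAdmissibleFibre φ ν x) :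
    x ∈ closedNewtonStratum p ν.reflexField ν.muReal := by
  obtain ⟨⟨P, hP, hx⟩, hwa⟩ := hz
  have hp := norm_natCast_prime_of_normedAlgebra_reflexField ν z.L
  have hX : ∀ i : Fin d, x.seminorm (MvPolynomial.X i) = ‖P.coeff (d - ((i : ℕ) + 1))‖ :=
    fun i => by rw [hx, MvPolynomial.aeval_X]
  rw [mem_closedNewtonStratum_iff hd]
  refine ⟨fun i => ?_, ?_⟩
  · rw [hX]
    exact hwa.norm_coeff_le hφ hp z.isOfType hP i.2
  · rw [hX]
    simp only [show d - (d - 1 + 1) = 0 by omega]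
    exact hwa.norm_coeff_zero_eq hφ hd hp z.isOfType hP

theorem nonempty_weaklyAdmissibleFibre (hφ : IsFrobeniusLift φ) (hd : 0 < d)
    {x : AdjointQuotientAn ν.reflexField d}
    (hx : x ∈ closedNewtonStratum p ν.reflexField ν.muReal) :
    (weaklyAdmissibleFibre φ ν x).Nonempty := by
  rw [mem_closedNewtonStratum_iff hd] at hx
  obtain ⟨L, _, _, _, _, _, c, hc⟩ := x.exists_geometric_point
    (fun n => by rw [norm_natCast_reflexField]; exact_mod_cast Padic.norm_int_le_one n)
    ⟨p, by
      have h1 : (1 : ℝ) < p := by exact_mod_cast hpr.out.one_lt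
      rw [norm_natCast_reflexField, Padic.norm_p]
      exact ⟨by positivity, (inv_lt_one_of_one_lt₀ h1).ne⟩⟩
  let : Algebra ℚ_[p] L :=
    ((algebraMap ν.reflexField L).comp (algebraMap ℚ_[p] ν.reflexField)).toAlgebra
  have : IsScalarTower ℚ_[p] ν.reflexField L := IsScalarTower.of_algebraMap_eq fun _ => rfl
  obtain ⟨P, hm, hdP, hcP⟩ := exists_monic_coeff_eq c
  have hX : ∀ i : Fin d, x.seminorm (MvPolynomial.X i) = ‖P.coeff (d - ((i : ℕ) + 1))‖ :=
    fun i => by rw [hc, MvPolynomial.aeval_X, hcP]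
  simp only [hX, show d - (d - 1 + 1) = 0 by omega] at hx
  obtain ⟨g, F, hF, hP, hwa⟩ := exists_isWeaklyAdmissible (φ := φ) (L := L) ν hφ hd
    (norm_natCast_prime_of_normedAlgebra_reflexField ν L) hm hdP (fun j hj => by
      -- The index `0` is the leading coefficient, with bound `p ^ 0`; the remaining ones are the
      -- coordinates of `x`, shifted by one.
      rcases Nat.eq_zero_or_pos j with rfl | h0
      · have h : P.coeff d = 1 := by rw [← hdP, hm.coeff_natDegree]
        rw [Nat.sub_zero, h, norm_one, ν.bound_zero, Real.rpow_zero]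
      · have h := hx.1 ⟨j - 1, by omega⟩
        simpa only [Nat.sub_add_cancel h0] using h) hx.2
  refine ⟨⟨L, g, F, hF⟩, ⟨P, hP, fun Q => ?_⟩, hwa⟩
  rw [hc]
  simp only [hcP]

end Fibres

end FilteredPhi

end

theorem theorem1p2 (p : ℕ) [Fact p.Prime] (K : Type*) [Field K] [Algebra ℚ_[p] K]
    [FiniteDimensional ℚ_[p] K]
    (φ : FilteredPhi.maxUnramified p K ≃ₐ[ℚ_[p]] FilteredPhi.maxUnramified p K)
    (hφ : FilteredPhi.IsFrobeniusLift φ)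
    (d : ℕ) (hd : 0 < d) (ν : FilteredPhi.DominantCocharacter p K d) :
    ν.muReal ∈ FilteredPhi.dominantCone d ∧
    (∀ i : Fin d, (1 / (FilteredPhi.inertiaDeg p K : ℝ)) *
      FilteredPhi.omegaPairing i ν.muReal = -(ν.l ((i : ℕ) + 1) : ℝ)) ∧
    ∀ x : FilteredPhi.AdjointQuotientAn ν.reflexField d,
      (FilteredPhi.weaklyAdmissibleFibre φ ν x).Nonempty ↔
        x ∈ FilteredPhi.closedNewtonStratum p ν.reflexField ν.muReal := by
  refine ⟨ν.muReal_mem_dominantCone, fun i => ?_, fun x => ⟨fun ⟨z, hz⟩ =>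
    FilteredPhi.mem_closedNewtonStratum_of_mem_weaklyAdmissibleFibre hφ hd hz, fun hx =>
    FilteredPhi.nonempty_weaklyAdmissibleFibre hφ hd hx⟩⟩
  have hf : 0 < FilteredPhi.inertiaDeg p K := FilteredPhi.inertiaDeg_pos
  have hf' : (FilteredPhi.inertiaDeg p K : ℝ) ≠ 0 := by positivity
  rw [ν.omegaPairing_muReal, FilteredPhi.DominantCocharacter.bound]
  field_simp
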